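/- All graphs are finite, simple and undirected. A $(3,1)$-completion set of a graph $G=(V,E)$ is a set $E'$ of non-edges of $G$ (pairs of distinct non-adjacent vertices) such that every edge of $G\cup E'$ lies in a triangle of $G\cup E'$; it is optimal if it has minimum cardinality. A graph is chordal if no cycle of length at least four is an induced subgraph of it. The trees of $G$ are the maximal connected subgraphs with at least one edge all of whose edges are bridges of $G$, and $V(T)$ denotes the vertex set of a tree $T$. A vertex is a boundary vertex if it belongs to a tree of $G$ and is incident to an edge of $G$ that is not a bridge. Consider the following algorithm, whose input is a connected chordal graph $G$ with at least three vertices and whose output is the set $E'$ of all edges that it adds. (a) For every tree $T$ of $G$ with $|V(T)|\ge 3$: root $T$ at an arbitrary vertex $r$ and, as long as some edge of $T$ has not been extracted, do the following in the tree formed by the remaining edges. Take a remaining vertex $v$ of maximum depth, and let $u$ be its parent. If $v$ has a remaining sibling $v_1$, extract the edges $uv$ and $uv_1$ and add the edge $vv_1$. If $v$ has no remaining sibling and $u$ has a parent $w$, extract the edges $uv$ and $uw$ and add the edge $vw$. If $uv$ is the only remaining edge, extract it and add one edge between two non-adjacent vertices of $T$ such that $uv$ lies in a triangle of $T$ together with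 the edges added for $T$. (b) For every tree of $G$ with exactly two vertices $u,v$, named so that $u$ is a boundary vertex: add one edge $vw$, where $w\ne v$ is a neighbour of $u$ in $G$. **Theorem.** Let $G=(V,E)$ be a connected chordal graph on $n\ge 3$ vertices with $m$ edges. 1. Every output $E'$ of the algorithm on $G$, whatever choices are made, is an optimal $(3,1)$-completion set of $G$. Moreover, for every tree $T$ of $G$ with $|V(T)|\ge 3$, the edges of $E'$ with both ends in $V(T)$ form an optimal $(3,1)$-completion set of $T$; and every tree of $G$ on two vertices can be written with $V(T)=\{u,v\}$ such that for some neighbour $w$ of $u$ with $\operatorname{dist}_G(v,w)=2$ we have $vw\in E'$, and $uvw$ is the only triangle of $G\cup E'$ that contains $uv$ (so the bridge $uv$ is covered by the single added edge $vw$). 2. The algorithm runs in $O(n+m)$ time: there are a program $P$ for a random access machine and a constant $C$ such that for all such $G$, on vertex set $\{0,\dots,n-1\}$ and given by adjacency lists in any order, $P$ halts after at most $C(n+m)$ steps and outputs (a list without repetition of the elements of) an output $E'$ of the algorithm on $G$, which is an optimal $(3,1)$-completion set of $G$. Here the machine has finitely many registers and arrays of natural numbers, all zero initially except for the input; its unit-cost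 instructions are: setting a register to a constant, copying a register, adding or subtracting one, reading or writing an array entry whose index is in a register, doing nothing, and testing $<$ or $=$ between two registers in conditionals and while loops. -/

import Mathlib

open SimpleGraph

namespace CliqueCover

section Graphs

variable {V : Type*}

/-- A graph is chordal if no cycle of length at least four is an induced subgraph of it. -/
def IsChordal (G : SimpleGraph V) : Prop :=
  ∀ k : ℕ, 4 ≤ k → IsEmpty (cycleGraph k ↪g G)

/-- Every edge lies in at least `l` cliques of order `k`. -/
def HasCover [Finite V] (k l : ℕ) (G : SimpleGraph V) : Prop :=
  ∀ u v : V, G.Adj u v → l ≤ {K : Finset V | G.IsNClique k K ∧ u ∈ K ∧ v ∈ K}.ncard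

/-- The graph `G ∪ S` obtained from `G` by adding the edges in `S`. -/
def addEdges (G : SimpleGraph V) (S : Set (Sym2 V)) : SimpleGraph V :=
  G ⊔ fromEdgeSet S

/-- `S` is a set of non-edges of `G` (loops are not allowed) such that
`G ∪ S` has a `(k, l)`-cover. -/
def IsCompletionSet [Finite V] (k l : ℕ) (G : SimpleGraph V) (S : Set (Sym2 V)) : Prop :=
  (∀ e ∈ S, ¬ e.IsDiag ∧ e ∉ G.edgeSet) ∧ HasCover k l (addEdges G S)

/-- A `(k, l)`-completion set of minimum size. -/
def IsOptimalCompletionSet [Finite V] (k l : ℕ) (G : SimpleGraph V) (S : Set (Sym2 V)) : Prop :=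
  IsCompletionSet k l G S ∧ ∀ S', IsCompletionSet k l G S' → S.ncard ≤ S'.ncard

/-! ### The trees of a graph -/

/-- The spanning subgraph of `G` whose edges are the bridges of `G`. -/
def bridgeGraph (G : SimpleGraph V) : SimpleGraph V where
  Adj u v := G.Adj u v ∧ G.IsBridge s(u, v)
  symm := ⟨fun u v h => ⟨h.1.symm, by rw [Sym2.eq_swap]; exact h.2⟩⟩
  loopless := ⟨fun _ h => h.1.ne rfl⟩

/-- A component of the bridge graph. Those with at least two vertices are the vertex sets of the
trees of `G`, the maximal connected subgraphs formed by bridges; those with one vertex are the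
vertices that lie on no bridge. -/
abbrev BridgeComponent (G : SimpleGraph V) : Type _ := (bridgeGraph G).ConnectedComponent

/-- The tree of `G` on a bridge component, as a graph on all of `V` that has no other edges. -/
def bridgeTree (G : SimpleGraph V) (c : BridgeComponent G) : SimpleGraph V where
  Adj u v := (bridgeGraph G).Adj u v ∧ u ∈ c.supp ∧ v ∈ c.supp
  symm := ⟨fun _ _ h => ⟨h.1.symm, h.2.2, h.2.1⟩⟩
  loopless := ⟨fun _ h => h.1.ne rfl⟩

/-- A boundary vertex: it belongs to a tree and is incident to a non-bridge. -/
def IsBoundary (G : SimpleGraph V) (u : V) : Prop :=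
  (∃ v, (bridgeGraph G).Adj u v) ∧ ∃ w, G.Adj u w ∧ ¬ G.IsBridge s(u, w)

/-! ### The algorithm for trees

`T` is a tree on the vertex set `T.support`, rooted at `r`. A state `(F, S)` consists of the set
`F` of edges that are not yet extracted and the set `S` of edges added so far. -/

/-- `u` is the parent of `v` in what is left of the tree `T` rooted at `r`. -/
def IsParentIn (T : SimpleGraph V) (r : V) (F : Set (Sym2 V)) (u v : V) : Prop :=
  s(u, v) ∈ F ∧ T.dist r v = T.dist r u + 1

/-- `v` is a vertex of maximum depth of what is left of the tree `T` rooted at `r`. -/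
def IsDeepestIn (T : SimpleGraph V) (r : V) (F : Set (Sym2 V)) (v : V) : Prop :=
  (∃ e ∈ F, v ∈ e) ∧ ∀ x, (∃ e ∈ F, x ∈ e) → T.dist r x ≤ T.dist r v

/-- One iteration: take a deepest leaf `v` and its parent `u`. If `v` has a sibling, extract the
path through `v`, `u` and a sibling; if it has none, extract the path through `v`, `u` and the
parent of `u`; in both cases add the edge that closes the path to a triangle. If a single edge is
left, add one edge that puts it into a triangle. -/
inductive TreeStep (T : SimpleGraph V) (r : V) :
    Set (Sym2 V) × Set (Sym2 V) → Set (Sym2 V) × Set (Sym2 V) → Prop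
  | sibling {F S : Set (Sym2 V)} {u v v₁ : V} :
      IsDeepestIn T r F v → IsParentIn T r F u v → IsParentIn T r F u v₁ → v₁ ≠ v →
      TreeStep T r (F, S) (F \ {s(u, v), s(u, v₁)}, insert s(v, v₁) S)
  | path {F S : Set (Sym2 V)} {u v w : V} :
      IsDeepestIn T r F v → IsParentIn T r F u v → (∀ v₁, IsParentIn T r F u v₁ → v₁ = v) →
      IsParentIn T r F w u →
      TreeStep T r (F, S) (F \ {s(u, v), s(w, u)}, insert s(v, w) S)
  | single {S : Set (Sym2 V)} {u v x : V} {e : Sym2 V} :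
      IsParentIn T r {s(u, v)} u v →
      ¬ e.IsDiag → e ∉ T.edgeSet → (∀ y ∈ e, y ∈ T.support) →
      (addEdges T (insert e S)).Adj u x → (addEdges T (insert e S)).Adj v x →
      TreeStep T r ({s(u, v)}, S) (∅, insert e S)

/-- `S` is a possible output of the tree algorithm on `T`, for some choice of the root and of the
vertices and edges picked in the iterations. -/
def IsTreeOutput (T : SimpleGraph V) (S : Set (Sym2 V)) : Prop :=
  ∃ r ∈ T.support, Relation.ReflTransGen (TreeStep T r) (T.edgeSet, ∅) (∅, S)

/-- `S` is a possible output of the algorithm for chordal graphs: `add c` is the set of edges that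
are added for the component `c`. A tree on at least three vertices is handled by the tree
algorithm; for a tree on two vertices `u`, `v` with `u` a boundary vertex, one edge `vw` is
added, where `w ≠ v` is a neighbour of `u`; nothing is added for a vertex that is in no tree. -/
def IsAlgorithmOutput [Finite V] (G : SimpleGraph V) (S : Set (Sym2 V)) : Prop :=
  ∃ add : BridgeComponent G → Set (Sym2 V), S = (⋃ c, add c) ∧
    ∀ c : BridgeComponent G,
      (3 ≤ c.supp.ncard → IsTreeOutput (bridgeTree G c) (add c)) ∧
      (c.supp.ncard = 2 → ∃ u v w : V, c.supp = {u, v} ∧ IsBoundary G u ∧ G.Adj u w ∧ w ≠ v ∧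
        add c = {s(v, w)}) ∧
      (c.supp.ncard ≤ 1 → add c = ∅)

end Graphs

/-! ### A random access machine

Programs work on registers and arrays of natural numbers. There are finitely many of them in a
program. The only arithmetic is adding and subtracting one, so that during `t` steps no
value grows by more than `t` above the input and the constants in the program: words of
logarithmic length suffice for the runs considered here, and unit costs are legitimate. -/

/-- Contents of the registers and of the arrays (`arr a i` is entry `i` of array `a`). -/
structure Memory where
  reg : ℕ → ℕ
  arr : ℕ → ℕ → ℕ

/-- Write a register. -/
def Memory.setReg (M : Memory) (x k : ℕ) : Memory :=
  { M with reg := Function.update M.reg x k }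

/-- Write an entry of an array. -/
def Memory.setArr (M : Memory) (a i k : ℕ) : Memory :=
  { M with arr := Function.update M.arr a (Function.update (M.arr a) i k) }

/-- A test compares two registers. -/
inductive Test where
  | lt (x y : ℕ)
  | eq (x y : ℕ)

/-- The outcome of a test. -/
def Test.Holds (M : Memory) : Test → Prop
  | .lt x y => M.reg x < M.reg y
  | .eq x y => M.reg x = M.reg y

/-- Programs. -/
inductive Program where
  | skip
  | const (x k : ℕ)
  | copy (x y : ℕ)
  | succ (x : ℕ)
  | pred (x : ℕ)
  | load (x a y : ℕ)
  | store (a x y : ℕ)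
  | seq (P Q : Program)
  | ite (b : Test) (P Q : Program)
  | while (b : Test) (P : Program)

/-- `Exec P M t M'`: started in memory `M`, the program `P` halts after `t` steps in memory `M'`.
Every elementary instruction and every evaluation of a test is one step. -/
inductive Exec : Program → Memory → ℕ → Memory → Prop
  | skip {M : Memory} : Exec .skip M 1 M
  | const {M : Memory} {x k : ℕ} : Exec (.const x k) M 1 (M.setReg x k)
  | copy {M : Memory} {x y : ℕ} : Exec (.copy x y) M 1 (M.setReg x (M.reg y))
  | succ {M : Memory} {x : ℕ} : Exec (.succ x) M 1 (M.setReg x (M.reg x + 1))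
  | pred {M : Memory} {x : ℕ} : Exec (.pred x) M 1 (M.setReg x (M.reg x - 1))
  | load {M : Memory} {x a y : ℕ} : Exec (.load x a y) M 1 (M.setReg x (M.arr a (M.reg y)))
  | store {M : Memory} {a x y : ℕ} : Exec (.store a x y) M 1 (M.setArr a (M.reg x) (M.reg y))
  | seq {P Q : Program} {M M' M'' : Memory} {s t : ℕ} :
      Exec P M s M' → Exec Q M' t M'' → Exec (.seq P Q) M (s + t) M''
  | iteTrue {b : Test} {P Q : Program} {M M' : Memory} {t : ℕ} :
      b.Holds M → Exec P M t M' → Exec (.ite b P Q) M (t + 1) M'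
  | iteFalse {b : Test} {P Q : Program} {M M' : Memory} {t : ℕ} :
      ¬ b.Holds M → Exec Q M t M' → Exec (.ite b P Q) M (t + 1) M'
  | whileTrue {b : Test} {P : Program} {M M' M'' : Memory} {s t : ℕ} :
      b.Holds M → Exec P M s M' → Exec (.while b P) M' t M'' →
      Exec (.while b P) M (s + t + 1) M''
  | whileFalse {b : Test} {P : Program} {M : Memory} :
      ¬ b.Holds M → Exec (.while b P) M 1 M

/-- Adjacency lists of a graph on `{0, …, n - 1}`; the neighbours may come in any order. -/
structure AdjLists {n : ℕ} (G : SimpleGraph (Fin n)) where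
  nbrs : Fin n → List (Fin n)
  nodup : ∀ v, (nbrs v).Nodup
  mem_iff : ∀ v w, w ∈ nbrs v ↔ G.Adj v w

/-- The concatenation of the adjacency lists of the vertices `0, …, n - 1`. -/
def AdjLists.entries {n : ℕ} {G : SimpleGraph (Fin n)} (A : AdjLists G) : List (Fin n) :=
  (List.finRange n).flatMap A.nbrs

/-- Where the list of vertex `i` begins; for `i = n`, the total length of the lists. -/
def AdjLists.offset {n : ℕ} {G : SimpleGraph (Fin n)} (A : AdjLists G) (i : ℕ) : ℕ :=
  (((List.finRange n).take i).flatMap A.nbrs).length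

/-- The initial memory: register 0 holds `n`, array 0 holds at `0, …, n` the positions at which
the adjacency lists begin, array 1 holds the concatenated adjacency lists, all else is zero. -/
def AdjLists.initial {n : ℕ} {G : SimpleGraph (Fin n)} (A : AdjLists G) : Memory where
  reg x := if x = 0 then n else 0
  arr a i :=
    if a = 0 then (if i ≤ n then A.offset i else 0)
    else if a = 1 then (A.entries.map Fin.val).getD i 0
    else 0

/-- The memory holds the set `S` as its output: a list of the elements of `S` without repetition,
with its length in register 0 and the two ends of its `i`-th element in entry `i` of arrays 2
and 3. -/
def Memory.Outputs {n : ℕ} (M : Memory) (S : Set (Sym2 (Fin n))) : Prop :=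
  ∃ L : List (Fin n × Fin n),
    M.reg 0 = L.length ∧
    (∀ (i : ℕ) (h : i < L.length), M.arr 2 i = (L[i].1 : ℕ) ∧ M.arr 3 i = (L[i].2 : ℕ)) ∧
    (L.map fun p => s(p.1, p.2)).Nodup ∧
    ∀ e : Sym2 (Fin n), e ∈ S ↔ e ∈ L.map fun p => s(p.1, p.2)

end CliqueCover

/-! Lower bound. In a completed graph every bridge `uv` lies in a triangle, whose apex `z` is on one
side of the bridge, say that of `u`. Then `vz` crosses the bridge, so it is an added edge; charge
`uv` to the ordered pair `(v, z)`. The pair determines the bridge, since `u` is the neighbour of `v`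
in the direction of `z` (`bridge_unique_of_joined`). So an added edge is charged at most twice, once
in each direction. To round up in every tree separately, each tree with an odd number of edges has
to supply one uncharged direction of an added edge, different trees supplying different ones. An odd
set of pairs contains a pair whose reversal is missing from it. If this reversal is uncharged, it is
the one wanted; if a bridge of another tree is charged to it, then another side of the triangle at
that bridge gives an uncharged pair. Hence at least the sum of `⌈m_c / 2⌉` edges are needed, where
`m_c` is the number of edges of the tree `c` (`sum_bridgeTree_le`).

Optimality. The algorithm adds one edge for two extracted ones, except perhaps in the last iteration
on a tree, so it meets the bound. It maintains that no added edge crosses a bridge that is not yet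
extracted (`TreeInv`); therefore the edge added for a single last bridge is itself a side of the
triangle at that bridge. Edges that are not bridges are covered from the outset: a shortest cycle
through such an edge is induced, hence a triangle (`exists_triangle_of_isChordal`).

Linear time. Run a breadth first search from a vertex with two neighbours. In a chordal graph the
edge from `v` to its parent is a bridge if and only if all neighbours of `v` are its parent or its
children (`SearchTree.flagged_iff`), so the scan of `v` recognizes it. In the reverse search order
depths never increase and siblings are consecutive. One pass in this order, in which at most one
vertex waits for a sibling, therefore carries out the algorithm on all trees simultaneously
(`Progress.extract`, `CoverInv.step`). For the last edge of a tree it suffices to have stored two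
children of each vertex. -/

namespace CliqueCover

/-! ### Sides of an edge, bridges and triangles -/

section Basics

variable {V : Type*} {G : SimpleGraph V}

/-- `a` and `b` are joined by a walk of `G` that does not use the edge `e`. -/
def Joined (G : SimpleGraph V) (e : Sym2 V) (a b : V) : Prop :=
  (G.deleteEdges {e}).Reachable a b

theorem Joined.refl {e : Sym2 V} (a : V) : Joined G e a a := Reachable.refl a

theorem Joined.symm {e : Sym2 V} {a b : V} (h : Joined G e a b) : Joined G e b a :=
  Reachable.symm h

theorem Joined.trans {e : Sym2 V} {a b c : V} (h : Joined G e a b) (h' : Joined G e b c) :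
    Joined G e a c :=
  Reachable.trans h h'

theorem joined_of_adj {e : Sym2 V} {a b : V} (h : G.Adj a b) (he : s(a, b) ≠ e) :
    Joined G e a b :=
  Adj.reachable (by simpa [deleteEdges_adj] using ⟨h, he⟩)

theorem Joined.induction {e : Sym2 V} {a b : V} {P : V → Prop} (h : Joined G e a b) (ha : P a)
    (step : ∀ x y, Joined G e a x → G.Adj x y → s(x, y) ≠ e → P x → P y) : P b := by
  rw [Joined, reachable_iff_reflTransGen] at h
  induction h with
  | refl => exact ha
  | tail h1 h2 ih =>
    rw [deleteEdges_adj] at h2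
    exact step _ _ ((reachable_iff_reflTransGen _ _).2 h1) h2.1 (by simpa using h2.2) ih

/-- Along a walk from `u`, an edge other than `uv` does not change the side, and the edge `uv` leads
to one of its own ends. -/
theorem joined_or_joined (hG : G.Connected) (u v z : V) :
    Joined G s(u, v) u z ∨ Joined G s(u, v) v z := by
  have h := (reachable_iff_reflTransGen _ _).1 (hG u z)
  induction h with
  | refl => exact .inl (.refl _)
  | @tail a b _ h2 ih =>
    by_cases he : s(a, b) = s(u, v)
    · rcases Sym2.eq_iff.1 he with ⟨-, rfl⟩ | ⟨-, rfl⟩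
      · exact .inr (.refl _)
      · exact .inl (.refl _)
    · exact ih.imp (·.trans (joined_of_adj h2 he)) (·.trans (joined_of_adj h2 he))

theorem bridgeGraph_adj_iff {u v : V} :
    (bridgeGraph G).Adj u v ↔ G.Adj u v ∧ ¬ Joined G s(u, v) u v := by
  simp only [bridgeGraph, isBridge_iff, Joined]

/-- The walk from `u₂` to `z` off the bridge `u₂v` cannot meet `v`, so it avoids `u₁v` as well. If
`u₁ ≠ u₂`, the detour `u₁ … z … u₂ v` would contradict that `u₁v` is a bridge. -/
theorem bridge_unique_of_joined {u₁ u₂ v z : V} (h₁ : (bridgeGraph G).Adj u₁ v)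
    (h₂ : (bridgeGraph G).Adj u₂ v) (hz₁ : Joined G s(u₁, v) u₁ z)
    (hz₂ : Joined G s(u₂, v) u₂ z) : u₁ = u₂ := by
  rw [bridgeGraph_adj_iff] at h₁ h₂
  by_contra hne
  have key : Joined G s(u₁, v) u₂ z := by
    refine hz₂.induction (.refl _) fun x y hx hxy he ih ↦ ih.trans (joined_of_adj hxy fun h ↦ ?_)
    rcases Sym2.eq_iff.1 h with ⟨-, rfl⟩ | ⟨rfl, -⟩
    · exact h₂.2 (hx.trans (joined_of_adj hxy he))
    · exact h₂.2 hx
  refine h₁.2 (hz₁.trans (key.symm.trans (joined_of_adj h₂.1 fun h ↦ ?_)))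
  rcases Sym2.eq_iff.1 h with ⟨h, -⟩ | ⟨h, h'⟩
  · exact hne h.symm
  · exact hne (h'.symm.trans h.symm)

theorem addEdges_adj {S : Set (Sym2 V)} {a b : V} :
    (addEdges G S).Adj a b ↔ G.Adj a b ∨ s(a, b) ∈ S ∧ a ≠ b := by
  simp [addEdges]

theorem hasCover_three_one_iff [Finite V] :
    HasCover 3 1 G ↔ ∀ u v, G.Adj u v → ∃ x, G.Adj u x ∧ G.Adj v x := by
  classical
  refine forall₂_congr fun u v ↦ imp_congr_right fun huv ↦ ?_
  rw [Nat.one_le_iff_ne_zero, ne_eq, Set.ncard_eq_zero (Set.toFinite _), ← ne_eq,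
    ← Set.nonempty_iff_ne_empty]
  constructor
  · rintro ⟨K, hK, hu, hv⟩
    obtain ⟨a, b, c, hab, hac, hbc, rfl⟩ := is3Clique_iff.1 hK
    have hne := huv.ne
    simp only [Finset.mem_insert, Finset.mem_singleton] at hu hv
    have := hab.symm
    have := hac.symm
    have := hbc.symm
    rcases hu with rfl | rfl | rfl <;> rcases hv with rfl | rfl | rfl <;>
      first | exact absurd rfl hne | exact ⟨a, ‹_›, ‹_›⟩ | exact ⟨b, ‹_›, ‹_›⟩ | exact ⟨c, ‹_›, ‹_›⟩
  · rintro ⟨x, hx, hx'⟩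
    exact ⟨{u, v, x}, is3Clique_iff.2 ⟨u, v, x, huv, hx, hx', rfl⟩, by simp, by simp⟩

/-- The set of bridges of `G`. -/
def bridges (G : SimpleGraph V) : Set (Sym2 V) := (bridgeGraph G).edgeSet

theorem mem_edgeSet_bridgeTree {c : BridgeComponent G} {u v : V} :
    s(u, v) ∈ (bridgeTree G c).edgeSet ↔
      (bridgeGraph G).Adj u v ∧ (bridgeGraph G).connectedComponentMk u = c := by
  simp only [mem_edgeSet, bridgeTree, ConnectedComponent.mem_supp_iff]
  refine ⟨fun h ↦ ⟨h.1, h.2.1⟩, fun h ↦ ⟨h.1, h.2, ?_⟩⟩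
  rw [← h.2]
  exact (ConnectedComponent.connectedComponentMk_eq_of_adj h.1).symm

end Basics

/-! ### Lower bound for the size of a completion set -/

section LowerBound

variable {V : Type*} {G : SimpleGraph V}

/-- A bridge `uv` of `G`, with an apex `z` on the side of `u` of a triangle `uvz` that contains
it after adding `S`. -/
structure Covered (G : SimpleGraph V) (S : Set (Sym2 V)) (u v z : V) : Prop where
  adj : (bridgeGraph G).Adj u v
  joined : Joined G s(u, v) u z
  near : (addEdges G S).Adj u z
  far : s(v, z) ∈ S
  ne : v ≠ z

/-- The apex of a triangle at a bridge lies on one of the two sides; its edge to the far end crosses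
the bridge and so cannot belong to `G`. -/
theorem exists_covered [Finite V] (hG : G.Connected) {S : Set (Sym2 V)}
    (hS : IsCompletionSet 3 1 G S) {e : Sym2 V} (he : e ∈ bridges G) :
    ∃ u v z, e = s(u, v) ∧ Covered G S u v z := by
  induction e with | _ u v => ?_
  have hb : (bridgeGraph G).Adj u v := he
  obtain ⟨z, huz, hvz⟩ := hasCover_three_one_iff.1 hS.2 u v
    (addEdges_adj.2 (.inl hb.1))
  have main : ∀ u v : V, (bridgeGraph G).Adj u v → (addEdges G S).Adj u z →
      (addEdges G S).Adj v z → Joined G s(u, v) u z → Covered G S u v z := by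
    intro u v hb huz hvz hj
    refine ⟨hb, hj, huz, ?_, hvz.ne⟩
    rcases addEdges_adj.1 hvz with h | h
    · refine absurd (hj.trans (joined_of_adj h.symm fun h' ↦ ?_)) (bridgeGraph_adj_iff.1 hb).2
      rcases Sym2.eq_iff.1 h' with ⟨rfl, -⟩ | ⟨rfl, h'⟩
      · exact huz.ne rfl
      · exact hb.ne h'.symm
    · exact h.1
  rcases joined_or_joined hG u v z with h | h
  · exact ⟨u, v, z, rfl, main u v hb huz hvz h⟩
  · rw [Sym2.eq_swap] at h
    exact ⟨v, u, z, Sym2.eq_swap, main v u hb.symm hvz huz h⟩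

theorem Covered.unique {S : Set (Sym2 V)} {u₁ u₂ v z : V} (h₁ : Covered G S u₁ v z)
    (h₂ : Covered G S u₂ v z) : u₁ = u₂ :=
  bridge_unique_of_joined h₁.adj h₂.adj h₁.joined h₂.joined

/-- The ordered pairs of distinct vertices that form an element of `S`. -/
def darts (S : Set (Sym2 V)) : Set (V × V) := {d | s(d.1, d.2) ∈ S ∧ d.1 ≠ d.2}

theorem ncard_darts_le [Finite V] (S : Set (Sym2 V)) : (darts S).ncard ≤ 2 * S.ncard := by
  classical
  have := Fintype.ofFinite V
  rw [Set.ncard_eq_toFinset_card', Set.ncard_eq_toFinset_card' S]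
  refine (Finset.card_le_mul_card_image (f := fun d : V × V ↦ s(d.1, d.2)) _ 2 ?_).trans
    (Nat.mul_le_mul_left _ (Finset.card_le_card ?_))
  · intro e _
    induction e with | _ a b => ?_
    refine (Finset.card_le_card (t := {(a, b), (b, a)}) ?_).trans Finset.card_le_two
    rintro ⟨x, y⟩ h
    simp only [Finset.mem_filter, Sym2.eq_iff] at h
    simp only [Finset.mem_insert, Finset.mem_singleton, Prod.mk.injEq]
    exact h.2
  · intro e he
    obtain ⟨d, hd, rfl⟩ := Finset.mem_image.1 he
    simpa using (Set.mem_toFinset.1 hd).1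

/-- Reversal has no fixed point on pairs of distinct vertices, so a finite set closed under it has
even size. -/
theorem exists_swap_not_mem {D : Finset (V × V)} (hD : ∀ d ∈ D, d.1 ≠ d.2) (h : Odd D.card) :
    ∃ d ∈ D, d.swap ∉ D := by
  by_contra! hc
  have : ∑ _x ∈ D, (1 : ZMod 2) = 0 :=
    Finset.sum_involution (fun d _ ↦ d.swap) (fun _ _ ↦ by decide)
      (fun d hd _ he ↦ hD d hd (congrArg Prod.snd he)) (fun d hd ↦ hc d hd) (fun d _ ↦ d.swap_swap)
  rw [Finset.sum_const, nsmul_one, ZMod.natCast_eq_zero_iff_even] at this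
  exact (Nat.not_even_iff_odd.2 h) this

/-- Both bounds count darts of `S`: one charged by each bridge and one spare dart for each tree with
an odd number of edges. The second bound forgets the spare darts and is enough for a graph that is
itself a tree. -/
theorem sum_bridgeTree_le [Finite V] [Fintype (BridgeComponent G)] (hG : G.Connected)
    {S : Set (Sym2 V)}
    (hS : IsCompletionSet 3 1 G S) :
    ∑ c : BridgeComponent G, ((bridgeTree G c).edgeSet.ncard + 1) / 2 ≤ S.ncard ∧
      (bridges G).ncard ≤ 2 * S.ncard := by
  classical
  have := Fintype.ofFinite V
  have hex : ∀ e : bridges G, ∃ u v z, e.1 = s(u, v) ∧ Covered G S u v z :=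
    fun e ↦ exists_covered hG hS e.2
  choose U W Z he hc using hex
  let comp : V → BridgeComponent G := (bridgeGraph G).connectedComponentMk
  have hUW : ∀ e, comp (U e) = comp (W e) := fun e ↦
    ConnectedComponent.connectedComponentMk_eq_of_adj (hc e).adj
  let f : bridges G → V × V := fun e ↦ (W e, Z e)
  have hf : Function.Injective f := by
    intro e e' h
    simp only [f, Prod.mk.injEq] at h
    have h1 := hc e
    rw [h.1, h.2] at h1
    exact Subtype.ext ((he e).trans (by rw [h.1, h1.unique (hc e')]; exact (he e').symm))
  have hfS : ∀ e, f e ∈ darts S := fun e ↦ ⟨(hc e).far, (hc e).ne⟩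
  let B : BridgeComponent G → Finset (bridges G) := fun c ↦ {e | comp (W e) = c}
  have hB : ∀ c, (B c).card = (bridgeTree G c).edgeSet.ncard := by
    intro c
    rw [Set.ncard_eq_toFinset_card', ← Finset.card_map (Function.Embedding.subtype _)]
    congr 1
    ext e
    simp only [Finset.mem_map, Function.Embedding.subtype_apply, Set.mem_toFinset, B,
      Finset.mem_filter, Finset.mem_univ, true_and]
    constructor
    · rintro ⟨e, h, rfl⟩
      rw [he e, mem_edgeSet_bridgeTree]
      exact ⟨(hc e).adj, (hUW e).trans h⟩
    · intro h
      have hb : e ∈ bridges G := by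
        induction e with | _ u v => exact (mem_edgeSet_bridgeTree.1 h).1
      refine ⟨⟨e, hb⟩, ?_, rfl⟩
      have h' := he ⟨e, hb⟩
      dsimp only at h'
      rw [h', mem_edgeSet_bridgeTree] at h
      exact (hUW _).symm.trans h.2
  -- the two ways to find a dart that is used by no bridge
  let Shared : BridgeComponent G → Prop := fun c ↦
    ∃ b b' : bridges G, comp (W b) = c ∧ comp (W b') ≠ c ∧ f b' = (f b).swap
  let Spare : BridgeComponent G → V × V → Prop := fun c d ↦
    if Shared c then ∃ b b' : bridges G, comp (W b) = c ∧ comp (W b') ≠ c ∧ f b' = (f b).swap ∧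
      d = (W b, U b')
    else ∃ b : bridges G, comp (W b) = c ∧ d = (f b).swap ∧ ∀ b', f b' ≠ (f b).swap
  -- The side of the triangle at `b'` between `U b'` and `Z b' = W b` crosses `b`, because `U b'`
  -- lies on the side of `U b`; hence it is an added edge.
  have hshared : ∀ b b' : bridges G, comp (W b') ≠ comp (W b) → f b' = (f b).swap →
      s(W b, U b') ∈ S ∧ W b ≠ U b' ∧ Joined G s(U b, W b) (U b) (U b') := by
    intro b b' hne h
    simp only [f, Prod.swap, Prod.mk.injEq] at h
    have h1 := hc b
    have h2 := hc b'
    have hU : U b' ≠ U b := by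
      intro hU
      apply hne
      rw [← hUW, ← hUW, hU]
    have hW : W b' ≠ W b := fun h ↦ hne (by rw [h])
    have hU' : U b' ≠ W b := fun hh ↦ hne (by rw [← hUW, hh])
    have hj : Joined G s(U b, W b) (U b) (U b') := by
      refine h1.joined.trans (joined_of_adj (h.1 ▸ h2.adj.1.symm) fun hh ↦ ?_)
      rcases Sym2.eq_iff.1 hh with ⟨-, hh⟩ | ⟨-, hh⟩
      · exact hU' hh
      · exact hU hh
    refine ⟨?_, hU'.symm, hj⟩
    have := h2.near
    rw [h.2] at this
    rcases addEdges_adj.1 this with h3 | h3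
    · refine absurd (hj.trans (joined_of_adj h3 fun hh ↦ ?_)) (bridgeGraph_adj_iff.1 h1.adj).2
      rcases Sym2.eq_iff.1 hh with ⟨hh, -⟩ | ⟨hh, -⟩
      · exact hU hh
      · exact hU' hh
    · rw [Sym2.eq_swap]; exact h3.1
  have hspare : ∀ c, Odd (bridgeTree G c).edgeSet.ncard → ∃ d, Spare c d := by
    intro c hodd
    by_cases hsh : Shared c
    · obtain ⟨b, b', h1, h2, h3⟩ := hsh
      refine ⟨(W b, U b'), ?_⟩
      simp only [Spare]
      rw [if_pos ⟨b, b', h1, h2, h3⟩]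
      exact ⟨b, b', h1, h2, h3, rfl⟩
    · rw [← hB, ← Finset.card_image_of_injective _ hf] at hodd
      obtain ⟨d, hd, hd'⟩ := exists_swap_not_mem (fun d hd ↦ by
        obtain ⟨e, -, rfl⟩ := Finset.mem_image.1 hd
        exact (hfS e).2) hodd
      obtain ⟨b, hb, rfl⟩ := Finset.mem_image.1 hd
      have hb' : comp (W b) = c := by simpa [B] using hb
      refine ⟨(f b).swap, ?_⟩
      simp only [Spare]
      rw [if_neg hsh]
      refine ⟨b, hb', rfl, fun b' h ↦ ?_⟩
      by_cases hcb : comp (W b') = c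
      · exact hd' (Finset.mem_image.2 ⟨b', by simpa [B] using hcb, h⟩)
      · exact hsh ⟨b, b', hb', hcb, h⟩
  have hspareS : ∀ c d, Spare c d → d ∈ darts S := by
    intro c d h
    simp only [Spare] at h
    split_ifs at h
    · obtain ⟨b, b', rfl, h2, h3, rfl⟩ := h
      exact ⟨(hshared b b' h2 h3).1, (hshared b b' h2 h3).2.1⟩
    · obtain ⟨b, -, rfl, -⟩ := h
      exact ⟨by rw [Sym2.eq_swap]; exact (hfS b).1, (hfS b).2.symm⟩
  -- Only `b` itself could be charged to `(W b, U b')`, but its pair is `(W b, W b')`.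
  have hsparef : ∀ c d, Spare c d → ∀ e, f e ≠ d := by
    intro c d h e hed
    simp only [Spare] at h
    split_ifs at h
    · obtain ⟨b, b', rfl, h2, h3, rfl⟩ := h
      simp only [f, Prod.mk.injEq] at hed
      have h4 := (hshared b b' h2 h3).2.2
      have h5 := hc e
      rw [hed.1, hed.2] at h5
      have h6 := bridge_unique_of_joined h5.adj (hc b).adj h5.joined h4
      have : e = b := Subtype.ext (by rw [he e, he b, hed.1, h6])
      subst this
      simp only [f, Prod.swap, Prod.mk.injEq] at h3
      exact (hc b').adj.ne (by rw [h3.1, ← hed.2])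
    · obtain ⟨b, -, rfl, h⟩ := h
      exact h e hed
  have hspareinj : ∀ c c' d, Spare c d → Spare c' d → c = c' := by
    -- A coincidence would put `b2'` into the tree `c`, and then the bridges `b2'` and `b2` would
    -- show that `c` is shared.
    have mixed : ∀ c c' d, Spare c d → Spare c' d → Shared c' → ¬ Shared c → c = c' := by
      intro c c' d h h' hs' hs
      simp only [Spare] at h h'
      rw [if_neg hs] at h
      rw [if_pos hs'] at h'
      obtain ⟨b1, rfl, rfl, -⟩ := h
      obtain ⟨b2, b2', rfl, h2, h3, hd⟩ := h'
      by_contra hne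
      simp only [f, Prod.swap, Prod.mk.injEq] at hd h3
      refine hs ⟨b2', b2, ?_, fun h ↦ hne h.symm, ?_⟩
      · rw [← hUW b2', hd.2]
      · simp only [f, Prod.swap, h3]
    intro c c' d h h'
    by_cases hs : Shared c <;> by_cases hs' : Shared c'
    · simp only [Spare] at h h'
      rw [if_pos hs] at h
      rw [if_pos hs'] at h'
      obtain ⟨b, b1, rfl, h2, h3, rfl⟩ := h
      obtain ⟨b', b1', rfl, h2', h3', hd⟩ := h'
      rw [Prod.mk.injEq] at hd
      rw [hd.1]
    · exact (mixed c' c d h' h hs hs').symm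
    · exact mixed c c' d h h' hs' hs
    · simp only [Spare] at h h'
      rw [if_neg hs] at h
      rw [if_neg hs'] at h'
      obtain ⟨b, rfl, rfl, -⟩ := h
      obtain ⟨b', rfl, hd, -⟩ := h'
      rw [hf (Prod.swap_injective hd)]
  have : Nonempty (V × V) := (hG.nonempty).elim fun v ↦ ⟨(v, v)⟩
  choose! g hg using hspare
  let O : Finset (BridgeComponent G) := {c | Odd (bridgeTree G c).edgeSet.ncard}
  have hO : ∀ c ∈ O, Spare c (g c) := fun c hc ↦ hg c (by simpa [O] using hc)
  have hcard : (Finset.univ : Finset (bridges G)).card + O.card ≤ 2 * S.ncard := by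
    refine le_trans ?_ (ncard_darts_le S)
    rw [← Finset.card_image_of_injective _ hf, ← Finset.card_image_of_injOn (f := g) (s := O)
      fun c h c' h' hcc ↦ hspareinj c c' (g c) (hO c h) (hcc ▸ hO c' h'),
      ← Finset.card_union_of_disjoint, Set.ncard_eq_toFinset_card']
    · refine Finset.card_le_card (Finset.union_subset ?_ ?_)
      · intro d hd
        obtain ⟨e, -, rfl⟩ := Finset.mem_image.1 hd
        exact Set.mem_toFinset.2 (hfS e)
      · intro d hd
        obtain ⟨c, h, rfl⟩ := Finset.mem_image.1 hd
        exact Set.mem_toFinset.2 (hspareS c _ (hO c h))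
    · rw [Finset.disjoint_left]
      intro d hd hd'
      obtain ⟨e, -, rfl⟩ := Finset.mem_image.1 hd
      obtain ⟨c, h, hd'⟩ := Finset.mem_image.1 hd'
      exact hsparef c _ (hO c h) e hd'.symm
  have hsum : (Finset.univ : Finset (bridges G)).card =
      ∑ c : BridgeComponent G, (bridgeTree G c).edgeSet.ncard := by
    rw [Finset.card_eq_sum_card_fiberwise (f := fun e ↦ comp (W e)) (t := Finset.univ)
      (fun _ _ ↦ Finset.mem_coe.2 (Finset.mem_univ _))]
    exact Finset.sum_congr rfl fun c _ ↦ hB c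
  constructor
  · rw [hsum, Finset.card_filter, ← Finset.sum_add_distrib] at hcard
    have : ∑ c : BridgeComponent G, ((bridgeTree G c).edgeSet.ncard +
        if Odd (bridgeTree G c).edgeSet.ncard then 1 else 0) =
        2 * ∑ c : BridgeComponent G, ((bridgeTree G c).edgeSet.ncard + 1) / 2 := by
      rw [Finset.mul_sum]
      refine Finset.sum_congr rfl fun c _ ↦ ?_
      split_ifs with h
      · obtain ⟨k, hk⟩ := h
        omega
      · obtain ⟨k, hk⟩ := Nat.not_odd_iff_even.1 h
        omega
    omega
  · rw [Set.ncard_eq_toFinset_card', Set.toFinset_card, ← Finset.card_univ]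
    omega

end LowerBound

/-! ### Invariants of the tree algorithm -/

section TreeOutput

variable {V : Type*} {G : SimpleGraph V} {c : BridgeComponent G}

theorem addEdges_mono {H : SimpleGraph V} {S S' : Set (Sym2 V)} (hG : H ≤ G) (h : S ⊆ S') {a b : V}
    (hab : (addEdges H S).Adj a b) : (addEdges G S').Adj a b := by
  rw [addEdges_adj] at hab ⊢
  exact hab.imp (hG ·) (.imp_left (h ·))

theorem bridgeGraph_le : bridgeGraph G ≤ G := fun _ _ h ↦ h.1

theorem bridgeTree_le : bridgeTree G c ≤ bridgeGraph G := fun _ _ h ↦ h.1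

theorem mem_supp_of_bridgeGraph_adj {u v : V} (h : (bridgeGraph G).Adj u v) (hu : u ∈ c.supp) :
    v ∈ c.supp := by
  rw [ConnectedComponent.mem_supp_iff] at hu ⊢
  rw [← hu]
  exact (ConnectedComponent.connectedComponentMk_eq_of_adj h).symm

theorem reachable_of_mem_supp {u v : V} (hu : u ∈ c.supp) (hv : v ∈ c.supp) :
    (bridgeGraph G).Reachable u v :=
  ConnectedComponent.exact (hu.trans hv.symm)

/-- A triangle through a bridge would give a detour around it. -/
theorem not_adj_of_bridge {u v w : V} (h : (bridgeGraph G).Adj u v) (hw : G.Adj u w) (hvw : w ≠ v) :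
    ¬ G.Adj v w := fun hadj ↦ by
  refine (bridgeGraph_adj_iff.1 h).2 ((joined_of_adj hw fun h ↦ ?_).trans
    (joined_of_adj hadj.symm fun h ↦ ?_))
  · rcases Sym2.eq_iff.1 h with ⟨-, h⟩ | ⟨-, h⟩
    · exact hvw h
    · exact hw.ne h.symm
  · rcases Sym2.eq_iff.1 h with ⟨rfl, -⟩ | ⟨h, -⟩
    · exact hw.ne rfl
    · exact hvw h

/-- The vertices of a component are joined by the edges of its own tree alone. -/
theorem joined_of_mem_supp {u v : V} (hu : u ∈ c.supp) (hv : v ∈ c.supp) {e : Sym2 V}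
    (he : e ∉ (bridgeTree G c).edgeSet) : Joined G e u v := by
  have h := (reachable_iff_reflTransGen _ _).1 (reachable_of_mem_supp hu hv)
  clear hv
  suffices Joined G e u v ∧ v ∈ c.supp from this.1
  induction h with
  | refl => exact ⟨.refl _, hu⟩
  | tail _ h ih =>
    refine ⟨ih.1.trans (joined_of_adj h.1 ?_), mem_supp_of_bridgeGraph_adj h ih.2⟩
    rintro rfl
    exact he (mem_edgeSet_bridgeTree.2 ⟨h, ih.2⟩)

/-- Otherwise a path of bridges from `u` to `v` and the edge `uv` would form a cycle through the
first bridge of the path. Consequently a non-edge of a tree with both ends in it is a non-edge of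
`G`. -/
theorem bridgeGraph_adj_of_reachable {u v : V} (huv : G.Adj u v)
    (h : (bridgeGraph G).Reachable u v) : (bridgeGraph G).Adj u v := by
  classical
  obtain ⟨p, hp⟩ := h.exists_isPath
  cases p with
  | nil => exact absurd rfl huv.ne
  | @cons _ w _ hw p =>
    rw [Walk.cons_isPath_iff] at hp
    by_contra hb
    have hwv : w ≠ v := by rintro rfl; exact hb hw
    have key : ∀ {a b : V} (q : (bridgeGraph G).Walk a b), u ∉ q.support →
        Joined G s(u, w) a b := by
      intro a b q
      induction q with
      | nil => exact fun _ ↦ .refl _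
      | cons h q ih =>
        intro hq
        simp only [Walk.support_cons, List.mem_cons, not_or] at hq
        refine (joined_of_adj h.1 fun he ↦ ?_).trans (ih hq.2)
        rcases Sym2.eq_iff.1 he with ⟨he, -⟩ | ⟨-, he⟩
        · exact hq.1 he.symm
        · exact hq.2 (he ▸ q.start_mem_support)
    refine (bridgeGraph_adj_iff.1 hw).2 ((joined_of_adj huv fun he ↦ ?_).trans (key p hp.2).symm)
    rcases Sym2.eq_iff.1 he with ⟨-, he⟩ | ⟨he, -⟩
    · exact hwv he.symm
    · exact hw.ne he

/-- What holds while the tree algorithm runs on the tree of `c`. -/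
structure TreeInv (c : BridgeComponent G) (F S : Set (Sym2 V)) : Prop where
  subset : F ⊆ (bridgeTree G c).edgeSet
  nonedge : ∀ e ∈ S, ¬ e.IsDiag ∧ e ∉ G.edgeSet
  mem_supp : ∀ e ∈ S, ∀ y ∈ e, y ∈ c.supp
  joined : ∀ a b, s(a, b) ∈ S → ∀ e ∈ F, Joined G e a b
  cover : ∀ u v, s(u, v) ∈ (bridgeTree G c).edgeSet → s(u, v) ∉ F →
    ∃ x, (addEdges (bridgeTree G c) S).Adj u x ∧ (addEdges (bridgeTree G c) S).Adj v x
  cover' : ∀ u v, s(u, v) ∈ S →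
    ∃ x, (addEdges (bridgeTree G c) S).Adj u x ∧ (addEdges (bridgeTree G c) S).Adj v x
  card : F.ncard + 2 * S.ncard ≤ (bridgeTree G c).edgeSet.ncard ∨
    F = ∅ ∧ 2 * S.ncard ≤ (bridgeTree G c).edgeSet.ncard + 1

theorem treeInv_initial (c : BridgeComponent G) : TreeInv c (bridgeTree G c).edgeSet ∅ where
  subset := subset_rfl
  nonedge := by simp
  mem_supp := by simp
  joined := by simp
  cover := fun _ _ h h' ↦ absurd h h'
  cover' := by simp
  card := by simp

/-- The new edge `vw` is bypassed by the path `v u w`, whose edges are exactly those extracted; so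
it crosses none of the remaining ones. -/
theorem TreeInv.close_path [Finite V] {F S : Set (Sym2 V)} (h : TreeInv c F S) {u v w : V}
    (huv : s(u, v) ∈ F) (huw : s(u, w) ∈ F) (hvw : v ≠ w) :
    TreeInv c (F \ {s(u, v), s(u, w)}) (insert s(v, w) S) := by
  have huv' := mem_edgeSet_bridgeTree.1 (h.subset huv)
  have huw' := mem_edgeSet_bridgeTree.1 (h.subset huw)
  have hTuv : (bridgeTree G c).Adj u v := h.subset huv
  have hTuw : (bridgeTree G c).Adj u w := h.subset huw
  have mono : ∀ {a b : V}, (addEdges (bridgeTree G c) S).Adj a b →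
      (addEdges (bridgeTree G c) (insert s(v, w) S)).Adj a b :=
    addEdges_mono le_rfl (Set.subset_insert _ _)
  have auv : (addEdges (bridgeTree G c) (insert s(v, w) S)).Adj u v :=
    addEdges_adj.2 (.inl hTuv)
  have auw : (addEdges (bridgeTree G c) (insert s(v, w) S)).Adj u w :=
    addEdges_adj.2 (.inl hTuw)
  have avw : (addEdges (bridgeTree G c) (insert s(v, w) S)).Adj v w :=
    addEdges_adj.2 (.inr ⟨Set.mem_insert _ _, hvw⟩)
  constructor
  · exact Set.sdiff_subset.trans h.subset
  · rintro e (rfl | he)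
    · exact ⟨hvw, not_adj_of_bridge huv'.1 huw'.1.1 hvw.symm⟩
    · exact h.nonedge e he
  · rintro e (rfl | he) y hy
    · rcases Sym2.mem_iff.1 hy with rfl | rfl
      · exact mem_supp_of_bridgeGraph_adj huv'.1 huv'.2
      · exact mem_supp_of_bridgeGraph_adj huw'.1 huw'.2
    · exact h.mem_supp e he y hy
  · intro a b hab e he
    rcases hab with hab | hab
    · have : Joined G e v w := by
        refine (joined_of_adj huv'.1.1.symm ?_).trans (joined_of_adj huw'.1.1 ?_)
        · rintro rfl
          exact he.2 (.inl Sym2.eq_swap)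
        · rintro rfl
          exact he.2 (.inr rfl)
      rcases Sym2.eq_iff.1 hab with ⟨rfl, rfl⟩ | ⟨rfl, rfl⟩
      · exact this
      · exact this.symm
    · exact h.joined a b hab e he.1
  · intro a b hab hF
    by_cases h1 : s(a, b) = s(u, v)
    · rcases Sym2.eq_iff.1 h1 with ⟨rfl, rfl⟩ | ⟨rfl, rfl⟩
      · exact ⟨w, auw, avw⟩
      · exact ⟨w, avw, auw⟩
    by_cases h2 : s(a, b) = s(u, w)
    · rcases Sym2.eq_iff.1 h2 with ⟨rfl, rfl⟩ | ⟨rfl, rfl⟩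
      · exact ⟨v, auv, avw.symm⟩
      · exact ⟨v, avw.symm, auv⟩
    obtain ⟨x, hx, hx'⟩ := h.cover a b hab fun h3 ↦ hF ⟨h3, by simp [h1, h2]⟩
    exact ⟨x, mono hx, mono hx'⟩
  · rintro a b (hab | hab)
    · rcases Sym2.eq_iff.1 hab with ⟨rfl, rfl⟩ | ⟨rfl, rfl⟩
      · exact ⟨u, auv.symm, auw.symm⟩
      · exact ⟨u, auw.symm, auv.symm⟩
    · obtain ⟨x, hx, hx'⟩ := h.cover' a b hab
      exact ⟨x, mono hx, mono hx'⟩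
  · left
    have hne : s(u, v) ≠ s(u, w) := by
      intro he
      rcases Sym2.eq_iff.1 he with ⟨-, he⟩ | ⟨he, he'⟩
      · exact hvw he
      · exact hvw (he'.trans he)
    have h1 := Set.ncard_sdiff_add_ncard_of_subset (s := {s(u, v), s(u, w)}) (t := F)
      (by rintro e (rfl | rfl) <;> assumption)
    rw [Set.ncard_pair hne] at h1
    have h2 := Set.ncard_insert_le s(v, w) S
    rcases h.card with h3 | h3
    · omega
    · simp [h3.1] at huv

/-- Earlier added edges do not cross the bridge `uv`, so `e` must be one of the two other sides of
the triangle at `uv`, and this triangle covers `e` too. -/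
theorem TreeInv.single [Finite V] {S : Set (Sym2 V)} {u v x : V} {e : Sym2 V}
    (h : TreeInv c {s(u, v)} S)
    (hd : ¬ e.IsDiag) (he : e ∉ (bridgeTree G c).edgeSet) (hs : ∀ y ∈ e, y ∈ c.supp)
    (hu : (addEdges (bridgeTree G c) (insert e S)).Adj u x)
    (hv : (addEdges (bridgeTree G c) (insert e S)).Adj v x) :
    TreeInv c ∅ (insert e S) := by
  have huv := mem_edgeSet_bridgeTree.1 (h.subset rfl)
  have hTuv : (bridgeTree G c).Adj u v := h.subset rfl
  have mono : ∀ {a b : V}, (addEdges (bridgeTree G c) S).Adj a b →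
      (addEdges (bridgeTree G c) (insert e S)).Adj a b :=
    addEdges_mono le_rfl (Set.subset_insert _ _)
  have auv : (addEdges (bridgeTree G c) (insert e S)).Adj u v := addEdges_adj.2 (.inl hTuv)
  have key : ∀ {a b : V}, (addEdges (bridgeTree G c) (insert e S)).Adj a b → s(a, b) ≠ s(u, v) →
      s(a, b) ≠ e → Joined G s(u, v) a b := by
    intro a b hab hne hne'
    rcases addEdges_adj.1 hab with h1 | ⟨h1, -⟩
    · exact joined_of_adj h1.1.1 hne
    · exact h.joined a b (h1.resolve_left hne') _ rfl
  have hux : s(u, x) ≠ s(u, v) := by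
    intro h1
    rcases Sym2.eq_iff.1 h1 with ⟨-, rfl⟩ | ⟨-, rfl⟩
    · exact hv.ne rfl
    · exact hu.ne rfl
  have hvx : s(v, x) ≠ s(u, v) := by
    intro h1
    rcases Sym2.eq_iff.1 h1 with ⟨-, rfl⟩ | ⟨-, rfl⟩
    · exact hv.ne rfl
    · exact hu.ne rfl
  have hex : s(u, x) = e ∨ s(v, x) = e := by
    by_contra! hc
    exact (bridgeGraph_adj_iff.1 huv.1).2 ((key hu hux hc.1).trans (key hv hvx hc.2).symm)
  constructor
  · simp
  · rintro e' (rfl | he')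
    · refine ⟨hd, fun h1 ↦ he ?_⟩
      induction e' with | _ a b => ?_
      have ha := hs a (by simp)
      exact mem_edgeSet_bridgeTree.2
        ⟨bridgeGraph_adj_of_reachable h1 (reachable_of_mem_supp ha (hs b (by simp))), ha⟩
    · exact h.nonedge e' he'
  · rintro e' (rfl | he') y hy
    · exact hs y hy
    · exact h.mem_supp e' he' y hy
  · simp
  · intro a b hab _
    by_cases h1 : s(a, b) = s(u, v)
    · rcases Sym2.eq_iff.1 h1 with ⟨rfl, rfl⟩ | ⟨rfl, rfl⟩
      · exact ⟨x, hu, hv⟩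
      · exact ⟨x, hv, hu⟩
    obtain ⟨y, hy, hy'⟩ := h.cover a b hab h1
    exact ⟨y, mono hy, mono hy'⟩
  · rintro a b (hab | hab)
    · rcases hex with h1 | h1 <;> rw [← h1] at hab <;>
        rcases Sym2.eq_iff.1 hab with ⟨rfl, rfl⟩ | ⟨rfl, rfl⟩
      · exact ⟨v, auv, hv.symm⟩
      · exact ⟨v, hv.symm, auv⟩
      · exact ⟨u, auv.symm, hu.symm⟩
      · exact ⟨u, hu.symm, auv.symm⟩
    · obtain ⟨y, hy, hy'⟩ := h.cover' a b hab
      exact ⟨y, mono hy, mono hy'⟩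
  · right
    have h2 := Set.ncard_insert_le e S
    rcases h.card with h3 | h3
    · rw [Set.ncard_singleton] at h3
      exact ⟨rfl, by omega⟩
    · simp at h3

theorem support_bridgeTree_subset : (bridgeTree G c).support ⊆ c.supp := by
  rintro x ⟨y, h⟩
  exact h.2.1

theorem TreeInv.step [Finite V] {r : V} {σ σ' : Set (Sym2 V) × Set (Sym2 V)}
    (h : TreeInv c σ.1 σ.2) (hs : TreeStep (bridgeTree G c) r σ σ') : TreeInv c σ'.1 σ'.2 := by
  cases hs with
  | sibling _ h1 h2 h3 => exact h.close_path h1.1 h2.1 h3.symm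
  | @path F S u v w _ h1 h2 h3 =>
    have : s(w, u) = s(u, w) := Sym2.eq_swap
    rw [this]
    refine h.close_path h1.1 (this ▸ h3.1) ?_
    rintro rfl
    have := h1.2
    have := h3.2
    omega
  | single h1 h2 h3 h4 h5 h6 =>
    exact h.single h2 h3 (fun y hy ↦ support_bridgeTree_subset (h4 y hy)) h5 h6

theorem treeInv_of_isTreeOutput [Finite V] {S : Set (Sym2 V)}
    (h : IsTreeOutput (bridgeTree G c) S) : TreeInv c ∅ S := by
  obtain ⟨r, -, h⟩ := h
  suffices ∀ σ, Relation.ReflTransGen (TreeStep (bridgeTree G c) r)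
      ((bridgeTree G c).edgeSet, ∅) σ → TreeInv c σ.1 σ.2 from this _ h
  intro σ h
  induction h with
  | refl => exact treeInv_initial c
  | tail _ h ih => exact ih.step h

end TreeOutput

/-! ### Non-bridges of a chordal graph lie in triangles -/

section Chordal

variable {V : Type*} {G : SimpleGraph V}

/-- A shortest path from `x` to `y` off the edge `xy` closes up with it to an induced cycle, which
chordality forces to be a triangle. -/
theorem exists_triangle_of_isChordal (hG : IsChordal G) {x y : V} (hxy : G.Adj x y)
    (hj : Joined G s(x, y) x y) : ∃ z, G.Adj x z ∧ G.Adj y z := by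
  obtain ⟨H, hH⟩ : ∃ H, H = G.deleteEdges {s(x, y)} := ⟨_, rfl⟩
  rw [Joined, ← hH] at hj
  obtain ⟨p, hp⟩ := Reachable.exists_walk_length_eq_dist hj
  have hHG : H ≤ G := hH ▸ deleteEdges_le _
  have hGH : ∀ a b, G.Adj a b → s(a, b) ≠ s(x, y) → H.Adj a b :=
    fun a b h he ↦ by rw [hH]; exact deleteEdges_adj.2 ⟨h, he⟩
  -- A chord would be a shortcut in a shortest path.
  have hadj : ∀ i j, i ≤ p.length → j ≤ p.length → H.Adj (p.getVert i) (p.getVert j) →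
      j ≤ i + 1 := by
    intro i j hi hj' h
    by_contra hlt
    have := dist_le ((p.take i).append (.cons h (p.drop j)))
    simp only [Walk.length_append, Walk.length_cons, Walk.take_length, Walk.drop_length] at this
    omega
  have hinj : ∀ i j, i ≤ p.length → j ≤ p.length → p.getVert i = p.getVert j → i = j := by
    have hpath := p.isPath_of_length_eq_dist hp
    intro i j hi hj' h
    exact hpath.getVert_injOn hi hj' h
  have h2 : 2 ≤ p.length := by
    by_contra hlt
    have h0 : p.length = 0 ∨ p.length = 1 := by omega
    rcases h0 with h0 | h0
    · exact hxy.ne (Walk.eq_of_length_eq_zero h0)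
    · have := (Walk.exists_length_eq_one_iff.1 ⟨p, h0⟩)
      simp [hH] at this
  rcases h2.eq_or_lt with h2 | h3
  · refine ⟨p.getVert 1, ?_, ?_⟩
    · have := p.adj_getVert_succ (i := 0) (by omega)
      rw [Walk.getVert_zero] at this
      exact (hHG this)
    · have := p.adj_getVert_succ (i := 1) (by omega)
      rw [show 1 + 1 = p.length from h2, Walk.getVert_length] at this
      exact (hHG this).symm
  -- The path has at least three edges here, so with `xy` it is an induced cycle on `p.length + 1 ≥
  -- 4` vertices.
  · refine (hG (p.length + 1) (by omega)).elim ⟨⟨fun i ↦ p.getVert i, fun i j h ↦ ?_⟩, ?_⟩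
    · exact Fin.ext (hinj _ _ (by omega) (by omega) h)
    · intro i j
      have main : G.Adj (p.getVert i) (p.getVert j) ↔ (i : ℕ) + 1 = j ∨ (j : ℕ) + 1 = i ∨
          (i : ℕ) = 0 ∧ (j : ℕ) = p.length ∨ (j : ℕ) = 0 ∧ (i : ℕ) = p.length := by
        constructor
        · intro h
          by_cases he : s(p.getVert i, p.getVert j) = s(x, y)
          · have e0 : x = p.getVert 0 := p.getVert_zero.symm
            have e1 : y = p.getVert p.length := p.getVert_length.symm
            rcases Sym2.eq_iff.1 he with ⟨h1, h2⟩ | ⟨h1, h2⟩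
            · have := hinj _ _ (by omega) (by omega) (h1.trans e0)
              have := hinj _ _ (by omega) (by omega) (h2.trans e1)
              omega
            · have := hinj _ _ (by omega) (by omega) (h1.trans e1)
              have := hinj _ _ (by omega) (by omega) (h2.trans e0)
              omega
          · have h1 : H.Adj (p.getVert i) (p.getVert j) := hGH _ _ h he
            have := hadj _ _ (by omega) (by omega) h1
            have := hadj _ _ (by omega) (by omega) h1.symm
            have : (i : ℕ) ≠ j := fun hij ↦ h.ne (by rw [hij])
            omega
        · rintro (h | h | h | h)
          · have := p.adj_getVert_succ (i := i) (by omega)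
            rw [h] at this
            exact (hHG this)
          · have := p.adj_getVert_succ (i := j) (by omega)
            rw [h] at this
            exact (hHG this).symm
          · rw [h.1, h.2]
            simpa using hxy
          · rw [h.1, h.2]
            simpa using hxy.symm
      change G.Adj (p.getVert i) (p.getVert j) ↔ _
      rw [main, cycleGraph_adj']
      have := i.2
      have := j.2
      rw [Fin.val_sub, Fin.val_sub]
      -- The order of `i` and `j` determines how the two cyclic differences reduce modulo the length
      -- of the cycle.
      by_cases hij : (i : ℕ) ≤ j
      · have e1 : (p.length + 1 - (i : ℕ) + j) % (p.length + 1) = j - i := by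
          rw [show p.length + 1 - (i : ℕ) + j = (j - i) + (p.length + 1) by omega,
            Nat.add_mod_right, Nat.mod_eq_of_lt (by omega)]
        rw [e1]
        rcases hij.eq_or_lt with h | h
        · rw [show p.length + 1 - (j : ℕ) + i = 0 + (p.length + 1) by omega, Nat.add_mod_right,
            Nat.mod_eq_of_lt (by omega)]
          omega
        · rw [Nat.mod_eq_of_lt (by omega)]
          omega
      · have e1 : (p.length + 1 - (j : ℕ) + i) % (p.length + 1) = i - j := by
          rw [show p.length + 1 - (j : ℕ) + i = (i - j) + (p.length + 1) by omega,
            Nat.add_mod_right, Nat.mod_eq_of_lt (by omega)]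
        rw [e1, Nat.mod_eq_of_lt (by omega)]
        omega

end Chordal

/-! ### Optimality of every output, on the graph and on each tree -/

section Optimality

variable {V : Type*} {G : SimpleGraph V}

theorem bridgeGraph_adj_of_supp_eq {c : BridgeComponent G} {u v : V} (hc : c.supp = {u, v})
    (huv : u ≠ v) : (bridgeGraph G).Adj u v := by
  obtain ⟨p⟩ := reachable_of_mem_supp (c := c) (u := u) (v := v) (by simp [hc]) (by simp [hc])
  cases p with
  | nil => exact absurd rfl huv
  | @cons _ w _ h p =>
    have hw := mem_supp_of_bridgeGraph_adj (c := c) h (by simp [hc])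
    rw [hc] at hw
    rcases hw with rfl | rfl
    · exact absurd rfl h.ne
    · exact h

theorem isBridge_induce (c : BridgeComponent G) {a b : c.supp}
    (h : ((bridgeGraph G).induce c.supp).Adj a b) :
    (bridgeGraph ((bridgeGraph G).induce c.supp)).Adj a b := by
  refine bridgeGraph_adj_iff.2 ⟨h, fun hj ↦ (bridgeGraph_adj_iff.1 h).2 ?_⟩
  change Joined G s(a.1, b.1) a.1 b.1
  refine Joined.induction (P := fun x : c.supp ↦ Joined G s(a.1, b.1) a.1 x.1) hj (.refl _) ?_
  intro x y _ hxy hne ih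
  refine ih.trans (joined_of_adj hxy.1 fun he ↦ hne ?_)
  exact Sym2.map.injective Subtype.val_injective he

theorem connected_induce_supp (c : BridgeComponent G) :
    ((bridgeGraph G).induce c.supp).Connected :=
  (ConnectedComponent.maximal_connected_induce_supp c).prop

theorem ncard_bridgeTree_le [Finite V] (c : BridgeComponent G) :
    (bridgeTree G c).edgeSet.ncard ≤ (bridges ((bridgeGraph G).induce c.supp)).ncard := by
  rw [← Set.ncard_image_of_injective _ (Sym2.map.injective (Subtype.val_injective (p := (· ∈ c.supp))))]
  refine Set.ncard_le_ncard ?_ (Set.toFinite _)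
  intro e he
  induction e with | _ u v => ?_
  exact ⟨s(⟨u, he.2.1⟩, ⟨v, he.2.2⟩), isBridge_induce c (a := ⟨u, he.2.1⟩) (b := ⟨v, he.2.2⟩) he.1, rfl⟩

/-- An output of the tree algorithm is an optimal completion set of the tree. -/
theorem isOptimal_induce [Finite V] {c : BridgeComponent G} {S : Set (Sym2 V)}
    (h : TreeInv c ∅ S) :
    IsOptimalCompletionSet 3 1 ((bridgeGraph G).induce c.supp)
      (Sym2.map (Subtype.val : c.supp → V) ⁻¹' S) := by
  have hadj : ∀ a b : c.supp, (addEdges ((bridgeGraph G).induce c.supp)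
      (Sym2.map (Subtype.val : c.supp → V) ⁻¹' S)).Adj a b ↔
      (addEdges (bridgeTree G c) S).Adj a b := by
    intro a b
    rw [addEdges_adj, addEdges_adj]
    refine or_congr ⟨fun h ↦ ⟨h, a.2, b.2⟩, fun h ↦ h.1⟩ (and_congr Iff.rfl ?_)
    rw [Ne, Ne, Subtype.ext_iff]
  have hmem : ∀ a b : V, a ∈ c.supp → (addEdges (bridgeTree G c) S).Adj a b → b ∈ c.supp := by
    intro a b ha hab
    rcases addEdges_adj.1 hab with hab | hab
    · exact hab.2.2
    · exact h.mem_supp _ hab.1 b (by simp)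
  refine ⟨⟨?_, hasCover_three_one_iff.2 ?_⟩, ?_⟩
  · intro e he
    have := h.nonedge _ he
    induction e with | _ a b => ?_
    refine ⟨fun hd ↦ this.1 ?_, fun hd ↦ this.2 (bridgeGraph_le hd)⟩
    rw [Sym2.mk_isDiag_iff] at hd
    simp [hd]
  · intro a b hab
    rw [hadj] at hab
    have : ∃ x, (addEdges (bridgeTree G c) S).Adj a x ∧ (addEdges (bridgeTree G c) S).Adj b x := by
      rcases addEdges_adj.1 hab with h1 | h1
      · exact h.cover a b h1 (by simp)
      · exact h.cover' a b h1.1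
    obtain ⟨x, hx, hx'⟩ := this
    exact ⟨⟨x, hmem a x a.2 hx⟩, (hadj _ _).2 hx, (hadj _ _).2 hx'⟩
  · intro S' hS'
    have := Fintype.ofFinite (BridgeComponent ((bridgeGraph G).induce c.supp))
    have h1 := (sum_bridgeTree_le (connected_induce_supp c) hS').2
    have h2 := ncard_bridgeTree_le c
    have h3 : (Sym2.map (Subtype.val : c.supp → V) ⁻¹' S).ncard ≤ S.ncard := by
      rw [← Set.ncard_image_of_injective _ (Sym2.map.injective Subtype.val_injective)]
      exact Set.ncard_le_ncard (Set.image_preimage_subset _ _) (Set.toFinite _)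
    -- Together with `m ≤ 2 |S'|` for the number `m` of tree edges this gives `2 |S| ≤ 2 |S'| + 1`,
    -- and parity removes the excess.
    have h4 : 2 * S.ncard ≤ (bridgeTree G c).edgeSet.ncard + 1 := by
      rcases h.card with h | h
      · simp only [Set.ncard_empty] at h; omega
      · exact h.2
    omega

/-- What the algorithm adds for a tree with two vertices. -/
structure PairOutput (c : BridgeComponent G) (S : Set (Sym2 V)) (u v w : V) : Prop where
  supp : c.supp = {u, v}
  ne : u ≠ v
  adj : G.Adj u w
  ne' : w ≠ v
  eq : S = {s(v, w)}

theorem PairOutput.bridge {c : BridgeComponent G} {S : Set (Sym2 V)} {u v w : V}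
    (h : PairOutput c S u v w) : (bridgeGraph G).Adj u v :=
  bridgeGraph_adj_of_supp_eq h.supp h.ne

theorem PairOutput.not_adj {c : BridgeComponent G} {S : Set (Sym2 V)} {u v w : V}
    (h : PairOutput c S u v w) : ¬ G.Adj v w :=
  not_adj_of_bridge h.bridge h.adj h.ne'

theorem PairOutput.not_bridge {c : BridgeComponent G} {S : Set (Sym2 V)} {u v w : V}
    (h : PairOutput c S u v w) : ¬ (bridgeGraph G).Adj u w := by
  intro hb
  have := mem_supp_of_bridgeGraph_adj (c := c) hb (by simp [h.supp])
  rw [h.supp] at this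
  rcases this with rfl | rfl
  · exact hb.ne rfl
  · exact h.ne' rfl

/-- The properties that determine the output of the algorithm up to the choices in the trees. -/
structure OutputData [Finite V] (S : Set (Sym2 V)) (add : BridgeComponent G → Set (Sym2 V)) :
    Prop where
  eq : S = ⋃ c, add c
  big : ∀ c : BridgeComponent G, 3 ≤ c.supp.ncard → TreeInv c ∅ (add c)
  pair : ∀ c : BridgeComponent G, c.supp.ncard = 2 → ∃ u v w, PairOutput c (add c) u v w
  small : ∀ c : BridgeComponent G, c.supp.ncard ≤ 1 → add c = ∅

theorem IsAlgorithmOutput.exists_outputData [Finite V] {S : Set (Sym2 V)}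
    (h : IsAlgorithmOutput G S) :
    ∃ add : BridgeComponent G → Set (Sym2 V), OutputData S add := by
  obtain ⟨add, hS, h⟩ := h
  refine ⟨add, hS, fun c hc ↦ treeInv_of_isTreeOutput ((h c).1 hc), fun c hc ↦ ?_,
    fun c hc ↦ (h c).2.2 hc⟩
  obtain ⟨u, v, w, h1, -, h2, h3, h4⟩ := (h c).2.1 hc
  refine ⟨u, v, w, h1, ?_, h2, h3, h4⟩
  rintro rfl
  rw [h1, Set.pair_eq_singleton, Set.ncard_singleton] at hc
  omega

variable [Finite V] {S : Set (Sym2 V)} {add : BridgeComponent G → Set (Sym2 V)}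

theorem OutputData.cases (h : OutputData S add) {e : Sym2 V} (he : e ∈ S) :
    ∃ c, e ∈ add c ∧ (TreeInv c ∅ (add c) ∨ c.supp.ncard = 2 ∧ ∃ u v w, PairOutput c (add c) u v w) := by
  rw [h.eq, Set.mem_iUnion] at he
  obtain ⟨c, hc⟩ := he
  refine ⟨c, hc, ?_⟩
  by_cases h3 : 3 ≤ c.supp.ncard
  · exact .inl (h.big c h3)
  by_cases h2 : c.supp.ncard = 2
  · exact .inr ⟨h2, h.pair c h2⟩
  · rw [h.small c (by omega)] at hc
    exact absurd hc (by simp)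

theorem OutputData.subset (h : OutputData S add) (c : BridgeComponent G) : add c ⊆ S := by
  rw [h.eq]
  exact Set.subset_iUnion _ _

/-- Non-bridges have their triangles by chordality; bridges and added edges get theirs from the
component they belong to. For a tree on two vertices, the bridge and its added edge share one
triangle. -/
theorem OutputData.isCompletionSet (h : OutputData S add) (hG : IsChordal G) :
    IsCompletionSet 3 1 G S := by
  have mono : ∀ {c : BridgeComponent G} {a b : V}, (addEdges (bridgeTree G c) (add c)).Adj a b →
      (addEdges G S).Adj a b := fun {c} {_ _} h1 ↦
    addEdges_mono (bridgeTree_le.trans bridgeGraph_le) (h.subset c) h1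
  have hpair : ∀ {c : BridgeComponent G} {u v w : V}, PairOutput c (add c) u v w →
      (addEdges G S).Adj v w := fun {c u v w} hp ↦ addEdges_adj.2
    (.inr ⟨h.subset c (by rw [hp.eq]; rfl), hp.ne'.symm⟩)
  refine ⟨fun e he ↦ ?_, hasCover_three_one_iff.2 fun u v huv ↦ ?_⟩
  · obtain ⟨c, hc, h1 | ⟨-, u, v, w, h1⟩⟩ := h.cases he
    · exact h1.nonedge e hc
    · rw [h1.eq] at hc
      rw [hc]
      exact ⟨h1.ne'.symm, h1.not_adj⟩
  by_cases hadj : G.Adj u v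
  · by_cases hj : Joined G s(u, v) u v
    · obtain ⟨z, hz, hz'⟩ := exists_triangle_of_isChordal hG hadj hj
      exact ⟨z, addEdges_adj.2 (.inl hz), addEdges_adj.2 (.inl hz')⟩
    have hb : (bridgeGraph G).Adj u v := bridgeGraph_adj_iff.2 ⟨hadj, hj⟩
    obtain ⟨c, hc⟩ : ∃ c, c = (bridgeGraph G).connectedComponentMk u := ⟨_, rfl⟩
    have hu : u ∈ c.supp := hc.symm
    have hv : v ∈ c.supp := mem_supp_of_bridgeGraph_adj hb hu
    have h2 : 2 ≤ c.supp.ncard := by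
      rw [← Set.ncard_pair huv.ne]
      refine Set.ncard_le_ncard ?_ (Set.toFinite _)
      rintro x (rfl | rfl) <;> assumption
    rcases h2.eq_or_lt with h2 | h3
    · obtain ⟨a, b, w, hp⟩ := h.pair c h2.symm
      rw [hp.supp] at hu hv
      have haw : (addEdges G S).Adj a w := addEdges_adj.2 (.inl hp.adj)
      have hbw := hpair hp
      rcases hu with rfl | rfl <;> rcases hv with rfl | rfl
      · exact absurd rfl huv.ne
      · exact ⟨w, haw, hbw⟩
      · exact ⟨w, hbw, haw⟩
      · exact absurd rfl huv.ne
    · obtain ⟨x, hx, hx'⟩ := (h.big c h3).cover u v ⟨hb, hu, hv⟩ (by simp)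
      exact ⟨x, mono hx, mono hx'⟩
  · have he := ((addEdges_adj.1 huv).resolve_left hadj).1
    obtain ⟨c, hc, h1 | ⟨-, a, b, w, h1⟩⟩ := h.cases he
    · obtain ⟨x, hx, hx'⟩ := h1.cover' u v hc
      exact ⟨x, mono hx, mono hx'⟩
    · have hab : (addEdges G S).Adj a b := addEdges_adj.2 (.inl h1.bridge.1)
      have haw : (addEdges G S).Adj a w := addEdges_adj.2 (.inl h1.adj)
      rw [h1.eq] at hc
      rcases Sym2.eq_iff.1 hc with ⟨rfl, rfl⟩ | ⟨rfl, rfl⟩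
      · exact ⟨a, hab.symm, haw.symm⟩
      · exact ⟨a, haw.symm, hab.symm⟩

/-- Component by component, the number of added edges is at most the corresponding term of the lower
bound in `sum_bridgeTree_le`. -/
theorem OutputData.isOptimal (h : OutputData S add) (hc : G.Connected) (hG : IsChordal G) :
    IsOptimalCompletionSet 3 1 G S := by
  refine ⟨h.isCompletionSet hG, fun S' hS' ↦ ?_⟩
  have := Fintype.ofFinite (BridgeComponent G)
  refine le_trans ?_ (sum_bridgeTree_le hc hS').1
  rw [h.eq]
  refine (Set.ncard_iUnion_le_of_fintype _).trans (Finset.sum_le_sum fun c _ ↦ ?_)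
  by_cases h3 : 3 ≤ c.supp.ncard
  · rcases (h.big c h3).card with h | h
    · simp only [Set.ncard_empty] at h; omega
    · have := h.2; omega
  by_cases h2 : c.supp.ncard = 2
  · obtain ⟨u, v, w, hp⟩ := h.pair c h2
    rw [hp.eq, Set.ncard_singleton]
    have : 0 < (bridgeTree G c).edgeSet.ncard := by
      refine (Set.ncard_pos (Set.toFinite _)).2 ⟨s(u, v), ?_⟩
      exact ⟨hp.bridge, by simp [hp.supp], by simp [hp.supp]⟩
    omega
  · rw [h.small c (by omega), Set.ncard_empty]
    exact Nat.zero_le _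

/-- An edge added for another component has an end in that component, so only the edges of `add c`
can have both ends in `c`. -/
theorem OutputData.isOptimal_tree (h : OutputData S add) {c : BridgeComponent G}
    (hc : 3 ≤ c.supp.ncard) :
    IsOptimalCompletionSet 3 1 ((bridgeGraph G).induce c.supp)
      (Sym2.map (Subtype.val : c.supp → V) ⁻¹' S) := by
  have : Sym2.map (Subtype.val : c.supp → V) ⁻¹' S =
      Sym2.map (Subtype.val : c.supp → V) ⁻¹' add c := by
    refine Set.Subset.antisymm (fun e he ↦ ?_) (Set.preimage_mono (h.subset c))
    obtain ⟨c', hc', h'⟩ := h.cases he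
    suffices c' = c by subst this; exact hc'
    induction e with | _ a b => ?_
    rw [Sym2.map_mk] at hc'
    rcases h' with h1 | ⟨-, u, v, w, h1⟩
    · exact (h1.mem_supp _ hc' a (by simp)).symm.trans a.2
    · have hv : v ∈ c'.supp := by simp [h1.supp]
      rw [h1.eq] at hc'
      rcases Sym2.eq_iff.1 hc' with ⟨rfl, -⟩ | ⟨-, rfl⟩
      · exact hv.symm.trans a.2
      · exact hv.symm.trans b.2
  rw [this]
  exact isOptimal_induce (h.big c hc)

/-- Every edge of the completed graph except `uv` and `vw` stays on one side of the bridge `uv`: an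
edge added for another component is bypassed inside that tree or, if the tree has two vertices, by
the path that the edge closes. So each triangle at `uv` has to use `vw`. -/
theorem OutputData.pair_unique (h : OutputData S add) {c : BridgeComponent G}
    (hc : c.supp.ncard = 2) :
    ∃ u v w : V, c.supp = {u, v} ∧ G.Adj u w ∧ G.dist v w = 2 ∧ s(v, w) ∈ S ∧
      ∀ x : V, (addEdges G S).Adj u x → (addEdges G S).Adj v x → x = w := by
  obtain ⟨u, v, w, hp⟩ := h.pair c hc
  refine ⟨u, v, w, hp.supp, hp.adj, ?_, h.subset c (by rw [hp.eq]; rfl), fun x hu hv ↦ ?_⟩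
  · have h1 : G.Reachable v w := hp.bridge.1.symm.reachable.trans hp.adj.reachable
    have h2 := h1.one_lt_dist_of_ne_of_not_adj hp.ne'.symm hp.not_adj
    have h3 := dist_le (Walk.cons hp.bridge.1.symm (.cons hp.adj .nil))
    simp only [Walk.length_cons, Walk.length_nil] at h3
    omega
  · have key : ∀ a b, (addEdges G S).Adj a b → s(a, b) ≠ s(u, v) → s(a, b) ≠ s(v, w) →
        Joined G s(u, v) a b := by
      intro a b hab hne hne'
      rcases addEdges_adj.1 hab with hab | ⟨hab, -⟩
      · exact joined_of_adj hab hne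
      obtain ⟨c', hc', h'⟩ := h.cases hab
      have hcc : c' ≠ c := by
        rintro rfl
        rw [hp.eq] at hc'
        exact hne' hc'
      have hu : u ∈ c.supp := by simp [hp.supp]
      rcases h' with h' | ⟨-, u', v', w', h'⟩
      · refine joined_of_mem_supp (h'.mem_supp _ hc' a (by simp)) (h'.mem_supp _ hc' b (by simp)) ?_
        intro he
        exact hcc ((mem_edgeSet_bridgeTree.1 he).2.symm.trans hu)
      · have hj : Joined G s(u, v) v' w' := by
          refine (joined_of_adj h'.bridge.1.symm fun he ↦ hcc ?_).trans
            (joined_of_adj h'.adj fun he ↦ h'.not_bridge ?_)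
          · have hv' : v' ∈ c'.supp := by simp [h'.supp]
            have hu' : u' ∈ c'.supp := by simp [h'.supp]
            rcases Sym2.eq_iff.1 he with ⟨rfl, -⟩ | ⟨-, rfl⟩
            · exact hv'.symm.trans hu
            · exact hu'.symm.trans hu
          · rcases Sym2.eq_iff.1 he with ⟨rfl, rfl⟩ | ⟨rfl, rfl⟩
            · exact hp.bridge
            · exact hp.bridge.symm
        rw [h'.eq] at hc'
        rcases Sym2.eq_iff.1 hc' with ⟨rfl, rfl⟩ | ⟨rfl, rfl⟩
        · exact hj
        · exact hj.symm
    by_contra hxw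
    have h1 : s(u, x) ≠ s(u, v) := fun he ↦ by
      rcases Sym2.eq_iff.1 he with ⟨-, rfl⟩ | ⟨rfl, -⟩
      · exact hv.ne rfl
      · exact hp.ne rfl
    have h2 : s(v, x) ≠ s(u, v) := fun he ↦ by
      rcases Sym2.eq_iff.1 he with ⟨he, -⟩ | ⟨-, he⟩
      · exact hp.ne he.symm
      · exact hu.ne he.symm
    have h3 : s(u, x) ≠ s(v, w) := fun he ↦ by
      rcases Sym2.eq_iff.1 he with ⟨he, -⟩ | ⟨he, -⟩
      · exact hp.ne he
      · exact hp.adj.ne he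
    have h4 : s(v, x) ≠ s(v, w) := fun he ↦ by
      rcases Sym2.eq_iff.1 he with ⟨-, he⟩ | ⟨he, -⟩
      · exact hxw he
      · exact hp.ne' he.symm
    exact (bridgeGraph_adj_iff.1 hp.bridge).2 ((key u x hu h1 h3).trans (key v x hv h2 h4).symm)

end Optimality

/-! ### Breadth first search trees and the bridges of a chordal graph -/

section SearchTree

variable {V : Type*}

/-- The result of a breadth first search from `s`: `pos v` is the position of `v` in the search
order, and `p v` is the first neighbour of `v ≠ s` in that order. -/
structure SearchTree (G : SimpleGraph V) (s : V) (pos : V → ℕ) (p : V → V) : Prop where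
  inj : Function.Injective pos
  root : pos s = 0
  adj : ∀ v, v ≠ s → G.Adj (p v) v
  lt : ∀ v, v ≠ s → pos (p v) < pos v
  first : ∀ v y, v ≠ s → G.Adj y v → pos (p v) ≤ pos y
  mono : ∀ v w, v ≠ s → w ≠ s → pos v ≤ pos w → pos (p v) ≤ pos (p w)

/-- The edge from `v` to its parent exists and is a bridge. -/
def Flagged (G : SimpleGraph V) (s : V) (p : V → V) (v : V) : Prop :=
  v ≠ s ∧ (bridgeGraph G).Adj (p v) v

namespace SearchTree

variable {G : SimpleGraph V} {s : V} {pos : V → ℕ} {p : V → V}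

/-- The climb from `x` through successive parents meets no position beyond that of `x`. -/
theorem joined_root (h : SearchTree G s pos p) {e : Sym2 V} {x : V}
    (he : ∀ y, y ≠ s → pos y ≤ pos x → s(p y, y) ≠ e) : Joined G e x s := by
  obtain ⟨k, hk⟩ : ∃ k, k = pos x := ⟨_, rfl⟩
  induction k using Nat.strong_induction_on generalizing x with
  | _ k ih =>
    by_cases hx : x = s
    · exact hx ▸ .refl _
    · have hlt := h.lt x hx
      exact (joined_of_adj (h.adj x hx).symm (by rw [Sym2.eq_swap]; exact he x hx le_rfl)).trans
        (ih _ (hk ▸ hlt) (fun y hy hy' ↦ he y hy (hy'.trans hlt.le)) rfl)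

theorem edge_inj (h : SearchTree G s pos p) {v w : V} (hv : v ≠ s) (hw : w ≠ s)
    (he : s(p v, v) = s(p w, w)) : v = w := by
  rcases Sym2.eq_iff.1 he with ⟨-, he⟩ | ⟨h1, h2⟩
  · exact he
  · have h3 := h.lt v hv
    have h4 := h.lt w hw
    rw [h1] at h3
    rw [← h2] at h4
    omega

/-- If `v` has a neighbour `x` that is neither its parent nor its child, then `x` is the root or its
parent precedes `v`; so the climb from `x` to the root avoids the edge above `v`, and `vx` leads
around that edge. Conversely, if the edge above `v` is no bridge, chordality gives a triangle; its
apex is adjacent to the parent of `v`, which precedes `v`, so the apex is not a child of `v`. -/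
theorem flagged_iff (h : SearchTree G s pos p) (hG : IsChordal G) (v : V) :
    Flagged G s p v ↔ v ≠ s ∧ ∀ x, G.Adj v x → x = p v ∨ x ≠ s ∧ p x = v := by
  refine and_congr_right fun hv ↦ ?_
  have hlt := h.lt v hv
  rw [bridgeGraph_adj_iff]
  constructor
  · rintro ⟨-, hj⟩ x hx
    by_contra! hc
    have hpx : Joined G s(p v, v) x s := by
      by_cases hxs : x = s
      · exact hxs ▸ .refl _
      have h1 := h.first x v hxs hx
      have h2 : pos (p x) ≠ pos v := fun he ↦ hc.2 hxs (h.inj he)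
      refine (joined_of_adj (h.adj x hxs).symm fun he ↦ ?_).trans
        (h.joined_root fun y hy hyx he ↦ ?_)
      · rw [Sym2.eq_swap] at he
        exact hx.ne (h.edge_inj hxs hv he).symm
      · rw [h.edge_inj hy hv he] at hyx
        omega
    have hpv : ∀ y, y ≠ s → pos y ≤ pos (p v) → s(p y, y) ≠ s(p v, v) := by
      intro y hy hyx he
      rw [h.edge_inj hy hv he] at hyx
      omega
    refine hj (((h.joined_root hpv).trans hpx.symm).trans (joined_of_adj hx.symm ?_))
    intro he
    rcases Sym2.eq_iff.1 he with ⟨he, -⟩ | ⟨he, -⟩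
    · exact hc.1 he
    · exact hx.ne he.symm
  · intro hx
    refine ⟨h.adj v hv, fun hj ↦ ?_⟩
    obtain ⟨z, hz, hz'⟩ := exists_triangle_of_isChordal hG (h.adj v hv) hj
    rcases hx z hz' with rfl | ⟨hzs, rfl⟩
    · exact hz.ne rfl
    · have := h.first z _ hzs hz
      omega

/-- The ends of an edge outside the search tree are joined through the root by tree edges, so only
tree edges can be bridges. -/
theorem adj_iff (h : SearchTree G s pos p) {x y : V} :
    (bridgeGraph G).Adj x y ↔ Flagged G s p x ∧ p x = y ∨ Flagged G s p y ∧ p y = x := by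
  constructor
  · intro hb
    have main : ∀ x y, (bridgeGraph G).Adj x y → pos x < pos y → Flagged G s p y ∧ p y = x := by
      intro x y hb hlt
      have hy : y ≠ s := by
        rintro rfl
        rw [h.root] at hlt
        omega
      by_cases hp : p y = x
      · exact ⟨⟨hy, hp ▸ hb⟩, hp⟩
      refine absurd ?_ (bridgeGraph_adj_iff.1 hb).2
      have hne : ∀ z, z ≠ s → s(p z, z) ≠ s(x, y) := by
        intro z hz he
        rcases Sym2.eq_iff.1 he with ⟨h1, rfl⟩ | ⟨h1, rfl⟩
        · exact hp h1
        · have := h.lt z hz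
          rw [h1] at this
          omega
      exact (h.joined_root fun z hz _ ↦ hne z hz).trans (h.joined_root fun z hz _ ↦ hne z hz).symm
    rcases lt_trichotomy (pos x) (pos y) with h1 | h1 | h1
    · exact .inr (main x y hb h1)
    · exact absurd (h.inj h1) hb.ne
    · exact .inl (main y x hb.symm h1)
  · rintro (⟨h1, rfl⟩ | ⟨h1, rfl⟩)
    · exact h1.2.symm
    · exact h1.2

/-- Parents come in the same order as their children, so by induction on positions the depth is
monotone along the search. -/
theorem exists_depth (h : SearchTree G s pos p) :
    ∃ D : V → ℕ, (∀ v, v ≠ s → D v = D (p v) + 1) ∧ ∀ v w, pos v ≤ pos w → D v ≤ D w := by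
  classical
  -- The first argument is fuel; `pos v` is enough for `v`, as positions drop on the way to the
  -- root.
  obtain ⟨D, hD0, hD⟩ : ∃ D : ℕ → V → ℕ, (∀ v, D 0 v = 0) ∧
      ∀ k v, D (k + 1) v = if v = s then 0 else D k (p v) + 1 :=
    ⟨fun k ↦ k.rec (fun _ ↦ 0) fun _ f v ↦ if v = s then 0 else f (p v) + 1,
      fun _ ↦ rfl, fun _ _ ↦ rfl⟩
  have stable : ∀ k l v, pos v ≤ k → pos v ≤ l → D k v = D l v := by
    have hs : ∀ k, D k s = 0 := by
      intro k
      cases k with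
      | zero => exact hD0 s
      | succ k => rw [hD, if_pos rfl]
    intro k
    induction k with
    | zero =>
      intro l v hv _
      have : v = s := h.inj (by rw [h.root]; omega)
      rw [this, hs, hs]
    | succ k ih =>
      intro l v hk hl
      by_cases hv : v = s
      · rw [hv, hs, hs]
      have := h.lt v hv
      cases l with
      | zero => omega
      | succ l => rw [hD, hD, if_neg hv, if_neg hv, ih l (p v) (by omega) (by omega)]
  have h1 : ∀ v, v ≠ s → D (pos v) v = D (pos (p v)) (p v) + 1 := by
    intro v hv
    have := h.lt v hv
    rw [stable (pos v) (pos v + 1) v le_rfl (by omega), hD, if_neg hv,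
      stable (pos v) (pos (p v)) (p v) (by omega) le_rfl]
  refine ⟨fun v ↦ D (pos v) v, h1, fun v w ↦ ?_⟩
  obtain ⟨k, hk⟩ : ∃ k, k = pos w := ⟨_, rfl⟩
  induction k using Nat.strong_induction_on generalizing v w with
  | _ k ih =>
    intro hvw
    by_cases hv : v = s
    · dsimp only
      rw [hv, h.root, hD0]
      exact Nat.zero_le _
    have hw : w ≠ s := by
      rintro rfl
      rw [h.root] at hvw
      exact hv (h.inj (by rw [h.root]; omega))
    dsimp only
    rw [h1 v hv, h1 w hw]
    have := ih _ (hk ▸ h.lt w hw) (p v) (p w) rfl (h.mono v w hv hw hvw)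
    dsimp only at this
    omega

end SearchTree

/-- `r` is reached from a vertex by moving to the parent along bridges. -/
inductive Below (G : SimpleGraph V) (s : V) (p : V → V) (r : V) : V → Prop
  | refl : Below G s p r r
  | step {v : V} : Flagged G s p v → Below G s p r (p v) → Below G s p r v

/-- `r` is the root of the tree of the bridge component `c`, with respect to the depths `D`. -/
structure IsTop (G : SimpleGraph V) (s : V) (p : V → V) (D : V → ℕ) (c : BridgeComponent G)
    (r : V) : Prop where
  mem : r ∈ c.supp
  below : ∀ v ∈ c.supp, Below G s p r v
  depth : ∀ v ∈ c.supp, D v = D r + (bridgeTree G c).dist r v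

namespace SearchTree

variable {G : SimpleGraph V} {s : V} {pos : V → ℕ} {p : V → V} {D : V → ℕ}

/-- The first vertex of `c` in the search order has no bridge above it, and every walk of bridges
from it stays among the vertices below it. -/
theorem exists_isTop (h : SearchTree G s pos p) (hD : ∀ v, v ≠ s → D v = D (p v) + 1)
    (c : BridgeComponent G) : ∃ r, IsTop G s p D c r := by
  obtain ⟨r, hr, hmin⟩ := WellFounded.has_min (measure pos).wf c.supp c.nonempty_supp
  have hfl : ¬ Flagged G s p r := fun hf ↦
    hmin (p r) (mem_supp_of_bridgeGraph_adj hf.2.symm hr) (h.lt r hf.1)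
  have hbelow : ∀ v ∈ c.supp, Below G s p r v := by
    intro v hv
    have hrv := (reachable_iff_reflTransGen _ _).1 (reachable_of_mem_supp hr hv)
    clear hv
    induction hrv with
    | refl => exact .refl
    | tail _ hb ih =>
      rcases h.adj_iff.1 hb with ⟨h1, h2⟩ | ⟨h1, rfl⟩
      · cases ih with
        | refl => exact absurd h1 hfl
        | step _ h3 => exact h2 ▸ h3
      · exact .step h1 ih
  -- A bridge changes the depth by one, so the difference of depths bounds the tree distance from
  -- below; climbing to `r` attains it.
  have hlow : ∀ v, ∀ q : (bridgeTree G c).Walk r v, D v ≤ D r + q.length := by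
    have : ∀ a b, ∀ q : (bridgeTree G c).Walk a b, D b ≤ D a + q.length := by
      intro a b q
      induction q with
      | nil => simp
      | cons hab q ih =>
        rw [Walk.length_cons]
        rcases h.adj_iff.1 hab.1 with ⟨h1, rfl⟩ | ⟨h1, rfl⟩
        · have := hD _ h1.1
          omega
        · have := hD _ h1.1
          omega
    exact this r
  have hup : ∀ v, Below G s p r v → v ∈ c.supp →
      ∃ q : (bridgeTree G c).Walk r v, D r + q.length = D v := by
    intro v hv
    induction hv with
    | refl => exact fun _ ↦ ⟨.nil, by simp⟩
    | @step v h1 _ ih =>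
      intro hv
      have hpv := mem_supp_of_bridgeGraph_adj h1.2.symm hv
      obtain ⟨q, hq⟩ := ih hpv
      have hadj : (bridgeTree G c).Adj (p v) v := ⟨h1.2, hpv, hv⟩
      refine ⟨q.append (.cons hadj .nil), ?_⟩
      have := hD v h1.1
      simp only [Walk.length_append, Walk.length_cons, Walk.length_nil]
      omega
  refine ⟨r, hr, hbelow, fun v hv ↦ ?_⟩
  obtain ⟨q, hq⟩ := hup v (hbelow v hv) hv
  have h1 := dist_le q
  obtain ⟨q', hq'⟩ := q.reachable.exists_walk_length_eq_dist
  have h2 := hlow v q'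
  omega

end SearchTree

end SearchTree

/-! ### Iterations of the algorithm in terms of the search tree -/

section Progress

variable {V : Type*}

/-- The edges of the tree of `c` from the vertices in `R` to their parents. -/
def parentEdges {G : SimpleGraph V} (p : V → V) (c : BridgeComponent G) (R : Set V) :
    Set (Sym2 V) :=
  (fun v ↦ s(p v, v)) '' {v | v ∈ R ∧ v ∈ c.supp}

/-- The algorithm can have added `add c` for each component `c`, and then the edges from the
vertices in `R` to their parents are those not yet extracted. -/
structure Reached (G : SimpleGraph V) (s : V) (p : V → V) (D : V → ℕ) (R : Set V)
    (add : BridgeComponent G → Set (Sym2 V)) : Prop where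
  big : ∀ c : BridgeComponent G, 3 ≤ c.supp.ncard → ∃ r, IsTop G s p D c r ∧
    Relation.ReflTransGen (TreeStep (bridgeTree G c) r) ((bridgeTree G c).edgeSet, ∅)
      (parentEdges p c R, add c)
  pair : ∀ c : BridgeComponent G, c.supp.ncard = 2 →
    parentEdges p c R = (bridgeTree G c).edgeSet ∧ add c = ∅ ∨
    parentEdges p c R = ∅ ∧ ∃ u v w : V, c.supp = {u, v} ∧ IsBoundary G u ∧ G.Adj u w ∧ w ≠ v ∧
        add c = {s(v, w)}
  small : ∀ c : BridgeComponent G, c.supp.ncard ≤ 1 → add c = ∅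

/-- The algorithm can have produced the list `L` when the edges from the vertices in `R` to
their parents are those not yet extracted. -/
structure Progress (G : SimpleGraph V) (s : V) (p : V → V) (D : V → ℕ) (R : Set V)
    (L : List (V × V)) : Prop where
  reached : ∃ add : BridgeComponent G → Set (Sym2 V),
    (∀ e, (∃ c, e ∈ add c) ↔ e ∈ L.map fun d ↦ s(d.1, d.2)) ∧ Reached G s p D R add
  flagged : ∀ v ∈ R, Flagged G s p v
  joined : ∀ d ∈ L, ∀ v ∈ R, Joined G s(p v, v) d.1 d.2
  nodup : (L.map fun d ↦ s(d.1, d.2)).Nodup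

variable {G : SimpleGraph V} {s : V} {pos : V → ℕ} {p : V → V} {D : V → ℕ} {R : Set V}
  {L : List (V × V)} {c : BridgeComponent G} {r : V}

theorem SearchTree.parentEdges_flagged (h : SearchTree G s pos p) (c : BridgeComponent G) :
    parentEdges p c {v | Flagged G s p v} = (bridgeTree G c).edgeSet := by
  ext e
  constructor
  · rintro ⟨v, ⟨hv, hvc⟩, rfl⟩
    exact ⟨hv.2, mem_supp_of_bridgeGraph_adj hv.2.symm hvc, hvc⟩
  · intro he
    induction e with | _ u v => ?_
    obtain ⟨h1, h2, h3⟩ : (bridgeGraph G).Adj u v ∧ u ∈ c.supp ∧ v ∈ c.supp := he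
    rcases h.adj_iff.1 h1 with ⟨h4, rfl⟩ | ⟨h4, rfl⟩
    · exact ⟨u, ⟨h4, h2⟩, Sym2.eq_swap⟩
    · exact ⟨v, ⟨h4, h3⟩, rfl⟩

theorem SearchTree.progress_initial (h : SearchTree G s pos p)
    (hD : ∀ v, v ≠ s → D v = D (p v) + 1) :
    Progress G s p D {v | Flagged G s p v} [] where
  reached := ⟨fun _ ↦ ∅, by simp, fun c _ ↦ by
      obtain ⟨r, hr⟩ := h.exists_isTop hD c
      rw [h.parentEdges_flagged c]
      exact ⟨r, hr, .refl⟩, fun c _ ↦ .inl ⟨h.parentEdges_flagged c, rfl⟩, fun _ _ ↦ rfl⟩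
  flagged := fun _ h ↦ h
  joined := by simp
  nodup := by simp

theorem mem_support_bridgeTree {v : V} (hc : 2 ≤ c.supp.ncard) (hv : v ∈ c.supp) :
    v ∈ (bridgeTree G c).support := by
  obtain ⟨w, hw, hne⟩ := Set.exists_ne_of_one_lt_ncard hc v
  obtain ⟨q⟩ := reachable_of_mem_supp hv hw
  cases q with
  | nil => exact absurd rfl hne
  | cons h _ => exact ⟨_, h, hv, mem_supp_of_bridgeGraph_adj h hv⟩

theorem Progress.isAlgorithmOutput [Finite V] (h : Progress G s p D ∅ L) :
    IsAlgorithmOutput G {e | e ∈ L.map fun d ↦ s(d.1, d.2)} := by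
  obtain ⟨add, hadd, hr⟩ := h.reached
  have hempty : ∀ c : BridgeComponent G, parentEdges p c ∅ = ∅ := fun c ↦ by simp [parentEdges]
  refine ⟨add, by ext e; simpa using (hadd e).symm, fun c ↦ ⟨fun hc ↦ ?_, fun hc ↦ ?_, hr.small c⟩⟩
  · obtain ⟨r, htop, hsteps⟩ := hr.big c hc
    rw [hempty] at hsteps
    exact ⟨r, mem_support_bridgeTree (by omega) htop.mem, hsteps⟩
  · rcases hr.pair c hc with ⟨h1, -⟩ | ⟨-, h1⟩
    · obtain ⟨v, hv⟩ : c.supp.Nonempty := c.nonempty_supp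
      obtain ⟨w, hw⟩ := mem_support_bridgeTree (by omega) hv
      have : s(v, w) ∈ (bridgeTree G c).edgeSet := hw
      rw [← h1, hempty] at this
      exact absurd this (by simp)
    · exact h1

/-- Distances from the top of a tree are search depths up to a constant, so both notions of parent
agree. -/
theorem isParentIn_iff (hD : ∀ v, v ≠ s → D v = D (p v) + 1) (hr : IsTop G s p D c r)
    (hR : ∀ v ∈ R, Flagged G s p v) {u v : V} :
    IsParentIn (bridgeTree G c) r (parentEdges p c R) u v ↔ v ∈ R ∧ v ∈ c.supp ∧ u = p v := by
  constructor
  · rintro ⟨⟨y, ⟨hy, hyc⟩, he⟩, hdist⟩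
    rcases Sym2.eq_iff.1 he with ⟨rfl, rfl⟩ | ⟨rfl, rfl⟩
    · exact ⟨hy, hyc, rfl⟩
    · have h1 := hr.depth _ hyc
      have h2 := hr.depth _ (mem_supp_of_bridgeGraph_adj (hR y hy).2.symm hyc)
      have h3 := hD y (hR y hy).1
      omega
  · rintro ⟨hv, hvc, rfl⟩
    have h1 := hr.depth _ hvc
    have h2 := hr.depth _ (mem_supp_of_bridgeGraph_adj (hR v hv).2.symm hvc)
    have h3 := hD v (hR v hv).1
    exact ⟨⟨v, ⟨hv, hvc⟩, rfl⟩, by omega⟩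

/-- Maximal depth among the remaining vertices of all trees implies maximal depth in one's own tree;
this is why a single pass can interleave the trees. -/
theorem isDeepestIn (hD : ∀ v, v ≠ s → D v = D (p v) + 1) (hr : IsTop G s p D c r)
    (hR : ∀ v ∈ R, Flagged G s p v) {x : V} (hx : x ∈ R) (hxc : x ∈ c.supp)
    (hmax : ∀ z ∈ R, D z ≤ D x) :
    IsDeepestIn (bridgeTree G c) r (parentEdges p c R) x := by
  refine ⟨⟨_, ⟨x, ⟨hx, hxc⟩, rfl⟩, by simp⟩, ?_⟩
  rintro y ⟨_, ⟨z, ⟨hz, hzc⟩, rfl⟩, hy⟩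
  have h0 := hr.depth _ hxc
  have h1 := hr.depth _ hzc
  have h2 := hr.depth _ (mem_supp_of_bridgeGraph_adj (hR z hz).2.symm hzc)
  have h3 := hD z (hR z hz).1
  have h4 := hmax z hz
  rcases Sym2.mem_iff.1 hy with rfl | rfl <;> omega

theorem parentEdges_diff (h : SearchTree G s pos p) (hR : ∀ v ∈ R, Flagged G s p v) {x y : V}
    (hx : Flagged G s p x) (hy : Flagged G s p y) :
    parentEdges p c (R \ {x, y}) = parentEdges p c R \ {s(p x, x), s(p y, y)} := by
  ext e
  constructor
  · rintro ⟨z, ⟨⟨hz, hz'⟩, hzc⟩, rfl⟩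
    refine ⟨⟨z, ⟨hz, hzc⟩, rfl⟩, ?_⟩
    rintro (he | he)
    · exact hz' (.inl (h.edge_inj (hR z hz).1 hx.1 he))
    · exact hz' (.inr (h.edge_inj (hR z hz).1 hy.1 he))
  · rintro ⟨⟨z, ⟨hz, hzc⟩, rfl⟩, he⟩
    refine ⟨z, ⟨⟨hz, ?_⟩, hzc⟩, rfl⟩
    rintro (rfl | rfl)
    · exact he (.inl rfl)
    · exact he (.inr rfl)

theorem parentEdges_diff_of_notMem {x y : V} (hx : x ∉ c.supp) (hy : y ∉ c.supp) :
    parentEdges p c (R \ {x, y}) = parentEdges p c R := by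
  unfold parentEdges
  congr 1
  ext z
  simp only [Set.mem_ofPred_eq, Set.mem_sdiff, Set.mem_insert_iff, Set.mem_singleton_iff]
  refine ⟨fun h ↦ ⟨h.1.1, h.2⟩, fun h ↦ ⟨⟨h.1, ?_⟩, h.2⟩⟩
  rintro (rfl | rfl)
  · exact hx h.2
  · exact hy h.2

/-- One iteration in the component `c` that extracts the edges of `x` and `y` (which may be
equal) and adds the edge `ab`. -/
theorem Progress.extract [Finite V] (hP : Progress G s p D R L) {x y a b : V} (hx : x ∈ R) (hxc : x ∈ c.supp)
    (hyc : y ∈ c.supp)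
    (hcross : ¬ Joined G s(p x, x) a b)
    (hjoin : ∀ z ∈ R, z ≠ x → z ≠ y → Joined G s(p z, z) a b)
    (hbig : 3 ≤ c.supp.ncard → ∀ r S, IsTop G s p D c r →
      TreeStep (bridgeTree G c) r (parentEdges p c R, S)
        (parentEdges p c (R \ {x, y}), insert s(a, b) S))
    (hpair : c.supp.ncard = 2 → parentEdges p c R = (bridgeTree G c).edgeSet →
      parentEdges p c (R \ {x, y}) = ∅ ∧ ∃ u v w : V, c.supp = {u, v} ∧ IsBoundary G u ∧
        G.Adj u w ∧ w ≠ v ∧ s(a, b) = s(v, w)) :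
    Progress G s p D (R \ {x, y}) (L ++ [(a, b)]) := by
  classical
  obtain ⟨add, hadd, hr⟩ := hP.reached
  have hmem : s(p x, x) ∈ parentEdges p c R := ⟨x, ⟨hx, hxc⟩, rfl⟩
  have hpxc : p x ∈ c.supp := mem_supp_of_bridgeGraph_adj (hP.flagged x hx).2.symm hxc
  have hother : ∀ c', c' ≠ c → parentEdges p c' (R \ {x, y}) = parentEdges p c' R := by
    intro c' hc'
    refine parentEdges_diff_of_notMem (fun h ↦ hc' ?_) (fun h ↦ hc' ?_)
    · exact h.symm.trans hxc
    · exact h.symm.trans hyc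
  have h2 : 2 ≤ c.supp.ncard := by
    rw [← Set.ncard_pair (hP.flagged x hx).2.ne]
    refine Set.ncard_le_ncard ?_ (Set.toFinite _)
    rintro z (rfl | rfl) <;> assumption
  refine ⟨⟨Function.update add c (insert s(a, b) (add c)), ?_, ?_, ?_, ?_⟩, ?_, ?_, ?_⟩
  · intro e
    rw [List.map_append, List.mem_append, ← hadd]
    constructor
    · rintro ⟨c', h⟩
      by_cases hc : c' = c
      · subst hc
        rw [Function.update_self] at h
        rcases h with rfl | h
        · simp
        · exact .inl ⟨_, h⟩
      · rw [Function.update_of_ne hc] at h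
        exact .inl ⟨_, h⟩
    · rintro (⟨c', h⟩ | h)
      · by_cases hc : c' = c
        · exact ⟨c, by rw [Function.update_self]; exact .inr (hc ▸ h)⟩
        · exact ⟨c', by rwa [Function.update_of_ne hc]⟩
      · exact ⟨c, by rw [Function.update_self]; exact .inl (by simpa using h)⟩
  · intro c' h3
    by_cases hc : c' = c
    · subst hc
      rw [Function.update_self]
      obtain ⟨r, htop, hs⟩ := hr.big c' h3
      exact ⟨r, htop, hs.tail (hbig h3 r _ htop)⟩
    · rw [Function.update_of_ne hc, hother c' hc]
      exact hr.big c' h3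
  · intro c' h3
    by_cases hc : c' = c
    · subst hc
      rw [Function.update_self]
      rcases hr.pair c' h3 with ⟨h4, h5⟩ | ⟨h4, -⟩
      · obtain ⟨h6, u, v, w, h7, h8, h9, h10, h11⟩ := hpair h3 h4
        exact .inr ⟨h6, u, v, w, h7, h8, h9, h10, by rw [h5, h11]; simp⟩
      · rw [h4] at hmem
        exact absurd hmem (by simp)
    · rw [Function.update_of_ne hc, hother c' hc]
      exact hr.pair c' h3
  · intro c' h3
    have hc : c' ≠ c := by
      rintro rfl
      omega
    rw [Function.update_of_ne hc]
    exact hr.small c' h3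
  · exact fun v hv ↦ hP.flagged v hv.1
  · intro d hd v hv
    rcases List.mem_append.1 hd with hd | hd
    · exact hP.joined d hd v hv.1
    · rw [List.mem_singleton] at hd
      subst hd
      exact hjoin v hv.1 (fun h ↦ hv.2 (.inl h)) (fun h ↦ hv.2 (.inr h))
  -- The edges added earlier do not cross the remaining bridge above `x`, whereas `ab` does; so `ab`
  -- is new.
  · rw [List.map_append, List.nodup_append]
    refine ⟨hP.nodup, by simp, ?_⟩
    rintro e he _ he' rfl
    simp only [List.map_cons, List.map_nil, List.mem_singleton] at he'
    obtain ⟨d, hd, rfl⟩ := List.mem_map.1 he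
    have := hP.joined d hd x hx
    rcases Sym2.eq_iff.1 he' with ⟨h1, h2⟩ | ⟨h1, h2⟩
    · rw [h1, h2] at this
      exact hcross this
    · rw [h1, h2] at this
      exact hcross this.symm

theorem SearchTree.edge_ne (h : SearchTree G s pos p) {y z : V} (hz : Flagged G s p z)
    (hy : Flagged G s p y) (hne : y ≠ z) : s(p y, y) ≠ s(p z, z) :=
  fun he ↦ hne (h.edge_inj hy.1 hz.1 he)

theorem SearchTree.joined_parent (h : SearchTree G s pos p) {y z : V} (hz : Flagged G s p z)
    (hy : Flagged G s p y) (hne : y ≠ z) : Joined G s(p z, z) (p y) y :=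
  joined_of_adj hy.2.1 (h.edge_ne hz hy hne)

theorem not_joined_of_flagged {x b : V} (hx : Flagged G s p x) (hb : Joined G s(p x, x) (p x) b) :
    ¬ Joined G s(p x, x) x b := fun hj ↦
  (bridgeGraph_adj_iff.1 hx.2).2 (hb.trans hj.symm)

theorem three_le_ncard [Finite V] {x y z : V} (hx : x ∈ c.supp) (hy : y ∈ c.supp) (hz : z ∈ c.supp)
    (hxy : x ≠ y) (hxz : x ≠ z) (hyz : y ≠ z) : 3 ≤ c.supp.ncard := by
  rw [← Set.ncard_eq_three.2 ⟨x, y, z, hxy, hxz, hyz, rfl⟩]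
  refine Set.ncard_le_ncard ?_ (Set.toFinite _)
  rintro w (rfl | rfl | rfl) <;> assumption

theorem Progress.sibling [Finite V] (hP : Progress G s p D R L) (h : SearchTree G s pos p)
    (hD : ∀ v, v ≠ s → D v = D (p v) + 1) {x v : V} (hx : x ∈ R) (hv : v ∈ R) (hne : v ≠ x)
    (hp : p v = p x) (hmax : ∀ z ∈ R, D z ≤ D x) :
    Progress G s p D (R \ {x, v}) (L ++ [(x, v)]) := by
  have hfx := hP.flagged x hx
  have hfv := hP.flagged v hv
  obtain ⟨c, hc⟩ : ∃ c, c = (bridgeGraph G).connectedComponentMk x := ⟨_, rfl⟩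
  have hxc : x ∈ c.supp := hc.symm
  have hpc : p x ∈ c.supp := mem_supp_of_bridgeGraph_adj hfx.2.symm hxc
  have hvc : v ∈ c.supp := mem_supp_of_bridgeGraph_adj (hp ▸ hfv.2) hpc
  have h3 := three_le_ncard hpc hxc hvc hfx.2.ne (hp ▸ hfv.2.ne) hne.symm
  refine hP.extract hx hxc hvc (not_joined_of_flagged hfx ?_) ?_ ?_ (fun h ↦ by omega)
  · exact hp ▸ h.joined_parent hfx hfv hne
  · intro z hz hzx hzv
    have hfz := hP.flagged z hz
    exact (h.joined_parent hfz hfx hzx.symm).symm.trans (hp ▸ h.joined_parent hfz hfv hzv.symm)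
  · intro _ r S hr
    rw [parentEdges_diff h hP.flagged hfx hfv, hp]
    refine .sibling (isDeepestIn hD hr hP.flagged hx hxc hmax) ?_ ?_ hne
    · exact (isParentIn_iff hD hr hP.flagged).2 ⟨hx, hxc, rfl⟩
    · exact (isParentIn_iff hD hr hP.flagged).2 ⟨hv, hvc, hp.symm⟩

theorem Progress.path [Finite V] (hP : Progress G s p D R L) (h : SearchTree G s pos p)
    (hD : ∀ v, v ≠ s → D v = D (p v) + 1) {x : V} (hx : x ∈ R) (hu : p x ∈ R)
    (honly : ∀ z ∈ R, p z = p x → z = x) (hmax : ∀ z ∈ R, D z ≤ D x) :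
    Progress G s p D (R \ {x, p x}) (L ++ [(x, p (p x))]) := by
  have hfx := hP.flagged x hx
  have hfu := hP.flagged _ hu
  obtain ⟨c, hc⟩ : ∃ c, c = (bridgeGraph G).connectedComponentMk x := ⟨_, rfl⟩
  have hxc : x ∈ c.supp := hc.symm
  have hpc : p x ∈ c.supp := mem_supp_of_bridgeGraph_adj hfx.2.symm hxc
  have hppc : p (p x) ∈ c.supp := mem_supp_of_bridgeGraph_adj hfu.2.symm hpc
  have h1 := hD x hfx.1
  have h2 := hD _ hfu.1
  have h3 := three_le_ncard hppc hpc hxc hfu.2.ne (by intro h; rw [h] at h2; omega) hfx.2.ne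
  refine hP.extract hx hxc hpc (not_joined_of_flagged hfx ?_) ?_ ?_ (fun h ↦ by omega)
  · exact (h.joined_parent hfx hfu hfx.2.ne).symm
  · intro z hz hzx hzu
    have hfz := hP.flagged z hz
    exact (h.joined_parent hfz hfx hzx.symm).symm.trans (h.joined_parent hfz hfu hzu.symm).symm
  · intro _ r S hr
    rw [parentEdges_diff h hP.flagged hfx hfu]
    refine .path (isDeepestIn hD hr hP.flagged hx hxc hmax) ?_ ?_ ?_
    · exact (isParentIn_iff hD hr hP.flagged).2 ⟨hx, hxc, rfl⟩
    · intro v₁ hv₁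
      obtain ⟨h4, -, h5⟩ := (isParentIn_iff hD hr hP.flagged).1 hv₁
      exact honly v₁ h4 h5.symm
    · exact (isParentIn_iff hD hr hP.flagged).2 ⟨hu, hpc, rfl⟩

theorem isTop_eq (hr : IsTop G s p D c r) {v : V} (hv : v ∈ c.supp)
    (hf : ¬ Flagged G s p v) : v = r := by
  cases hr.below v hv with
  | refl => rfl
  | step h _ => exact absurd h hf

theorem Below.le (hD : ∀ v, v ≠ s → D v = D (p v) + 1) {v : V} (h : Below G s p r v) :
    v = r ∨ D r + 1 ≤ D v := by
  induction h with
  | refl => exact .inl rfl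
  | step h1 _ ih =>
    have := hD _ h1.1
    rcases ih with h | h
    · rw [h] at this
      exact .inr (by omega)
    · exact .inr (by omega)

/-- At the root of a tree, a single edge is left. -/
theorem SearchTree.parentEdges_eq_singleton (h : SearchTree G s pos p)
    (hD : ∀ v, v ≠ s → D v = D (p v) + 1) (hR : ∀ v ∈ R, Flagged G s p v) {x : V} (hx : x ∈ R)
    (hxc : x ∈ c.supp) (hu : ¬ Flagged G s p (p x)) (honly : ∀ z ∈ R, p z = p x → z = x)
    (hmax : ∀ z ∈ R, D z ≤ D x) : parentEdges p c R = {s(p x, x)} := by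
  obtain ⟨r, hr⟩ := h.exists_isTop hD c
  have hpc : p x ∈ c.supp := mem_supp_of_bridgeGraph_adj (hR x hx).2.symm hxc
  have hxr := isTop_eq hr hpc hu
  ext e
  constructor
  · rintro ⟨z, ⟨hz, hzc⟩, rfl⟩
    suffices z = x by rw [this]; rfl
    have hpz := mem_supp_of_bridgeGraph_adj (hR z hz).2.symm hzc
    have h1 := hD z (hR z hz).1
    have h2 := hD x (hR x hx).1
    have h3 := hmax z hz
    -- A remaining edge with parent `r` is that of `x`, as `x` has no remaining sibling; any other
    -- would lie deeper than `x`.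
    rcases (hr.below _ hpz).le hD with h4 | h4
    · exact honly z hz (h4.trans hxr.symm)
    · rw [hxr] at h2
      omega
  · rintro rfl
    exact ⟨x, ⟨hx, hxc⟩, rfl⟩

/-- The edge that may be added when the last edge of a tree joins `x` to its parent. -/
inductive LastEdge (G : SimpleGraph V) (s : V) (p : V → V) (x : V) : V → V → Prop
  | child {z : V} : Flagged G s p z → p z = x → LastEdge G s p x (p x) z
  | sibling {y : V} : Flagged G s p y → p y = p x → y ≠ x → LastEdge G s p x x y
  | pair {w : V} : (∀ z, Flagged G s p z → p z ≠ x) →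
      (∀ y, Flagged G s p y → p y = p x → y = x) → G.Adj (p x) w → w ≠ x → LastEdge G s p x x w

/-- An already extracted edge next to the last one, below `x` or below its parent, closes a triangle
with it inside the tree. If there is none, the tree has only two vertices and `p x` is a boundary
vertex. -/
theorem Progress.last [Finite V] (hP : Progress G s p D R L) (h : SearchTree G s pos p)
    (hD : ∀ v, v ≠ s → D v = D (p v) + 1) {x : V} (hx : x ∈ R) (hu : ¬ Flagged G s p (p x))
    (honly : ∀ z ∈ R, p z = p x → z = x) (hmax : ∀ z ∈ R, D z ≤ D x) {a b : V}
    (hab : LastEdge G s p x a b) :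
    Progress G s p D (R \ {x}) (L ++ [(a, b)]) := by
  have hfx := hP.flagged x hx
  obtain ⟨c, hc⟩ : ∃ c, c = (bridgeGraph G).connectedComponentMk x := ⟨_, rfl⟩
  have hxc : x ∈ c.supp := hc.symm
  have hpc : p x ∈ c.supp := mem_supp_of_bridgeGraph_adj hfx.2.symm hxc
  have hF := h.parentEdges_eq_singleton hD hP.flagged hx hxc hu honly hmax
  have hF' : parentEdges p c (R \ {x, x}) = ∅ := by
    rw [parentEdges_diff h hP.flagged hfx hfx, hF]
    simp
  rw [← Set.pair_eq_singleton]
  have hstep : ∀ r e y, IsTop G s p D c r → ∀ S, ¬ e.IsDiag → e ∉ G.edgeSet →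
      (∀ y ∈ e, y ∈ c.supp) → 3 ≤ c.supp.ncard →
      (addEdges (bridgeTree G c) (insert e S)).Adj (p x) y →
      (addEdges (bridgeTree G c) (insert e S)).Adj x y →
      TreeStep (bridgeTree G c) r (parentEdges p c R, S)
        (parentEdges p c (R \ {x, x}), insert e S) := by
    intro r e y hr S h1 h2 h3 h4 h5 h6
    have h7 := (isParentIn_iff hD hr hP.flagged).2 ⟨hx, hxc, rfl⟩
    rw [hF']
    rw [hF] at h7 ⊢
    refine .single h7 h1 (fun h ↦ h2 ?_) (fun y hy ↦ mem_support_bridgeTree (by omega) (h3 y hy)) h5 h6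
    exact edgeSet_mono (bridgeTree_le.trans bridgeGraph_le) h
  cases hab with
  | child hz hpz =>
    subst hpz
    have hzc : b ∈ c.supp := mem_supp_of_bridgeGraph_adj hz.2 hxc
    have h1 := hD _ hfx.1
    have h2 := hD b hz.1
    have hne : p (p b) ≠ b := by
      intro h
      rw [h] at h1
      omega
    refine hP.extract hx hxc hxc ?_ ?_ ?_ fun h ↦ ?_
    · intro hj
      exact (bridgeGraph_adj_iff.1 hfx.2).2 (hj.trans (h.joined_parent hfx hz hz.2.ne').symm)
    · intro y hy hyx _
      have hyz : b ≠ y := by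
        rintro rfl
        have := hmax b hy
        omega
      have hfy := hP.flagged y hy
      exact (h.joined_parent hfy hfx hyx.symm).trans (h.joined_parent hfy hz hyz)
    · intro h3 r S hr
      refine hstep r _ b hr S hne ?_ ?_ h3 ?_ ?_
      · have := not_adj_of_bridge hfx.2.symm hz.2.1 hne.symm
        exact this
      · intro y hy
        rcases Sym2.mem_iff.1 hy with rfl | rfl <;> assumption
      · exact addEdges_adj.2 (.inr ⟨.inl rfl, hne⟩)
      · exact addEdges_adj.2 (.inl ⟨hz.2, hxc, hzc⟩)
    · have := three_le_ncard hpc hxc hzc hfx.2.ne hne hz.2.ne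
      omega
  | sibling hy hpy hne =>
    have hyc : b ∈ c.supp := mem_supp_of_bridgeGraph_adj (hpy ▸ hy.2) hpc
    refine hP.extract hx hxc hxc ?_ ?_ ?_ fun h ↦ ?_
    · exact not_joined_of_flagged hfx (hpy ▸ h.joined_parent hfx hy hne)
    · intro z hz hzx _
      have hbz : b ≠ z := by
        rintro rfl
        exact hne (honly b hz hpy)
      have hfz := hP.flagged z hz
      exact (h.joined_parent hfz hfx hzx.symm).symm.trans (hpy ▸ h.joined_parent hfz hy hbz)
    · intro h3 r S hr
      refine hstep r _ b hr S hne.symm ?_ ?_ h3 ?_ ?_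
      · exact not_adj_of_bridge hfx.2 (hpy ▸ hy.2.1) hne
      · intro y hy
        rcases Sym2.mem_iff.1 hy with rfl | rfl <;> assumption
      · exact addEdges_adj.2 (.inl ⟨hpy ▸ hy.2, hpc, hyc⟩)
      · exact addEdges_adj.2 (.inr ⟨.inl rfl, hne.symm⟩)
    · have := three_le_ncard hpc hxc hyc hfx.2.ne (hpy ▸ hy.2.ne) hne.symm
      omega
  | pair hz hy hw hne =>
    -- Every vertex of `c` climbs to `p x` along bridges; `x` is the only flagged child of `p x` and
    -- has no flagged child.
    have hsupp : c.supp = {p x, x} := by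
      refine Set.Subset.antisymm (fun v hv ↦ ?_) (by rintro v (rfl | rfl) <;> assumption)
      obtain ⟨r, hr⟩ := h.exists_isTop hD c
      have hxr := isTop_eq hr hpc hu
      have := hr.below v hv
      clear hv
      induction this with
      | refl => exact .inl hxr.symm
      | @step v h1 _ ih =>
        rcases ih with ih | ih
        · exact .inr (hy v h1 ih)
        · exact absurd ih (hz v h1)
    have hnb : ¬ (bridgeGraph G).Adj (p x) b := by
      intro hb
      have := mem_supp_of_bridgeGraph_adj hb hpc
      rw [hsupp] at this
      rcases this with h | h
      · exact hw.ne h.symm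
      · exact hne h
    refine hP.extract hx hxc hxc ?_ ?_ ?_ fun _ _ ↦ ⟨hF', p x, x, b, hsupp, ?_, hw, hne, rfl⟩
    · refine not_joined_of_flagged hfx (joined_of_adj hw fun he ↦ ?_)
      rcases Sym2.eq_iff.1 he with ⟨-, he⟩ | ⟨-, he⟩
      · exact hne he
      · exact hw.ne he.symm
    · intro z hz hzx _
      have hfz := hP.flagged z hz
      refine (h.joined_parent hfz hfx hzx.symm).symm.trans (joined_of_adj hw fun he ↦ hnb ?_)
      have : s(p x, b) ∈ (bridgeGraph G).edgeSet := by
        rw [he]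
        exact hfz.2
      exact this
    · intro h3
      rw [hsupp, Set.ncard_pair hfx.2.ne] at h3
      omega
    · exact ⟨⟨x, hfx.2⟩, b, hw, fun hb ↦ hnb ⟨hw, hb⟩⟩

end Progress

/-! ### Running loop-free programs and loops -/

section Machine

open Classical in
/-- The result of running a program without loops. -/
noncomputable def Program.eval : Program → Memory → Memory
  | .skip, M => M
  | .const x k, M => M.setReg x k
  | .copy x y, M => M.setReg x (M.reg y)
  | .succ x, M => M.setReg x (M.reg x + 1)
  | .pred x, M => M.setReg x (M.reg x - 1)
  | .load x a y, M => M.setReg x (M.arr a (M.reg y))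
  | .store a x y, M => M.setArr a (M.reg x) (M.reg y)
  | .seq P Q, M => Q.eval (P.eval M)
  | .ite b P Q, M => if b.Holds M then P.eval M else Q.eval M
  | .while _ _, M => M

/-- The program contains no loop. -/
def Program.LoopFree : Program → Prop
  | .seq P Q => P.LoopFree ∧ Q.LoopFree
  | .ite _ P Q => P.LoopFree ∧ Q.LoopFree
  | .while _ _ => False
  | _ => True

/-- An upper bound for the number of steps of a program without loops. -/
def Program.size : Program → ℕ
  | .seq P Q => P.size + Q.size
  | .ite _ P Q => P.size + Q.size + 1
  | _ => 1

theorem Program.LoopFree.exec {P : Program} (h : P.LoopFree) (M : Memory) :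
    ∃ t ≤ P.size, Exec P M t (P.eval M) := by
  induction P generalizing M with
  | skip => exact ⟨1, le_rfl, .skip⟩
  | const => exact ⟨1, le_rfl, .const⟩
  | copy => exact ⟨1, le_rfl, .copy⟩
  | succ => exact ⟨1, le_rfl, .succ⟩
  | pred => exact ⟨1, le_rfl, .pred⟩
  | load => exact ⟨1, le_rfl, .load⟩
  | store => exact ⟨1, le_rfl, .store⟩
  | seq P Q ihP ihQ =>
    obtain ⟨s, hs, h1⟩ := ihP h.1 M
    obtain ⟨t, ht, h2⟩ := ihQ h.2 (P.eval M)
    exact ⟨s + t, Nat.add_le_add hs ht, .seq h1 h2⟩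
  | ite b P Q ihP ihQ =>
    rw [Program.eval, Program.size]
    split_ifs with hb
    · obtain ⟨s, hs, h1⟩ := ihP h.1 M
      exact ⟨s + 1, by omega, .iteTrue hb h1⟩
    · obtain ⟨s, hs, h1⟩ := ihQ h.2 M
      exact ⟨s + 1, by omega, .iteFalse hb h1⟩
  | _ => exact h.elim

/-- A loop with the invariant `I`, whose first argument bounds the number of iterations. -/
theorem exec_while {P : Program} (hP : P.LoopFree) {b : Test} {I : ℕ → Memory → Prop}
    (step : ∀ k M, I k M → b.Holds M → ∃ l < k, I l (P.eval M)) {k : ℕ} {M : Memory}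
    (h : I k M) :
    ∃ t l M', Exec (.while b P) M t M' ∧ I l M' ∧ ¬ b.Holds M' ∧ t ≤ (P.size + 1) * k + 1 := by
  induction k using Nat.strong_induction_on generalizing M with
  | _ k ih =>
    by_cases hb : b.Holds M
    · obtain ⟨l, hl, hI⟩ := step k M h hb
      obtain ⟨s, hs, h1⟩ := hP.exec M
      obtain ⟨t, l', M', h2, h3, h4, h5⟩ := ih l hl hI
      refine ⟨s + t + 1, l', M', .whileTrue hb h1 h2, h3, h4, ?_⟩
      have : (P.size + 1) * (l + 1) ≤ (P.size + 1) * k := Nat.mul_le_mul_left _ hl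
      rw [Nat.mul_add] at this
      omega
    · exact ⟨1, k, M, .whileFalse hb, h, hb, by omega⟩

end Machine

/-! ### The adjacency lists in memory -/

section Input

variable {n : ℕ} {G : SimpleGraph (Fin n)}

/-- The arrays `off` and `ent` hold adjacency lists of `G`. -/
structure HoldsGraph (G : SimpleGraph (Fin n)) (off ent : ℕ → ℕ) : Prop where
  zero : off 0 = 0
  mono : ∀ v < n, off v ≤ off (v + 1)
  sound : ∀ (v : Fin n) k, off v ≤ k → k < off (v + 1) → ∃ x, G.Adj v x ∧ ent k = x
  complete : ∀ v x : Fin n, G.Adj v x → ∃ k, off v ≤ k ∧ k < off (v + 1) ∧ ent k = x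
  inj : ∀ (v : Fin n) k l, off v ≤ k → k < off (v + 1) → off v ≤ l → l < off (v + 1) →
    ent k = ent l → k = l
  total : off n = 2 * G.edgeSet.ncard

theorem AdjLists.offset_succ (A : AdjLists G) {i : ℕ} (hi : i < n) :
    A.offset (i + 1) = A.offset i + (A.nbrs ⟨i, hi⟩).length := by
  have : (List.finRange n)[i]? = some ⟨i, hi⟩ := by simp [hi]
  rw [AdjLists.offset, AdjLists.offset, List.take_add_one, this]
  simp

theorem AdjLists.entries_getElem? (A : AdjLists G) (v : Fin n) {j : ℕ}
    (hj : j < (A.nbrs v).length) : A.entries[A.offset v + j]? = some (A.nbrs v)[j] := by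
  have h1 : (List.finRange n).drop v = v :: (List.finRange n).drop (v + 1) := by
    rw [List.drop_eq_getElem_cons (by simp)]
    simp
  rw [AdjLists.entries, ← List.take_append_drop v (List.finRange n), List.flatMap_append,
    AdjLists.offset, List.getElem?_append_right (by simp),
    Nat.add_sub_cancel_left, h1, List.flatMap_cons, List.getElem?_append_left hj]
  simp

theorem AdjLists.holdsGraph (A : AdjLists G) :
    HoldsGraph G (A.initial.arr 0) (A.initial.arr 1) := by
  classical
  have hoff : ∀ i ≤ n, A.initial.arr 0 i = A.offset i := fun i hi ↦ by
    simp [AdjLists.initial, hi]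
  have hlen : ∀ v : Fin n, A.initial.arr 0 (v + 1) = A.initial.arr 0 v + (A.nbrs v).length := by
    intro v
    rw [hoff _ v.2, hoff _ v.2.le, A.offset_succ v.2]
  have hent : ∀ (v : Fin n) j (hj : j < (A.nbrs v).length),
      A.initial.arr 1 (A.initial.arr 0 v + j) = (A.nbrs v)[j] := by
    intro v j hj
    rw [hoff _ v.2.le]
    simp [AdjLists.initial, List.getD_eq_getElem?_getD, A.entries_getElem? v hj]
  have hget : ∀ (v : Fin n) k, A.initial.arr 0 v ≤ k → k < A.initial.arr 0 (v + 1) →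
      ∃ j, ∃ hj : j < (A.nbrs v).length, k = A.initial.arr 0 v + j ∧
        A.initial.arr 1 k = (A.nbrs v)[j] := by
    intro v k h1 h2
    rw [hlen] at h2
    refine ⟨k - A.initial.arr 0 v, by omega, by omega, ?_⟩
    rw [← hent, Nat.add_sub_cancel' h1]
  refine ⟨?_, ?_, ?_, ?_, ?_, ?_⟩
  · rw [hoff 0 (Nat.zero_le _)]
    simp [AdjLists.offset]
  · intro v hv
    rw [hlen ⟨v, hv⟩]
    simp
  · intro v k h1 h2
    obtain ⟨j, hj, -, h3⟩ := hget v k h1 h2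
    exact ⟨_, (A.mem_iff v _).1 (List.getElem_mem hj), h3⟩
  · intro v x h
    obtain ⟨j, hj, hx⟩ := List.getElem_of_mem ((A.mem_iff v x).2 h)
    exact ⟨A.initial.arr 0 v + j, by omega, by rw [hlen]; omega, by rw [hent v j hj, hx]⟩
  · intro v k l h1 h2 h3 h4 h
    obtain ⟨i, hi, hik, h5⟩ := hget v k h1 h2
    obtain ⟨j, hj, hjl, h6⟩ := hget v l h3 h4
    rw [h5, h6] at h
    have := (A.nodup v).getElem_inj_iff.1 (Fin.ext h)
    omega
  · have h1 : ∀ v : Fin n, (A.nbrs v).length = G.degree v := by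
      intro v
      rw [← List.toFinset_card_of_nodup (A.nodup v), ← card_neighborFinset_eq_degree]
      congr 1
      ext x
      simp [A.mem_iff]
    have h2 : ∀ i, (hi : i ≤ n) → A.offset i = ∑ j ∈ Finset.range i,
        if hj : j < n then G.degree ⟨j, hj⟩ else 0 := by
      intro i
      induction i with
      | zero => intro _; simp [AdjLists.offset]
      | succ i ih =>
        intro hi
        rw [A.offset_succ hi, ih (by omega), Finset.sum_range_succ, dif_pos (show i < n from hi), h1]
    rw [hoff n le_rfl, h2 n le_rfl, Set.ncard_eq_toFinset_card', ← edgeFinset,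
      ← G.sum_degrees_eq_twice_card_edges, Finset.sum_range]
    exact Finset.sum_congr rfl fun i _ ↦ by simp

end Input

/-! ### Breadth first search as a combinatorial process -/

section Search

variable {n : ℕ} {G : SimpleGraph (Fin n)} {s : Fin n} {off ent : ℕ → ℕ} {q : ℕ → Fin n}
  {π : ℕ → ℕ} {h t : ℕ}

/-- A state of the breadth first search: the queue is `q 0, …, q (t - 1)`, its first `h` vertices
have been scanned, and the parent of `q j` is `q (π j)`. -/
structure Bfs (G : SimpleGraph (Fin n)) (s : Fin n) (q : ℕ → Fin n) (π : ℕ → ℕ) (h t : ℕ) :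
    Prop where
  root : q 0 = s
  pos : 1 ≤ t
  le : h ≤ t
  inj : ∀ i < t, ∀ j < t, q i = q j → i = j
  lt : ∀ j, 1 ≤ j → j < t → π j < j
  parent_le : ∀ j, 1 ≤ j → j < t → π j ≤ h
  adj : ∀ j, 1 ≤ j → j < t → G.Adj (q (π j)) (q j)
  mono : ∀ i j, 1 ≤ i → i ≤ j → j < t → π i ≤ π j
  first : ∀ i < t, ∀ j, 1 ≤ j → j < t → G.Adj (q i) (q j) → π j ≤ i
  closed : ∀ i < h, ∀ x, G.Adj (q i) x → ∃ j < t, q j = x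

theorem Bfs.initial : Bfs G s (fun _ ↦ s) (fun _ ↦ 0) 0 1 where
  root := rfl
  pos := le_rfl
  le := zero_le_one
  inj := by intros; omega
  lt := by intros; omega
  parent_le := by intros; omega
  adj := by intros; omega
  mono := by intros; omega
  first := by intros; omega
  closed := by intros; omega

theorem update_of_lt {α : Type*} (f : ℕ → α) {t j : ℕ} (x : α) (hj : j < t) :
    Function.update f t x j = f j :=
  Function.update_of_ne hj.ne _ _

/-- Neighbours of fully scanned vertices are in the queue already, so `q h` is the first neighbour
of the new vertex. No earlier parent exceeds `h`, which keeps the parents sorted. -/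
theorem Bfs.discover (H : Bfs G s q π h t) (hlt : h < t) {x : Fin n} (hx : G.Adj (q h) x)
    (hnew : ∀ j < t, q j ≠ x) :
    Bfs G s (Function.update q t x) (Function.update π t h) h (t + 1) := by
  have hq : ∀ j < t, Function.update q t x j = q j := fun j hj ↦ update_of_lt q x hj
  have hπ : ∀ j < t, Function.update π t h j = π j := fun j hj ↦ update_of_lt π h hj
  have hqt : Function.update q t x t = x := Function.update_self ..
  have hπt : Function.update π t h t = h := Function.update_self ..
  have hcase : ∀ j < t + 1, j < t ∨ j = t := fun j hj ↦ by omega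
  have hpos := H.pos
  constructor
  · rw [hq 0 (by omega)]; exact H.root
  · omega
  · omega
  · intro i hi j hj hij
    rcases hcase i hi with hi | rfl <;> rcases hcase j hj with hj | rfl
    · rw [hq i hi, hq j hj] at hij
      exact H.inj i hi j hj hij
    · rw [hq i hi, hqt] at hij
      exact absurd hij (hnew i hi)
    · rw [hq j hj, hqt] at hij
      exact absurd hij.symm (hnew j hj)
    · rfl
  · intro j h1 hj
    rcases hcase j hj with hj | rfl
    · rw [hπ j hj]; exact H.lt j h1 hj
    · rw [hπt]; exact hlt
  · intro j h1 hj
    rcases hcase j hj with hj | rfl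
    · rw [hπ j hj]; exact H.parent_le j h1 hj
    · rw [hπt]
  · intro j h1 hj
    rcases hcase j hj with hj | rfl
    · have := H.lt j h1 hj
      rw [hπ j hj, hq j hj, hq _ (by omega)]; exact H.adj j h1 hj
    · rw [hπt, hqt, hq h hlt]; exact hx
  · intro i j h1 hij hj
    rcases hcase j hj with hj | rfl
    · rw [hπ j hj, hπ i (by omega)]; exact H.mono i j h1 hij hj
    · rw [hπt]
      rcases hcase i (by omega) with hi | rfl
      · rw [hπ i hi]; exact H.parent_le i h1 hi
      · rw [hπt]
  · intro i hi j h1 hj hij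
    rcases hcase j hj with hj | rfl
    · rw [hπ j hj]
      rcases hcase i hi with hi | rfl
      · rw [hq i hi, hq j hj] at hij
        exact H.first i hi j h1 hj hij
      · have := H.parent_le j h1 hj
        omega
    · rw [hπt]
      by_contra! hih
      rw [hqt, hq i (by omega)] at hij
      obtain ⟨k, hk, hkx⟩ := H.closed i hih x hij
      exact hnew k hk hkx
  · intro i hi y hy
    rw [hq i (by omega)] at hy
    obtain ⟨j, hj, hjy⟩ := H.closed i hi y hy
    exact ⟨j, by omega, by rw [hq j hj]; exact hjy⟩

theorem Bfs.finish (H : Bfs G s q π h t) (hlt : h < t)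
    (hc : ∀ x, G.Adj (q h) x → ∃ j < t, q j = x) : Bfs G s q π (h + 1) t where
  root := H.root
  pos := H.pos
  le := hlt
  inj := H.inj
  lt := H.lt
  parent_le := fun j h1 hj ↦ (H.parent_le j h1 hj).trans (Nat.le_succ h)
  adj := H.adj
  mono := H.mono
  first := H.first
  closed := fun i hi x hx ↦ by
    rcases Nat.lt_succ_iff_lt_or_eq.1 hi with hi | rfl
    · exact H.closed i hi x hx
    · exact hc x hx

theorem Bfs.surj (H : Bfs G s q π t t) (hG : G.Connected) (x : Fin n) : ∃ j < t, q j = x := by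
  have hx := (reachable_iff_reflTransGen _ _).1 (hG s x)
  induction hx with
  | refl => exact ⟨0, H.pos, H.root⟩
  | tail _ hxy ih =>
    obtain ⟨i, hi, rfl⟩ := ih
    exact H.closed i hi _ hxy

theorem Bfs.card_le (H : Bfs G s q π h t) : t ≤ n := by
  have := Finset.card_le_card_of_injOn (s := Finset.range t) (t := (Finset.univ : Finset (Fin n))) q
    (fun _ _ ↦ Finset.mem_univ _)
    (fun i hi j hj hij ↦ H.inj i (by simpa using hi) j (by simpa using hj) hij)
  simpa using this

theorem Bfs.eq_card (H : Bfs G s q π t t) (hG : G.Connected) : t = n := by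
  refine le_antisymm H.card_le ?_
  have := Finset.card_le_card_of_surjOn (s := Finset.range t) (t := (Finset.univ : Finset (Fin n))) q
    (fun x _ ↦ by
      obtain ⟨j, hj, hx⟩ := H.surj hG x
      exact ⟨j, by simpa using hj, hx⟩)
  simpa using this

/-- No neighbour of `q i` lies before `q i` in the search, except for the parent, and none has
another parent than `q i`. -/
def Clean (G : SimpleGraph (Fin n)) (q : ℕ → Fin n) (π : ℕ → ℕ) (t i : ℕ) : Prop :=
  1 ≤ i ∧ ∀ j < t, G.Adj (q i) (q j) → j = π i ∨ 1 ≤ j ∧ π j = i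

theorem Bfs.exists_searchTree (H : Bfs G s q π n n) (hG : G.Connected) (hc : IsChordal G) :
    ∃ (pos : Fin n → ℕ) (p : Fin n → Fin n), SearchTree G s pos p ∧
      (∀ v, pos v < n ∧ q (pos v) = v) ∧ (∀ j < n, pos (q j) = j) ∧
      (∀ j, 1 ≤ j → j < n → p (q j) = q (π j)) ∧
      ∀ i < n, Clean G q π n i ↔ Flagged G s p (q i) := by
  choose pos hpos hq using H.surj hG
  have hpq : ∀ j < n, pos (q j) = j := fun j hj ↦ H.inj _ (hpos _) _ hj (hq _)
  have h1 : ∀ v, v ≠ s → 1 ≤ pos v := by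
    intro v hv
    by_contra h0
    apply hv
    rw [← hq v, show pos v = 0 by omega, H.root]
  have hs : pos s = 0 := by rw [← H.root]; exact hpq 0 H.pos
  have hlt : ∀ v, v ≠ s → π (pos v) < n := fun v hv ↦ (H.lt _ (h1 v hv) (hpos v)).trans (hpos v)
  have hST : SearchTree G s pos fun v ↦ q (π (pos v)) := by
    refine ⟨fun v w hvw ↦ ?_, hs, fun v hv ↦ ?_, fun v hv ↦ ?_, fun v y hv hy ↦ ?_,
      fun v w hv hw hvw ↦ ?_⟩
    · rw [← hq v, hvw, hq]
    · have := H.adj _ (h1 v hv) (hpos v)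
      rwa [hq] at this
    · rw [hpq _ (hlt v hv)]
      exact H.lt _ (h1 v hv) (hpos v)
    · rw [hpq _ (hlt v hv)]
      exact H.first _ (hpos y) _ (h1 v hv) (hpos v) (by rwa [hq, hq])
    · rw [hpq _ (hlt v hv), hpq _ (hlt w hw)]
      exact H.mono _ _ (h1 v hv) hvw (hpos w)
  refine ⟨pos, _, hST, fun v ↦ ⟨hpos v, hq v⟩, hpq, fun j _ hj ↦ by rw [hpq j hj], fun i hi ↦ ?_⟩
  -- `Clean` is the criterion of `flagged_iff`, expressed through positions in the queue.
  rw [hST.flagged_iff hc, Clean, hpq i hi]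
  have hi1 : 1 ≤ i ↔ q i ≠ s := by
    refine ⟨fun h h' ↦ ?_, fun h ↦ by simpa [hpq i hi] using h1 _ h⟩
    rw [← hpq i hi, h', hs] at h
    omega
  rw [hi1]
  refine and_congr_right fun hi0 ↦ ⟨fun h x hx ↦ ?_, fun h j hj hij ↦ ?_⟩
  · rcases h (pos x) (hpos x) (by rwa [hq]) with h2 | ⟨h2, h3⟩
    · exact .inl (by rw [← h2, hq])
    · refine .inr ⟨?_, by rw [h3]⟩
      rintro rfl
      omega
  · rcases h (q j) hij with h2 | ⟨h2, h3⟩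
    · left
      have := H.lt i (hi1.2 hi0) hi
      exact H.inj _ hj _ (by omega) h2
    · right
      have h4 : 1 ≤ j := by simpa [hpq j hj] using h1 _ h2
      have h5 := H.lt j h4 hj
      rw [hpq j hj] at h3
      exact ⟨h4, H.inj _ (by omega) _ hi h3⟩

/-- The state of the scan of the adjacency list of `q h`, whose entries at positions below `k`
have been inspected; `b = 0` if they satisfy the condition in `Clean`. -/
structure Scan (off ent : ℕ → ℕ) (q : ℕ → Fin n) (π : ℕ → ℕ) (h t k b : ℕ) : Prop where
  lo : off (q h) ≤ k
  hi : k ≤ off (q h + 1)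
  seen : ∀ l, off (q h) ≤ l → l < k → ∃ j < t, (q j : ℕ) = ent l
  new : ∀ j, 1 ≤ j → j < t → π j = h → ∃ l, off (q h) ≤ l ∧ l < k ∧ ent l = q j
  clean : b = 0 ↔ 1 ≤ h ∧ ∀ l, off (q h) ≤ l → l < k → ∀ j < t, (q j : ℕ) = ent l →
    j = π h ∨ 1 ≤ j ∧ π j = h

variable {k b : ℕ}

theorem Scan.start (hg : HoldsGraph G off ent) (hb : b = 0 ↔ 1 ≤ h) (hh : ∀ j, 1 ≤ j → j < t → π j < h) :
    Scan off ent q π h t (off (q h)) b where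
  lo := le_rfl
  hi := hg.mono _ (q h).2
  seen := by intros; omega
  new := fun j h1 hj h2 ↦ absurd (hh j h1 hj) (by omega)
  clean := by
    rw [hb]
    exact ⟨fun h ↦ ⟨h, by intros; omega⟩, fun h ↦ h.1⟩

/-- The new vertex becomes a child of `q h`, so the entry does not affect the flag. -/
theorem Scan.discover (H : Bfs G s q π h t)
    (S : Scan off ent q π h t k b) (hlt : h < t) (hk : k < off (q h + 1)) {x : Fin n}
    (hx : ent k = x) (hnew : ∀ j < t, q j ≠ x) :
    Scan off ent (Function.update q t x) (Function.update π t h) h (t + 1) (k + 1) b := by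
  have hq : ∀ j < t, Function.update q t x j = q j := fun j hj ↦ update_of_lt q x hj
  have hπ : ∀ j < t, Function.update π t h j = π j := fun j hj ↦ update_of_lt π h hj
  have hqt : Function.update q t x t = x := Function.update_self ..
  have hπt : Function.update π t h t = h := Function.update_self ..
  have hcase : ∀ j < t + 1, j < t ∨ j = t := fun j hj ↦ by omega
  have hqh := hq h hlt
  constructor
  · rw [hqh]; exact S.lo.trans (Nat.le_succ k)
  · rw [hqh]; exact hk
  · intro l h1 h2
    rw [hqh] at h1
    rcases Nat.lt_succ_iff_lt_or_eq.1 h2 with h2 | rfl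
    · obtain ⟨j, hj, hjl⟩ := S.seen l h1 h2
      exact ⟨j, by omega, by rw [hq j hj]; exact hjl⟩
    · exact ⟨t, by omega, by rw [hqt, hx]⟩
  · intro j h1 hj h2
    rw [hqh]
    rcases hcase j hj with hj | rfl
    · rw [hπ j hj] at h2
      obtain ⟨l, h3, h4, h5⟩ := S.new j h1 hj h2
      exact ⟨l, h3, by omega, by rw [hq j hj, h5]⟩
    · exact ⟨k, S.lo, by omega, by rw [hqt, hx]⟩
  · rw [S.clean, hqh, hπ h hlt]
    refine and_congr_right fun h1 ↦ ⟨fun hc l h2 h3 j hj hjl ↦ ?_, fun hc l h2 h3 j hj hjl ↦ ?_⟩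
    · rcases hcase j hj with hj | rfl
      · rw [hq j hj] at hjl
        rw [hπ j hj]
        rcases Nat.lt_succ_iff_lt_or_eq.1 h3 with h3 | rfl
        · exact hc l h2 h3 j hj hjl
        · exact absurd (Fin.ext (hjl.trans hx)) (hnew j hj)
      · exact .inr ⟨H.pos, hπt⟩
    · have := hc l h2 (by omega) j (by omega) (by rw [hq j hj]; exact hjl)
      rwa [hπ j hj] at this

/-- The children of `q h` come from entries before `k`, and the list has no repetition. So an entry
that is already in the queue is not a child, and only the parent leaves the flag at zero. -/
theorem Scan.known (hg : HoldsGraph G off ent) (S : Scan off ent q π h t k b)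
    (H : Bfs G s q π h t) (hk : k < off (q h + 1)) {j : ℕ} (hj : j < t)
    (hx : ent k = q j) {b' : ℕ} (hb : b' = 0 ↔ b = 0 ∧ 1 ≤ h ∧ j = π h) :
    Scan off ent q π h t (k + 1) b' where
  lo := S.lo.trans (Nat.le_succ k)
  hi := hk
  seen := fun l h1 h2 ↦ by
    rcases Nat.lt_succ_iff_lt_or_eq.1 h2 with h2 | rfl
    · exact S.seen l h1 h2
    · exact ⟨j, hj, hx.symm⟩
  new := fun i h1 hi h2 ↦ by
    obtain ⟨l, h3, h4, h5⟩ := S.new i h1 hi h2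
    exact ⟨l, h3, by omega, h5⟩
  clean := by
    rw [hb, S.clean]
    constructor
    · rintro ⟨⟨h1, hc⟩, -, rfl⟩
      refine ⟨h1, fun l h2 h3 i hi hil ↦ ?_⟩
      rcases Nat.lt_succ_iff_lt_or_eq.1 h3 with h3 | rfl
      · exact hc l h2 h3 i hi hil
      · exact .inl (H.inj i hi _ hj (Fin.ext (hil.trans hx)))
    · rintro ⟨h1, hc⟩
      refine ⟨⟨h1, fun l h2 h3 ↦ hc l h2 (by omega)⟩, h1, ?_⟩
      rcases hc k S.lo (by omega) j hj hx.symm with h2 | ⟨h2, h3⟩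
      · exact h2
      · obtain ⟨l, h4, h5, h6⟩ := S.new j h2 hj h3
        have := hg.inj (q h) l k h4 (by omega) S.lo hk (h6.trans hx.symm)
        omega

theorem Scan.closed (hg : HoldsGraph G off ent) (S : Scan off ent q π h t (off (q h + 1)) b)
    (x : Fin n) (hx : G.Adj (q h) x) : ∃ j < t, q j = x := by
  obtain ⟨l, h1, h2, h3⟩ := hg.complete _ _ hx
  obtain ⟨j, hj, h4⟩ := S.seen l h1 h2
  exact ⟨j, hj, Fin.ext (h4.trans h3)⟩

theorem Scan.clean_iff (hg : HoldsGraph G off ent) (S : Scan off ent q π h t (off (q h + 1)) b) :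
    b = 0 ↔ Clean G q π t h := by
  rw [S.clean, Clean]
  refine and_congr_right fun _ ↦ ⟨fun hc j hj hhj ↦ ?_, fun hc l h1 h2 j hj hjl ↦ ?_⟩
  · obtain ⟨l, h1, h2, h3⟩ := hg.complete _ _ hhj
    exact hc l h1 h2 j hj h3.symm
  · obtain ⟨x, hx, h3⟩ := hg.sound _ l h1 h2
    exact hc j hj (by rwa [Fin.ext (hjl.trans h3)])

end Search

/-! ### The program of the search -/

section Programs

/-- Sequential composition. -/
infixr:60 " ⨟ " => Program.seq

/-- Register 3 gets the root of the search: vertex 0, or its neighbour if it has only one. The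
queue is array 4, array 5 holds the parents, array 6 marks the vertices found so far, and
array 7 gets the value 0 at the vertices that are joined to their parents by a bridge. The
registers 5 and 6 hold the ends of the queue, and register 10 holds the vertex that is scanned,
with the bounds of the rest of its adjacency list in the registers 7 and 8. -/
def searchInit : Program :=
  .const 1 1 ⨟ .load 2 0 1 ⨟ .ite (.eq 2 1) (.load 3 1 4) .skip ⨟
  .store 4 4 3 ⨟ .store 6 3 1 ⨟ .store 5 3 0 ⨟ .copy 10 3 ⨟
  .load 7 0 10 ⨟ .copy 11 10 ⨟ .succ 11 ⨟ .load 8 0 11 ⨟ .const 9 1 ⨟ .const 5 1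

/-- One step of the search. -/
def searchBody : Program :=
  .ite (.lt 7 8)
    (.load 11 1 7 ⨟ .load 12 6 11 ⨟
      .ite (.eq 12 1)
        (.load 13 5 10 ⨟ .ite (.eq 11 13) .skip (.const 9 1))
        (.store 6 11 1 ⨟ .store 5 11 10 ⨟ .store 4 5 11 ⨟ .succ 5) ⨟
      .succ 7)
    (.store 7 10 9 ⨟ .succ 6 ⨟ .load 10 4 6 ⨟ .load 7 0 10 ⨟ .copy 11 10 ⨟ .succ 11 ⨟
      .load 8 0 11 ⨟ .const 9 0)

/-- The breadth first search. -/
def search : Program := searchInit ⨟ .while (.lt 6 5) searchBody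

end Programs

/-! ### Correctness and cost of the search -/

section SearchLoop

variable {n : ℕ} {G : SimpleGraph (Fin n)} {s : Fin n} {off ent : ℕ → ℕ} {q : ℕ → Fin n}
  {π : ℕ → ℕ} {h t : ℕ} {M : Memory}

/-- The memory during the search. -/
structure SearchMem (G : SimpleGraph (Fin n)) (s : Fin n) (off ent : ℕ → ℕ) (q : ℕ → Fin n)
    (π : ℕ → ℕ) (h t : ℕ) (M : Memory) : Prop where
  offsets : M.arr 0 = off
  entries : M.arr 1 = ent
  queue : ∀ i < t, M.arr 4 i = q i
  parent : ∀ j, 1 ≤ j → j < t → M.arr 5 (q j) = q (π j)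
  parent_root : M.arr 5 s = n
  found : ∀ x : Fin n, M.arr 6 x = 1 ↔ ∃ j < t, q j = x
  flag : ∀ i < h, M.arr 7 (q i) = 0 ↔ Clean G q π t i
  zero : ∀ i, M.arr 8 i = 0 ∧ M.arr 9 i = 0
  reg_zero : M.reg 0 = n
  reg_one : M.reg 1 = 1
  head : M.reg 6 = h
  tail : M.reg 5 = t
  scan : h < t → M.reg 10 = q h ∧ M.reg 8 = off (q h + 1) ∧
    Scan off ent q π h t (M.reg 7) (M.reg 9)

/-- The number of steps in the scans of the first `h` vertices of the queue. -/
def work (off : ℕ → ℕ) (q : ℕ → Fin n) (h : ℕ) : ℕ :=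
  ∑ i ∈ Finset.range h, (off (q i + 1) - off (q i) + 1)

/-- The queue has no repetition, so the cost is at most that of scanning all lists, a telescoping
sum. -/
theorem work_le (hg : HoldsGraph G off ent) (H : Bfs G s q π h t) {k : ℕ} (hk : k ≤ t) :
    work off q k ≤ n + off n := by
  have h1 : work off q k ≤ ∑ v : Fin n, (off (v + 1) - off v + 1) := by
    rw [work, ← Finset.sum_image (f := fun v : Fin n ↦ off (v + 1) - off v + 1) (g := q)]
    · exact Finset.sum_le_sum_of_subset (Finset.subset_univ _)
    · intro i hi j hj hij
      simp only [Finset.coe_range, Set.mem_Iio] at hi hj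
      exact H.inj i (by omega) j (by omega) hij
  have h2 : ∀ i ≤ n, ∑ j ∈ Finset.range i, (off (j + 1) - off j + 1) = i + off i := by
    intro i
    induction i with
    | zero => simp [hg.zero]
    | succ i ih =>
      intro hi
      have := hg.mono i (by omega)
      rw [Finset.sum_range_succ, ih (by omega)]
      omega
  rw [← h2 n le_rfl, Finset.sum_range]
  exact h1

theorem work_update (q : ℕ → Fin n) (x : Fin n) {h t : ℕ} (hlt : h ≤ t) :
    work off (Function.update q t x) h = work off q h := by
  refine Finset.sum_congr rfl fun i hi ↦ ?_
  rw [update_of_lt q x (by have := Finset.mem_range.1 hi; omega)]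

/-- All neighbours of a scanned vertex are in the queue, so later discoveries leave its flag valid.
-/
theorem Clean.update_iff (H : Bfs G s q π h t) {i : ℕ} (hi : i < h) (hlt : h < t) {x : Fin n}
    (hnew : ∀ j < t, q j ≠ x) :
    Clean G (Function.update q t x) (Function.update π t h) (t + 1) i ↔ Clean G q π t i := by
  have hq : ∀ j < t, Function.update q t x j = q j := fun j hj ↦ update_of_lt q x hj
  have hπ : ∀ j < t, Function.update π t h j = π j := fun j hj ↦ update_of_lt π h hj
  have hqt : Function.update q t x t = x := Function.update_self ..
  rw [Clean, Clean, hq i (by omega), hπ i (by omega)]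
  refine and_congr_right fun _ ↦ ⟨fun hc j hj hij ↦ ?_, fun hc j hj hij ↦ ?_⟩
  · have := hc j (by omega) (by rwa [hq j hj])
    rwa [hπ j hj] at this
  · rcases Nat.lt_succ_iff_lt_or_eq.1 hj with hj | rfl
    · rw [hq j hj] at hij
      rw [hπ j hj]
      exact hc j hj hij
    · rw [hqt] at hij
      obtain ⟨k, hk, hkx⟩ := H.closed i hi x hij
      exact absurd hkx (hnew k hk)

theorem SearchMem.discover (hm : SearchMem G s off ent q π h t M) (H : Bfs G s q π h t)
    (hlt : h < t) (hk : M.reg 7 < off (q h + 1)) {x : Fin n} (hx : ent (M.reg 7) = x)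
    (hnew : ∀ j < t, q j ≠ x) :
    SearchMem G s off ent (Function.update q t x) (Function.update π t h) h (t + 1)
        (searchBody.eval M) ∧
      (searchBody.eval M).reg 7 = M.reg 7 + 1 := by
  obtain ⟨hc, he, hS⟩ := hm.scan hlt
  have hfound : M.arr 6 x ≠ 1 := fun h ↦ by
    obtain ⟨j, hj, hjx⟩ := (hm.found x).1 h
    exact hnew j hj hjx
  have hq : ∀ j < t, Function.update q t x j = q j := fun j hj ↦ update_of_lt q x hj
  have hπ : ∀ j < t, Function.update π t h j = π j := fun j hj ↦ update_of_lt π h hj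
  have hqt : Function.update q t x t = x := Function.update_self ..
  have hπt : Function.update π t h t = h := Function.update_self ..
  have e : searchBody.eval M =
      ⟨Function.update (Function.update (Function.update (Function.update M.reg 11 x) 12
          (M.arr 6 x)) 5 (t + 1)) 7 (M.reg 7 + 1),
        Function.update (Function.update (Function.update M.arr 6 (Function.update (M.arr 6) x 1)) 5
          (Function.update (M.arr 5) x (q h))) 4 (Function.update (M.arr 4) t x)⟩ := by
    simp only [searchBody, Program.eval, Test.Holds, Memory.setReg, Memory.setArr]
    simp [he, hk, hm.entries, hx, hm.reg_one, hfound, hc, hm.tail]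
  have hpos := H.pos
  rw [e]
  refine ⟨⟨?_, ?_, ?_, ?_, ?_, ?_, ?_, ?_, ?_, ?_, ?_, ?_, ?_⟩, ?_⟩
  · simpa using hm.offsets
  · simpa using hm.entries
  · intro i hi
    rcases Nat.lt_succ_iff_lt_or_eq.1 hi with hi | rfl
    · simpa [hi.ne] using hm.queue i hi
    · simp
  · intro j h1 hj
    rcases Nat.lt_succ_iff_lt_or_eq.1 hj with hj | rfl
    · have h2 := H.lt j h1 hj
      rw [hq j hj, hπ j hj, hq _ (by omega)]
      have : (q j : ℕ) ≠ x := fun h ↦ hnew j hj (Fin.ext h)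
      simpa [this] using hm.parent j h1 hj
    · rw [hqt, hπt, hq h hlt]
      simp
  · have : (s : ℕ) ≠ x := fun h ↦ hnew 0 hpos (by rw [H.root]; exact Fin.ext h)
    simpa [this] using hm.parent_root
  · intro y
    by_cases hy : y = x
    · subst hy
      simpa using ⟨t, by omega, hqt⟩
    · have hy' : (y : ℕ) ≠ x := fun h ↦ hy (Fin.ext h)
      have : M.arr 6 y = 1 ↔ ∃ j < t + 1, Function.update q t x j = y := by
        rw [hm.found]
        constructor
        · rintro ⟨j, hj, rfl⟩
          exact ⟨j, by omega, hq j hj⟩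
        · rintro ⟨j, hj, rfl⟩
          rcases Nat.lt_succ_iff_lt_or_eq.1 hj with hj | rfl
          · exact ⟨j, hj, (hq j hj).symm⟩
          · exact absurd hqt hy
      simpa [hy'] using this
  · intro i hi
    rw [Clean.update_iff H hi hlt hnew, hq i (by omega)]
    simpa using hm.flag i hi
  · simpa using hm.zero
  · simpa using hm.reg_zero
  · simpa using hm.reg_one
  · simpa using hm.head
  · simp
  · intro _
    rw [hq h hlt]
    exact ⟨by simpa using hc, by simpa using he, by simpa using hS.discover H hlt hk hx hnew⟩
  · simp

theorem SearchMem.known (hm : SearchMem G s off ent q π h t M) (H : Bfs G s q π h t)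
    (hg : HoldsGraph G off ent)
    (hlt : h < t) (hk : M.reg 7 < off (q h + 1)) {j : ℕ} (hj : j < t)
    (hx : ent (M.reg 7) = q j) :
    SearchMem G s off ent q π h t (searchBody.eval M) ∧
      (searchBody.eval M).reg 7 = M.reg 7 + 1 := by
  obtain ⟨hc, he, hS⟩ := hm.scan hlt
  have hfound : M.arr 6 (q j) = 1 := (hm.found _).2 ⟨j, hj, rfl⟩
  -- For the root, the stored parent `n` is no vertex, so the comparison fails, in accordance with
  -- `1 ≤ h`.
  have hpar : 1 ≤ h ∧ j = π h ↔ (q j : ℕ) = M.arr 5 (q h) := by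
    by_cases h1 : 1 ≤ h
    · have := H.lt h h1 hlt
      rw [hm.parent h h1 hlt]
      refine ⟨fun h ↦ by rw [← h.2], fun h ↦ ⟨h1, H.inj _ hj _ (by omega) (Fin.ext h)⟩⟩
    · have h0 : h = 0 := by omega
      rw [h0, H.root, hm.parent_root]
      have := (q j).2
      omega
  obtain ⟨b, hb, e⟩ : ∃ b, (b = 0 ↔ M.reg 9 = 0 ∧ 1 ≤ h ∧ j = π h) ∧ searchBody.eval M =
      ⟨Function.update (Function.update (Function.update (Function.update (Function.update M.reg
        11 (q j)) 12 1) 13 (M.arr 5 (q h))) 9 b) 7 (M.reg 7 + 1), M.arr⟩ := by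
    by_cases hp : (q j : ℕ) = M.arr 5 (q h)
    · refine ⟨M.reg 9, by tauto, ?_⟩
      simp only [searchBody, Program.eval, Test.Holds, Memory.setReg, Memory.setArr]
      simp [he, hk, hm.entries, hx, hm.reg_one, hfound, hc, ← hp]
      funext i
      simp only [Function.update_apply]
      grind
    · refine ⟨1, by tauto, ?_⟩
      simp only [searchBody, Program.eval, Test.Holds, Memory.setReg, Memory.setArr]
      simp [he, hk, hm.entries, hx, hm.reg_one, hfound, hc, hp]
  rw [e]
  refine ⟨⟨hm.offsets, hm.entries, hm.queue, hm.parent, hm.parent_root, hm.found, hm.flag, hm.zero,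
    ?_, ?_, ?_, ?_, fun _ ↦ ⟨?_, ?_, ?_⟩⟩, ?_⟩
  · simpa using hm.reg_zero
  · simpa using hm.reg_one
  · simpa using hm.head
  · simpa using hm.tail
  · simpa using hc
  · simpa using he
  · simpa using hS.known hg H hk hj hx hb
  · simp

theorem SearchMem.finish (hm : SearchMem G s off ent q π h t M) (H : Bfs G s q π h t)
    (hg : HoldsGraph G off ent)
    (hlt : h < t) (hk : ¬ M.reg 7 < off (q h + 1)) :
    Bfs G s q π (h + 1) t ∧ SearchMem G s off ent q π (h + 1) t (searchBody.eval M) ∧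
      (h + 1 < t → (searchBody.eval M).reg 7 = off (q (h + 1))) := by
  obtain ⟨hc, he, hS⟩ := hm.scan hlt
  have h7 : M.reg 7 = off (q h + 1) := le_antisymm hS.hi (by omega)
  rw [h7] at hS
  have H' := H.finish hlt (hS.closed hg)
  have e : searchBody.eval M =
      ⟨Function.update (Function.update (Function.update (Function.update (Function.update
        (Function.update M.reg 6 (h + 1)) 10 (M.arr 4 (h + 1))) 7 (off (M.arr 4 (h + 1))))
        11 (M.arr 4 (h + 1) + 1)) 8 (off (M.arr 4 (h + 1) + 1))) 9 0,
        Function.update M.arr 7 (Function.update (M.arr 7) (q h) (M.reg 9))⟩ := by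
    simp only [searchBody, Program.eval, Test.Holds, Memory.setReg, Memory.setArr]
    simp [he, hk, hm.offsets, hc, hm.head]
  rw [e]
  refine ⟨H', ⟨?_, ?_, ?_, ?_, ?_, ?_, ?_, ?_, ?_, ?_, ?_, ?_, fun hlt' ↦ ⟨?_, ?_, ?_⟩⟩, fun hlt' ↦ ?_⟩
  · simpa using hm.offsets
  · simpa using hm.entries
  · simpa using hm.queue
  · simpa using hm.parent
  · simpa using hm.parent_root
  · simpa using hm.found
  · intro i hi
    rcases Nat.lt_succ_iff_lt_or_eq.1 hi with hi | rfl
    · have : (q i : ℕ) ≠ q h := fun h ↦ by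
        have := H.inj i (by omega) _ hlt (Fin.ext h)
        omega
      simpa [this] using hm.flag i hi
    · simpa using hS.clean_iff hg
  · simpa using hm.zero
  · simpa using hm.reg_zero
  · simpa using hm.reg_one
  · simp
  · simpa using hm.tail
  · simpa using hm.queue _ hlt'
  · simp [hm.queue _ hlt']
  · have : Scan off ent q π (h + 1) t (off (q (h + 1))) 0 :=
      Scan.start hg (by simp) fun j h1 hj ↦ by have := H.parent_le j h1 hj; omega
    simpa [hm.queue _ hlt'] using this
  · simp [hm.queue _ hlt']

/-- The invariant of the search. -/
def SearchInv (G : SimpleGraph (Fin n)) (s : Fin n) (off ent : ℕ → ℕ) (k : ℕ) (M : Memory) :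
    Prop :=
  ∃ q π h t, Bfs G s q π h t ∧ SearchMem G s off ent q π h t M ∧
    k = n + off n - (work off q h + if h < t then M.reg 7 - off (q h) else 0)

theorem work_succ : work off q (h + 1) = work off q h + (off (q h + 1) - off (q h) + 1) :=
  Finset.sum_range_succ _ _

/-- The measure drops by one with each entry inspected. It drops by one more when a list ends, which
is what the summand one for each vertex in `work` pays for. -/
theorem searchInv_step (hg : HoldsGraph G off ent) (k : ℕ) (M : Memory)
    (hI : SearchInv G s off ent k M) (hb : (Test.lt 6 5).Holds M) :
    ∃ l < k, SearchInv G s off ent l (searchBody.eval M) := by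
  obtain ⟨q, π, h, t, H, hm, rfl⟩ := hI
  have hlt : h < t := by simpa [Test.Holds, hm.head, hm.tail] using hb
  obtain ⟨-, -, hS⟩ := hm.scan hlt
  have hw := work_le hg H (k := h + 1) hlt
  rw [work_succ] at hw
  have hlo := hS.lo
  have hhi := hS.hi
  rw [if_pos hlt]
  by_cases hk : M.reg 7 < off (q h + 1)
  · by_cases hold : ∃ j < t, (q j : ℕ) = ent (M.reg 7)
    · obtain ⟨j, hj, hx⟩ := hold
      obtain ⟨hm', h7⟩ := hm.known H hg hlt hk hj hx.symm
      refine ⟨_, ?_, q, π, h, t, H, hm', rfl⟩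
      rw [if_pos hlt, h7]
      omega
    · obtain ⟨x, hadj, hx⟩ := hg.sound _ _ hS.lo hk
      have hnew : ∀ j < t, q j ≠ x := fun j hj h ↦ hold ⟨j, hj, by rw [h, hx]⟩
      obtain ⟨hm', h7⟩ := hm.discover H hlt hk hx hnew
      refine ⟨_, ?_, _, _, h, t + 1, H.discover hlt hadj hnew, hm', rfl⟩
      rw [if_pos (by omega), h7, work_update _ _ hlt.le, update_of_lt _ _ hlt]
      omega
  · obtain ⟨H', hm', h7⟩ := hm.finish H hg hlt hk
    refine ⟨_, ?_, q, π, h + 1, t, H', hm', rfl⟩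
    rw [work_succ]
    split_ifs with h1
    · rw [h7 h1]
      omega
    · omega

theorem two_le_degree (hG : G.Connected) (hn : 3 ≤ n) {u v : Fin n} (huv : G.Adj u v)
    (hu : ∀ w, G.Adj u w → w = v) : ∃ w, G.Adj v w ∧ w ≠ u := by
  by_contra! hv
  have hall : ∀ x, x = u ∨ x = v := by
    intro x
    have hx := (reachable_iff_reflTransGen _ _).1 (hG u x)
    induction hx with
    | refl => exact .inl rfl
    | tail _ h ih =>
      rcases ih with rfl | rfl
      · exact .inr (hu _ h)
      · exact .inl (hv _ h)
  have h1 : (Finset.univ : Finset (Fin n)) ⊆ {u, v} := fun x _ ↦ by simpa using hall x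
  have := (Finset.card_le_card h1).trans Finset.card_le_two
  rw [Finset.card_univ, Fintype.card_fin] at this
  omega

theorem exists_adj_of_connected (hG : G.Connected) (hn : 3 ≤ n) (v : Fin n) : ∃ w, G.Adj v w := by
  have : Nontrivial (Fin n) := Fin.nontrivial_iff_two_le.2 (by omega)
  exact hG.preconnected.exists_adj_of_nontrivial v

/-- The root has at least two neighbours. -/
theorem searchInit_spec (hG : G.Connected) (hn : 3 ≤ n) (A : AdjLists G) :
    ∃ s : Fin n, (∃ x y, G.Adj s x ∧ G.Adj s y ∧ x ≠ y) ∧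
      SearchInv G s (A.initial.arr 0) (A.initial.arr 1) (n + A.initial.arr 0 n)
        (searchInit.eval A.initial) := by
  have hg := A.holdsGraph
  obtain ⟨off, ho⟩ : ∃ off, off = A.initial.arr 0 := ⟨_, rfl⟩
  obtain ⟨ent, he⟩ : ∃ ent, ent = A.initial.arr 1 := ⟨_, rfl⟩
  rw [← ho, ← he] at hg ⊢
  have harr : ∀ a i, A.initial.arr a i = if a = 0 then off i else if a = 1 then ent i else 0 := by
    intro a i
    rw [ho, he]
    by_cases h0 : a = 0
    · simp [h0]
    by_cases h1 : a = 1
    · simp [h1]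
    simp [AdjLists.initial, h0, h1]
  have hreg : ∀ x, A.initial.reg x = if x = 0 then n else 0 := fun x ↦ rfl
  obtain ⟨z, hz⟩ : ∃ z : Fin n, (z : ℕ) = 0 := ⟨⟨0, by omega⟩, rfl⟩
  -- If vertex 0 has a single neighbour, then this neighbour has another one, as `n ≥ 3`; otherwise
  -- vertex 0 will do.
  obtain ⟨s, hs, hsv⟩ : ∃ s : Fin n, (∃ x y, G.Adj s x ∧ G.Adj s y ∧ x ≠ y) ∧
      (s : ℕ) = if off 1 = 1 then ent 0 else 0 := by
    obtain ⟨w, hw⟩ := exists_adj_of_connected hG hn z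
    obtain ⟨k, hk1, hk2, hk3⟩ := hg.complete _ _ hw
    rw [hz, hg.zero] at hk1
    rw [hz, Nat.zero_add] at hk2
    by_cases h1 : off 1 = 1
    · obtain rfl : k = 0 := by omega
      rw [if_pos h1, hk3]
      refine ⟨w, ?_, rfl⟩
      obtain ⟨x, hx, hxz⟩ := two_le_degree hG hn hw fun w' hw' ↦ by
        obtain ⟨l, hl1, hl2, hl3⟩ := hg.complete _ _ hw'
        rw [hz, Nat.zero_add] at hl2
        obtain rfl : l = 0 := by omega
        exact Fin.ext (hl3.symm.trans hk3)
      exact ⟨x, z, hx, hw.symm, hxz⟩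
    · rw [if_neg h1]
      refine ⟨z, ?_, hz⟩
      have h0 : off (z : ℕ) = 0 := by rw [hz, hg.zero]
      have h2 : 2 ≤ off (z + 1) := by
        rw [hz, Nat.zero_add]
        omega
      obtain ⟨x, hx, hx'⟩ := hg.sound z 0 (by omega) (by omega)
      obtain ⟨y, hy, hy'⟩ := hg.sound z 1 (by omega) (by omega)
      refine ⟨x, y, hx, hy, ?_⟩
      rintro rfl
      have := hg.inj z 0 1 (by omega) (by omega) (by omega) (by omega) (hx'.trans hy'.symm)
      omega
  refine ⟨s, hs, fun _ ↦ s, fun _ ↦ 0, 0, 1, Bfs.initial, ?_⟩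
  -- Registers 2 and 11 keep auxiliary values that the invariant ignores.
  have e : ∃ r2 r11, searchInit.eval A.initial =
      ⟨fun x ↦ if x = 5 then 1 else if x = 9 then 1 else if x = 8 then off (s + 1) else
          if x = 11 then r11 else if x = 7 then off s else if x = 10 then s else if x = 3 then s else
          if x = 2 then r2 else if x = 1 then 1 else if x = 0 then n else 0,
        Function.update (Function.update (Function.update A.initial.arr 4
          (Function.update (A.initial.arr 4) 0 s)) 6 (Function.update (A.initial.arr 6) s 1)) 5
          (Function.update (A.initial.arr 5) s n)⟩ := by
    refine ⟨off 1, s + 1, ?_⟩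
    simp only [searchInit, Program.eval, Test.Holds, Memory.setReg, Memory.setArr]
    by_cases h1 : off 1 = 1
    · rw [if_pos h1] at hsv
      simp [harr, hreg, h1, ← hsv]
      funext x
      simp only [Function.update_apply, hreg]
    · rw [if_neg h1] at hsv
      simp [harr, hreg, h1, hsv]
      funext x
      simp only [Function.update_apply, hreg]
      grind
  obtain ⟨r2, r11, e⟩ := e
  rw [e]
  refine ⟨⟨?_, ?_, ?_, ?_, ?_, ?_, ?_, ?_, ?_, ?_, ?_, ?_, fun hlt' ↦ ⟨?_, ?_, ?_⟩⟩, ?_⟩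
  · simpa using ho.symm
  · simpa using he.symm
  · intro i hi
    obtain rfl : i = 0 := by omega
    simp
  · intro j h1 h2
    omega
  · simp
  · intro x
    by_cases hx : x = s
    · subst hx
      simp
    · have : (x : ℕ) ≠ s := fun h ↦ hx (Fin.ext h)
      simp [this, harr, Ne.symm hx]
  · intro i hi
    omega
  · simp [harr]
  · simp
  · simp
  · simp
  · simp
  · simp
  · simp
  -- The flag starts at 1 because the root has no edge to a parent.
  · have : Scan off ent (fun _ ↦ s) (fun _ ↦ 0) 0 1 (off s) 1 :=
      Scan.start hg (by simp) fun j h1 hj ↦ by omega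
    simpa using this
  · simp [work]

theorem searchInit_loopFree : searchInit.LoopFree := by simp [searchInit, Program.LoopFree]

theorem searchBody_loopFree : searchBody.LoopFree := by simp [searchBody, Program.LoopFree]

/-- The result of the search. -/
theorem search_spec (hG : G.Connected) (hn : 3 ≤ n) (A : AdjLists G) :
    ∃ (s : Fin n) (q : ℕ → Fin n) (π : ℕ → ℕ) (t : ℕ) (M : Memory),
      (∃ x y, G.Adj s x ∧ G.Adj s y ∧ x ≠ y) ∧
      Exec search A.initial t M ∧
      t ≤ searchInit.size + (searchBody.size + 1) * (n + A.initial.arr 0 n) + 1 ∧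
      Bfs G s q π n n ∧
      SearchMem G s (A.initial.arr 0) (A.initial.arr 1) q π n n M := by
  obtain ⟨s, hs, hI⟩ := searchInit_spec hG hn A
  obtain ⟨t, ht, h1⟩ := searchInit_loopFree.exec A.initial
  obtain ⟨t', l, M, h2, ⟨q, π, h, k, H, hm, -⟩, h4, h5⟩ :=
    exec_while searchBody_loopFree (searchInv_step A.holdsGraph) hI
  have hk : h = k := by
    have := H.le
    simp only [Test.Holds, hm.head, hm.tail] at h4
    omega
  subst hk
  obtain rfl := H.eq_card hG
  exact ⟨s, q, π, t + t', M, hs, .seq h1 h2, by omega, H, hm⟩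

end SearchLoop

/-! ### The program that collects children -/

section Programs

/-- One step of the loop that finds up to two vertices whose parent is a given vertex and that
are joined to it by a bridge: array 8 and array 9 hold their successors, or 0. -/
def childBody : Program :=
  .load 4 4 2 ⨟ .load 5 7 4 ⨟
    .ite (.eq 5 3)
      (.load 6 5 4 ⨟ .load 7 8 6 ⨟ .store 9 6 7 ⨟ .copy 8 4 ⨟ .succ 8 ⨟ .store 8 6 8) .skip ⨟
    .succ 2

/-- The loop that fills the arrays 8 and 9. -/
def findChildren : Program :=
  (.const 2 0 ⨟ .const 3 0) ⨟ .while (.lt 2 0) childBody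

end Programs

/-! ### Two children of each vertex -/

section ChildLoop

variable {n : ℕ} {G : SimpleGraph (Fin n)} {s : Fin n} {pos : Fin n → ℕ} {p : Fin n → Fin n}
  {off ent : ℕ → ℕ} {M : Memory} {i : ℕ}

/-- What the memory holds of the graph and of the search tree. -/
structure TreeMem (s : Fin n) (pos : Fin n → ℕ) (p : Fin n → Fin n) (off ent : ℕ → ℕ)
    (M : Memory) : Prop where
  offsets : M.arr 0 = off
  entries : M.arr 1 = ent
  order : ∀ v, M.arr 4 (pos v) = v
  parent : ∀ v, v ≠ s → M.arr 5 v = p v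
  parent_root : M.arr 5 s = n
  reg_zero : M.reg 0 = n
  reg_one : M.reg 1 = 1

/-- Up to two of the flagged vertices with parent `u` at positions below `i` are given by `a` and
`b`. -/
structure Children (G : SimpleGraph (Fin n)) (s : Fin n) (pos : Fin n → ℕ) (p : Fin n → Fin n)
    (i a b : ℕ) (u : Fin n) : Prop where
  first : a = 0 ∧ (∀ v, Flagged G s p v → pos v < i → p v ≠ u) ∨
    ∃ z : Fin n, a = z + 1 ∧ Flagged G s p z ∧ p z = u ∧ pos z < i
  second : b = 0 ∧ (∀ v : Fin n, Flagged G s p v → pos v < i → p v = u → a = v + 1) ∨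
    ∃ y : Fin n, b = y + 1 ∧ Flagged G s p y ∧ p y = u ∧ a ≠ y + 1

theorem Children.skip {a b : ℕ} {u v : Fin n} (h : Children G s pos p i a b u)
    (hinj : Function.Injective pos) (hv : pos v = i)
    (hne : Flagged G s p v → p v ≠ u) : Children G s pos p (i + 1) a b u := by
  have hw : ∀ w, Flagged G s p w → pos w < i + 1 → p w = u → pos w < i := by
    intro w hf hw hp
    rcases Nat.lt_succ_iff_lt_or_eq.1 hw with hw | hw
    · exact hw
    · rw [← hv] at hw
      rw [hinj hw] at hf hp
      exact absurd hp (hne hf)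
  refine ⟨h.first.imp (fun h' ↦ ⟨h'.1, fun w hf hw' hp ↦ h'.2 w hf (hw w hf hw' hp) hp⟩) ?_,
    h.second.imp (fun h' ↦ ⟨h'.1, fun w hf hw' hp ↦ h'.2 w hf (hw w hf hw' hp) hp⟩) id⟩
  rintro ⟨z, h1, h2, h3, h4⟩
  exact ⟨z, h1, h2, h3, by omega⟩

/-- The former first child, if any, moves to second place; it is not `v`, because it has an earlier
position. -/
theorem Children.push {a b : ℕ} {u v : Fin n} (h : Children G s pos p i a b u)
    (hinj : Function.Injective pos) (hv : pos v = i) (hf : Flagged G s p v) (hp : p v = u) :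
    Children G s pos p (i + 1) (v + 1) a u := by
  refine ⟨.inr ⟨v, rfl, hf, hp, by omega⟩, ?_⟩
  rcases h.first with ⟨h1, h2⟩ | ⟨z, h1, h2, h3, h4⟩
  · refine .inl ⟨h1, fun w hfw hw hpw ↦ ?_⟩
    rcases Nat.lt_succ_iff_lt_or_eq.1 hw with hw | hw
    · exact absurd hpw (h2 w hfw hw)
    · rw [hinj (hw.trans hv.symm)]
  · refine .inr ⟨z, h1, h2, h3, fun h ↦ ?_⟩
    have : v = z := Fin.ext (by omega)
    rw [this] at hv
    omega

/-- The invariant of the loop that fills the arrays 8 and 9. -/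
structure ChildInv (G : SimpleGraph (Fin n)) (s : Fin n) (pos : Fin n → ℕ) (p : Fin n → Fin n)
    (off ent : ℕ → ℕ) (i : ℕ) (M : Memory) : Prop where
  mem : TreeMem s pos p off ent M
  flag : ∀ v : Fin n, M.arr 7 v = 0 ↔ Flagged G s p v
  children : ∀ u : Fin n, Children G s pos p i (M.arr 8 u) (M.arr 9 u) u
  index : M.reg 2 = i
  zero : M.reg 3 = 0

theorem ChildInv.step (h : ChildInv G s pos p off ent i M) (hinj : Function.Injective pos)
    {v : Fin n} (hv : pos v = i) : ChildInv G s pos p off ent (i + 1) (childBody.eval M) := by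
  have h4 : M.arr 4 i = v := by rw [← hv]; exact h.mem.order v
  by_cases hf : Flagged G s p v
  · have h7 := (h.flag v).2 hf
    have h5 := h.mem.parent v hf.1
    have e : childBody.eval M =
        ⟨Function.update (Function.update (Function.update (Function.update (Function.update
          (Function.update M.reg 4 v) 5 0) 6 (p v)) 7 (M.arr 8 (p v))) 8 (v + 1)) 2 (i + 1),
          Function.update (Function.update M.arr 9 (Function.update (M.arr 9) (p v) (M.arr 8 (p v))))
          8 (Function.update (M.arr 8) (p v) (v + 1))⟩ := by
      simp only [childBody, Program.eval, Test.Holds, Memory.setReg, Memory.setArr]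
      simp [h4, h7, h5, h.index, h.zero]
    rw [e]
    refine ⟨⟨?_, ?_, ?_, ?_, ?_, ?_, ?_⟩, ?_, fun u ↦ ?_, ?_, ?_⟩
    · simpa using h.mem.offsets
    · simpa using h.mem.entries
    · simpa using h.mem.order
    · simpa using h.mem.parent
    · simpa using h.mem.parent_root
    · simpa using h.mem.reg_zero
    · simpa using h.mem.reg_one
    · simpa using h.flag
    · by_cases hu : p v = u
      · subst hu
        simpa using (h.children _).push hinj hv hf rfl
      · have hu' : (u : ℕ) ≠ p v := fun h ↦ hu (Fin.ext h.symm)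
        simpa [hu'] using (h.children u).skip hinj hv fun _ ↦ hu
    · simp
    · simpa using h.zero
  · have h7 : M.arr 7 v ≠ 0 := fun h0 ↦ hf ((h.flag v).1 h0)
    have e : childBody.eval M =
        ⟨Function.update (Function.update (Function.update M.reg 4 v) 5 (M.arr 7 v)) 2 (i + 1),
          M.arr⟩ := by
      simp only [childBody, Program.eval, Test.Holds, Memory.setReg, Memory.setArr]
      simp [h4, h7, h.index, h.zero]
    rw [e]
    refine ⟨⟨h.mem.offsets, h.mem.entries, h.mem.order, h.mem.parent, h.mem.parent_root, ?_, ?_⟩,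
      h.flag, fun u ↦ (h.children u).skip hinj hv fun h ↦ absurd h hf, ?_, ?_⟩
    · simpa using h.mem.reg_zero
    · simpa using h.mem.reg_one
    · simp
    · simpa using h.zero

theorem findChildren_spec (hm : TreeMem s pos p off ent M)
    (hflag : ∀ v : Fin n, M.arr 7 v = 0 ↔ Flagged G s p v) (hzero : ∀ i, M.arr 8 i = 0 ∧ M.arr 9 i = 0)
    (hinj : Function.Injective pos) (hsurj : ∀ i < n, ∃ v, pos v = i) :
    ∃ t M', Exec findChildren M t M' ∧ t ≤ 2 + (childBody.size + 1) * n + 1 ∧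
      ChildInv G s pos p off ent n M' := by
  have h0 : ChildInv G s pos p off ent 0 ((Program.const 2 0 ⨟ .const 3 0).eval M) := by
    simp only [Program.eval, Memory.setReg]
    refine ⟨⟨hm.offsets, hm.entries, hm.order, hm.parent, hm.parent_root, ?_, ?_⟩, hflag,
      fun u ↦ ⟨.inl ⟨(hzero u).1, by intros; omega⟩, .inl ⟨(hzero u).2, by intros; omega⟩⟩, ?_, ?_⟩
    · simpa using hm.reg_zero
    · simpa using hm.reg_one
    · simp
    · simp
  obtain ⟨t, ht, h1⟩ := Program.LoopFree.exec (P := .const 2 0 ⨟ .const 3 0)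
    (by simp [Program.LoopFree]) M
  obtain ⟨t', l, M', h2, ⟨i, hi, hI, rfl⟩, h4, h5⟩ :=
    exec_while (P := childBody) (b := .lt 2 0) (by simp [childBody, Program.LoopFree])
      (I := fun k M ↦ ∃ i ≤ n, ChildInv G s pos p off ent i M ∧ k = n - i)
      (fun k M ⟨i, hi, hI, hk⟩ hb ↦ by
        have hlt : i < n := by simpa [Test.Holds, hI.index, hI.mem.reg_zero] using hb
        obtain ⟨v, hv⟩ := hsurj i hlt
        exact ⟨n - (i + 1), by omega, i + 1, hlt, hI.step hinj hv, rfl⟩)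
      ⟨0, Nat.zero_le n, h0, rfl⟩
  have hin : i = n := by
    simp only [Test.Holds, hI.index, hI.mem.reg_zero] at h4
    omega
  subst hin
  refine ⟨t + t', M', .seq h1 h2, ?_, hI⟩
  simp only [Program.size] at ht
  simp only [Nat.sub_zero] at h5
  omega

end ChildLoop

/-! ### The program that adds the edges -/

section Programs

/-- Register 11 gets the other end of the edge that is added at the vertex in register 9 to put
the last edge of its tree, which leads to the vertex in register 10, into a triangle. -/
def pick : Program :=
  .load 11 8 10 ⨟ .pred 11 ⨟
    .ite (.eq 11 9)
      (.load 11 9 10 ⨟ .ite (.lt 3 11) (.pred 11)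
        (.load 13 0 10 ⨟ .load 11 1 13 ⨟ .ite (.eq 11 9) (.succ 13 ⨟ .load 11 1 13) .skip)) .skip

/-- Add an edge when the last edge of a tree joins the vertices in the registers 9 and 10. -/
def last : Program :=
  .load 11 8 9 ⨟
    .ite (.lt 3 11) (.pred 11 ⨟ .store 2 6 10 ⨟ .store 3 6 11 ⨟ .succ 6)
      (pick ⨟ .store 2 6 9 ⨟ .store 3 6 11 ⨟ .succ 6)

/-- Extract the edge from the vertex in register 9 to its parent in register 10, which has no
remaining sibling. -/
def close : Program :=
  .load 11 7 10 ⨟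
    .ite (.eq 11 3)
      (.load 12 5 10 ⨟ .store 2 6 9 ⨟ .store 3 6 12 ⨟ .succ 6 ⨟ .store 7 10 1) last

/-- Register 5 holds the successor of a vertex that waits for a sibling, or 0. It waits no longer
if its parent is not the one in register 8. -/
def finalize : Program :=
  .ite (.lt 3 5)
    (.copy 9 5 ⨟ .pred 9 ⨟ .load 10 5 9 ⨟ .ite (.eq 10 8) .skip (close ⨟ .const 5 0)) .skip

/-- Match the vertex in register 7 with the one that waits for a sibling, or let it wait. -/
def consume : Program :=
  .load 11 7 7 ⨟
    .ite (.eq 11 3)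
      (.ite (.lt 3 5)
        (.copy 9 5 ⨟ .pred 9 ⨟ .store 2 6 9 ⨟ .store 3 6 7 ⨟ .succ 6 ⨟ .const 5 0)
        (.copy 5 7 ⨟ .succ 5)) .skip

/-- The next vertex in the reverse order of the search. -/
def advance : Program := .pred 2 ⨟ .load 7 4 2 ⨟ .load 8 5 7

/-- The loop through all vertices that adds the edges. -/
def cover : Program :=
  (.copy 2 0 ⨟ .const 3 0 ⨟ .const 5 0 ⨟ .const 6 0) ⨟
    .while (.lt 3 2) (advance ⨟ finalize ⨟ consume) ⨟ .copy 0 6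

end Programs

/-! ### The last edge of a tree, and invariants of the final loop -/

section CoverLoop

variable {n : ℕ} {G : SimpleGraph (Fin n)} {s : Fin n} {pos : Fin n → ℕ} {p : Fin n → Fin n}
  {off ent : ℕ → ℕ} {M : Memory} {i : ℕ}

/-- The memory `M'` arises from `M` by appending `(a, b)` to the output; apart from that, only
registers from 9 on have changed. -/
structure Emits (M M' : Memory) (a b : ℕ) : Prop where
  arr : M'.arr = Function.update (Function.update M.arr 2 (Function.update (M.arr 2) (M.reg 6) a)) 3
    (Function.update (M.arr 3) (M.reg 6) b)
  count : M'.reg 6 = M.reg 6 + 1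
  reg : ∀ x < 9, x ≠ 6 → M'.reg x = M.reg x

/-- Of two stored children of the parent at most one is `x`. If no other child exists, the first two
entries in the adjacency list of the parent contain a neighbour other than `x`. -/
theorem pick_spec (h : SearchTree G s pos p) (hg : HoldsGraph G off ent)
    (hpos : ∀ v, pos v < n)
    (hs : ∃ x y, G.Adj s x ∧ G.Adj s y ∧ x ≠ y) (hm : TreeMem s pos p off ent M)
    (hch : ∀ u : Fin n, Children G s pos p n (M.arr 8 u) (M.arr 9 u) u) (h3 : M.reg 3 = 0)
    {x : Fin n} (hx : Flagged G s p x) (h9 : M.reg 9 = x) (h10 : M.reg 10 = p x)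
    (h8 : M.arr 8 x = 0) :
    ∃ b : Fin n, LastEdge G s p x x b ∧ (pick.eval M).reg 11 = b ∧ (pick.eval M).arr = M.arr ∧
      ∀ y < 11, (pick.eval M).reg y = M.reg y := by
  have hnochild : ∀ z, Flagged G s p z → p z ≠ x := by
    rcases (hch x).first with ⟨-, h1⟩ | ⟨z, h1, -⟩
    · exact fun z hz ↦ h1 z hz (hpos z)
    · omega
  obtain ⟨z, hz1, hz2, hz3, -⟩ := (hch (p x)).first.resolve_left fun h1 ↦ h1.2 x hx (hpos x) rfl
  have hfr : ∀ {f : ℕ → ℕ} {a b : ℕ}, (∀ y < 11, f y = M.reg y) → 11 ≤ a →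
      ∀ y < 11, Function.update f a b y = M.reg y := fun hf ha y hy ↦ by
    rw [Function.update_of_ne (by omega), hf y hy]
  have hM : ∀ y < 11, M.reg y = M.reg y := fun _ _ ↦ rfl
  by_cases hzx : z = x
  · subst hzx
    rcases (hch (p z)).second with ⟨h1, h2⟩ | ⟨y, h1, h2, h3', h4⟩
    · have honly : ∀ y, Flagged G s p y → p y = p z → y = z := fun y hy hyz ↦ by
        have := h2 y hy (hpos y) hyz
        exact Fin.ext (by omega)
      -- The root of the search was chosen with two neighbours; any other vertex has its own parent
      -- as a second neighbour.
      have hdeg : ∃ w, G.Adj (p z) w ∧ w ≠ z := by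
        by_cases hps : p z = s
        · obtain ⟨a, b, ha, hb, hab⟩ := hs
          by_cases haz : a = z
          · exact ⟨b, hps ▸ hb, fun h ↦ hab (haz.trans h.symm)⟩
          · exact ⟨a, hps ▸ ha, haz⟩
        · refine ⟨p (p z), (h.adj _ hps).symm, fun he ↦ ?_⟩
          have h5 := h.lt _ hps
          have h6 := h.lt _ hx.1
          rw [he] at h5
          omega
      obtain ⟨w, hw, hwz⟩ := hdeg
      obtain ⟨k, hk1, hk2, hk3⟩ := hg.complete _ _ hw
      obtain ⟨l, hl1, hl2, hl3⟩ := hg.complete _ _ hx.2.1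
      have hkl : k ≠ l := by
        rintro rfl
        exact hwz (Fin.ext (hk3.symm.trans hl3))
      obtain ⟨a, ha1, ha2⟩ := hg.sound (p z) (off (p z)) le_rfl (by omega)
      by_cases haz : a = z
      · obtain ⟨b, hb1, hb2⟩ := hg.sound (p z) (off (p z) + 1) (by omega) (by omega)
        have hbz : b ≠ z := by
          rintro rfl
          have := hg.inj (p b) _ _ le_rfl (by omega) (by omega) (by omega)
            (ha2.trans ((congrArg Fin.val haz).trans hb2.symm))
          omega
        refine ⟨b, .pair hnochild honly hb1 hbz, ?_⟩
        subst haz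
        have e : pick.eval M =
            ⟨Function.update (Function.update M.reg 13 (off (p a) + 1)) 11 b, M.arr⟩ := by
          simp only [pick, Program.eval, Test.Holds, Memory.setReg]
          simp [h10, hz1, h9, h1, h3, hm.offsets, hm.entries, ha2, hb2]
          funext y
          simp only [Function.update_apply]
          grind
        rw [e]
        exact ⟨by simp, rfl, hfr (hfr hM (by omega)) (by omega)⟩
      · refine ⟨a, .pair hnochild honly ha1 haz, ?_⟩
        have haz' : (a : ℕ) ≠ z := fun h ↦ haz (Fin.ext h)
        have e : pick.eval M = ⟨Function.update (Function.update M.reg 13 (off (p z))) 11 a,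
            M.arr⟩ := by
          simp only [pick, Program.eval, Test.Holds, Memory.setReg]
          simp [h10, hz1, h9, h1, h3, hm.offsets, hm.entries, ha2, haz']
          funext y
          simp only [Function.update_apply]
          grind
        rw [e]
        exact ⟨by simp, rfl, hfr (hfr hM (by omega)) (by omega)⟩
    · refine ⟨y, .sibling h2 h3' fun h ↦ h4 (by rw [hz1, h]), ?_⟩
      have e : pick.eval M = ⟨Function.update M.reg 11 y, M.arr⟩ := by
        simp only [pick, Program.eval, Test.Holds, Memory.setReg]
        simp [h10, hz1, h9, h1, h3]
      rw [e]
      exact ⟨by simp, rfl, hfr hM (by omega)⟩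
  · refine ⟨z, .sibling hz2 hz3 hzx, ?_⟩
    have hzx' : (z : ℕ) ≠ x := fun h ↦ hzx (Fin.ext h)
    have e : pick.eval M = ⟨Function.update M.reg 11 z, M.arr⟩ := by
      simp only [pick, Program.eval, Test.Holds, Memory.setReg]
      simp [h10, hz1, h9, hzx']
    rw [e]
    exact ⟨by simp, rfl, hfr hM (by omega)⟩

theorem last_spec (h : SearchTree G s pos p) (hg : HoldsGraph G off ent)
    (hpos : ∀ v, pos v < n)
    (hs : ∃ x y, G.Adj s x ∧ G.Adj s y ∧ x ≠ y) (hm : TreeMem s pos p off ent M)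
    (hch : ∀ u : Fin n, Children G s pos p n (M.arr 8 u) (M.arr 9 u) u) (h3 : M.reg 3 = 0)
    {x : Fin n} (hx : Flagged G s p x) (h9 : M.reg 9 = x) (h10 : M.reg 10 = p x) :
    ∃ a b : Fin n, LastEdge G s p x a b ∧ Emits M (last.eval M) a b := by
  rcases (hch x).first with ⟨h8, -⟩ | ⟨z, hz1, hz2, hz3, -⟩
  · obtain ⟨b, hb, h11, harr, hreg⟩ := pick_spec (M := M.setReg 11 0) h hg hpos hs
      ⟨hm.offsets, hm.entries, hm.order, hm.parent, hm.parent_root,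
        by simpa [Memory.setReg] using hm.reg_zero, by simpa [Memory.setReg] using hm.reg_one⟩
      hch (by simpa [Memory.setReg] using h3) hx (by simpa [Memory.setReg] using h9)
      (by simpa [Memory.setReg] using h10) h8
    have hreg' : ∀ y < 11, (pick.eval (M.setReg 11 0)).reg y = M.reg y := fun y hy ↦ by
      rw [hreg y hy]
      simp [Memory.setReg, Function.update_of_ne (show y ≠ 11 by omega)]
    refine ⟨x, b, hb, ?_⟩
    obtain ⟨N, hN⟩ : ∃ N, N = pick.eval (M.setReg 11 0) := ⟨_, rfl⟩
    rw [← hN] at h11 harr hreg'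
    have harr' : N.arr = M.arr := harr
    have e : last.eval M = ⟨Function.update N.reg 6 (M.reg 6 + 1), Function.update (Function.update
        M.arr 2 (Function.update (M.arr 2) (M.reg 6) x)) 3
        (Function.update (M.arr 3) (M.reg 6) b)⟩ := by
      have hset : M.setReg 11 (M.arr 8 (M.reg 9)) = M.setReg 11 0 := by rw [h9, h8]
      have hlt : ¬ Test.Holds (M.setReg 11 0) (.lt 3 11) := by
        simp [Test.Holds, Memory.setReg, h3]
      simp only [last, Program.eval, hset, hlt, if_false, ← hN]
      simp [Memory.setReg, Memory.setArr, hreg', harr', h11, h9]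
    rw [e]
    refine ⟨rfl, by simp, fun y hy hy6 ↦ ?_⟩
    rw [← hreg' y (by omega)]
    exact Function.update_of_ne hy6 _ _
  · refine ⟨p x, z, .child hz2 hz3, ?_⟩
    have e : last.eval M = ⟨Function.update (Function.update M.reg 11 z) 6 (M.reg 6 + 1),
        Function.update (Function.update
        M.arr 2 (Function.update (M.arr 2) (M.reg 6) (p x))) 3
        (Function.update (M.arr 3) (M.reg 6) z)⟩ := by
      simp only [last, Program.eval, Test.Holds, Memory.setReg, Memory.setArr]
      simp [h9, hz1, h3, h10]
    rw [e]
    refine ⟨rfl, by simp, fun y hy hy6 ↦ ?_⟩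
    exact (Function.update_of_ne hy6 _ _).trans (Function.update_of_ne (by omega) _ _)

/-- The part of the memory in the last loop that describes the input, the tree and the output. -/
structure CoverMem (G : SimpleGraph (Fin n)) (s : Fin n) (pos : Fin n → ℕ) (p : Fin n → Fin n)
    (off ent : ℕ → ℕ) (L : List (Fin n × Fin n)) (M : Memory) : Prop where
  mem : TreeMem s pos p off ent M
  children : ∀ u : Fin n, Children G s pos p n (M.arr 8 u) (M.arr 9 u) u
  zero : M.reg 3 = 0
  count : M.reg 6 = L.length
  output : ∀ (j : ℕ) (h : j < L.length), M.arr 2 j = (L[j].1 : ℕ) ∧ M.arr 3 j = (L[j].2 : ℕ)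

variable {L : List (Fin n × Fin n)} {M' : Memory}

theorem CoverMem.congr (h : CoverMem G s pos p off ent L M) (harr : ∀ a ≠ 7, M'.arr a = M.arr a)
    (hreg : ∀ y ∈ [0, 1, 3, 6], M'.reg y = M.reg y) : CoverMem G s pos p off ent L M' := by
  simp only [List.mem_cons, List.not_mem_nil, or_false, forall_eq_or_imp, forall_eq] at hreg
  obtain ⟨h0, h1, h3, h6⟩ := hreg
  refine ⟨⟨?_, ?_, ?_, ?_, ?_, ?_, ?_⟩, ?_, ?_, ?_, ?_⟩
  · rw [harr 0 (by omega)]; exact h.mem.offsets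
  · rw [harr 1 (by omega)]; exact h.mem.entries
  · rw [harr 4 (by omega)]; exact h.mem.order
  · rw [harr 5 (by omega)]; exact h.mem.parent
  · rw [harr 5 (by omega)]; exact h.mem.parent_root
  · rw [h0]; exact h.mem.reg_zero
  · rw [h1]; exact h.mem.reg_one
  · rw [harr 8 (by omega), harr 9 (by omega)]; exact h.children
  · rw [h3]; exact h.zero
  · rw [h6]; exact h.count
  · rw [harr 2 (by omega), harr 3 (by omega)]; exact h.output

theorem CoverMem.emit (h : CoverMem G s pos p off ent L M) {a b : Fin n} (he : Emits M M' a b) :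
    CoverMem G s pos p off ent (L ++ [(a, b)]) M' := by
  have harr : ∀ x, x ≠ 2 → x ≠ 3 → M'.arr x = M.arr x := fun x h2 h3 ↦ by
    rw [he.arr, Function.update_of_ne h3, Function.update_of_ne h2]
  refine ⟨⟨?_, ?_, ?_, ?_, ?_, ?_, ?_⟩, ?_, ?_, ?_, ?_⟩
  · rw [harr 0 (by omega) (by omega)]; exact h.mem.offsets
  · rw [harr 1 (by omega) (by omega)]; exact h.mem.entries
  · rw [harr 4 (by omega) (by omega)]; exact h.mem.order
  · rw [harr 5 (by omega) (by omega)]; exact h.mem.parent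
  · rw [harr 5 (by omega) (by omega)]; exact h.mem.parent_root
  · rw [he.reg 0 (by omega) (by omega)]; exact h.mem.reg_zero
  · rw [he.reg 1 (by omega) (by omega)]; exact h.mem.reg_one
  · rw [harr 8 (by omega) (by omega), harr 9 (by omega) (by omega)]; exact h.children
  · rw [he.reg 3 (by omega) (by omega)]; exact h.zero
  · rw [he.count, h.count]; simp
  · intro j hj
    rw [he.arr, h.count]
    by_cases hjL : j < L.length
    · simpa [hjL.ne, List.getElem_append_left hjL] using h.output j hjL
    · have : j = L.length := by
        rw [List.length_append, List.length_singleton] at hj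
        omega
      subst this
      simp

/-- The invariant of the last loop, apart from the waiting vertex. The vertices at positions from
`i` on have been processed, and `R` contains the vertices with a remaining edge to their parent. -/
structure CoverCore (G : SimpleGraph (Fin n)) (s : Fin n) (pos : Fin n → ℕ) (p : Fin n → Fin n)
    (D : Fin n → ℕ) (off ent : ℕ → ℕ) (i : ℕ) (R : Set (Fin n)) (L : List (Fin n × Fin n))
    (M : Memory) : Prop where
  mem : CoverMem G s pos p off ent L M
  progress : Progress G s p D R L
  flag : ∀ v : Fin n, pos v < i → (M.arr 7 v = 0 ↔ v ∈ R)
  taken : ∀ u, Flagged G s p u → u ∉ R → pos u < i → ∀ y ∈ R, p y ≠ u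

/-- The vertex `x` waits for a sibling, and the other vertices in `R` are at positions below
`i`. -/
structure Waiting (pos : Fin n → ℕ) (p : Fin n → Fin n) (i : ℕ) (R : Set (Fin n)) (x : Fin n) :
    Prop where
  mem : x ∈ R
  le : i ≤ pos x
  parent_lt : pos (p x) < i
  lt : ∀ y ∈ R, y ≠ x → pos y < i

/-- Register 5 tells whether a vertex waits for a sibling. -/
def Pending (pos : Fin n → ℕ) (p : Fin n → Fin n) (i : ℕ) (R : Set (Fin n)) (M : Memory) : Prop :=
  M.reg 5 = 0 ∧ (∀ y ∈ R, pos y < i) ∨ ∃ x : Fin n, M.reg 5 = x + 1 ∧ Waiting pos p i R x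

/-- What the last loop needs to know about the search tree and the adjacency lists. -/
structure CoverSetup (G : SimpleGraph (Fin n)) (s : Fin n) (pos : Fin n → ℕ) (p : Fin n → Fin n)
    (D : Fin n → ℕ) (off ent : ℕ → ℕ) : Prop where
  tree : SearchTree G s pos p
  graph : HoldsGraph G off ent
  pos_lt : ∀ v, pos v < n
  surj : ∀ i < n, ∃ v, pos v = i
  root : ∃ x y, G.Adj s x ∧ G.Adj s y ∧ x ≠ y
  depth : ∀ v, v ≠ s → D v = D (p v) + 1
  depth_mono : ∀ v w, pos v ≤ pos w → D v ≤ D w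

end CoverLoop

/-! ### The pass in reverse search order -/

section CoverLoop

variable {n : ℕ} {G : SimpleGraph (Fin n)} {s : Fin n} {pos : Fin n → ℕ} {p : Fin n → Fin n}
  {D : Fin n → ℕ} {off ent : ℕ → ℕ} {M M' : Memory} {i : ℕ} {R : Set (Fin n)}
  {L : List (Fin n × Fin n)} {x v : Fin n}

theorem CoverCore.congr (h : CoverCore G s pos p D off ent i R L M) (harr : M'.arr = M.arr)
    (hreg : ∀ y ∈ [0, 1, 3, 6], M'.reg y = M.reg y) : CoverCore G s pos p D off ent i R L M' :=
  ⟨h.mem.congr (fun a _ ↦ by rw [harr]) hreg, h.progress, by rw [harr]; exact h.flag, h.taken⟩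

theorem Waiting.depth_le (hS : CoverSetup G s pos p D off ent) (hw : Waiting pos p i R x) :
    ∀ z ∈ R, D z ≤ D x := fun z hz ↦ by
  by_cases hzx : z = x
  · rw [hzx]
  · exact hS.depth_mono _ _ ((hw.lt z hz hzx).le.trans hw.le)

/-- If the edge above `p x` remains, it is extracted together with that of `x`. Otherwise there is
no bridge above `p x`: by `taken`, a flagged vertex that has lost its edge has no remaining child,
but `x` remains. Then `x` carries the last edge of its tree. -/
theorem close_spec (hS : CoverSetup G s pos p D off ent)
    (h : CoverCore G s pos p D off ent i R L M) (hw : Waiting pos p i R x)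
    (honly : ∀ z ∈ R, p z = p x → z = x) (h9 : M.reg 9 = x) (h10 : M.reg 10 = p x) :
    ∃ R' L', CoverCore G s pos p D off ent i R' L' (close.eval M) ∧ (∀ y ∈ R', pos y < i) ∧
      ∀ y < 9, y ≠ 6 → (close.eval M).reg y = M.reg y := by
  have hfx := h.progress.flagged x hw.mem
  have hm := h.mem.mem
  by_cases hpx : p x ∈ R
  · have h7 : M.arr 7 (p x) = 0 := (h.flag _ hw.parent_lt).2 hpx
    have hps : p x ≠ s := (h.progress.flagged _ hpx).1
    have hne : (p x) ≠ p (p x) := fun he ↦ by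
      have := hS.tree.lt _ hps
      rw [← he] at this
      omega
    obtain ⟨N, hN⟩ : ∃ N : Memory, N =
      ⟨Function.update (Function.update (Function.update M.reg 11 0) 12 (p (p x))) 6 (M.reg 6 + 1),
        Function.update (Function.update M.arr 2 (Function.update (M.arr 2) (M.reg 6) x)) 3
        (Function.update (M.arr 3) (M.reg 6) (p (p x)))⟩ := ⟨_, rfl⟩
    have he : Emits M N x (p (p x)) := by
      rw [hN]
      refine ⟨rfl, by simp, fun y hy hy6 ↦ ?_⟩
      exact ((Function.update_of_ne hy6 _ _).trans (Function.update_of_ne (by omega) _ _)).trans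
        (Function.update_of_ne (by omega) _ _)
    have e : close.eval M = N.setArr 7 (p x) 1 := by
      rw [hN]
      simp only [close, Program.eval, Test.Holds, Memory.setReg, Memory.setArr]
      simp [h10, h7, h.mem.zero, h9, hm.parent _ hps, hm.reg_one]
    rw [e]
    refine ⟨R \ {x, p x}, L ++ [(x, p (p x))], ⟨?_, ?_, ?_, ?_⟩, ?_, ?_⟩
    · refine (h.mem.emit he).congr (fun a ha ↦ ?_) (fun _ _ ↦ rfl)
      exact Function.update_of_ne ha _ _
    · exact h.progress.path hS.tree hS.depth hw.mem hpx honly (hw.depth_le hS)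
    · intro v hv
      have hvx : v ≠ x := by
        rintro rfl
        exact absurd hw.le (by omega)
      have h7N : N.arr 7 = M.arr 7 := by simp [hN]
      by_cases hvp : v = p x
      · subst hvp
        simp [Memory.setArr]
      · have hvp' : (v : ℕ) ≠ p x := fun h ↦ hvp (Fin.ext h)
        simpa [Memory.setArr, hvp', hvp, hvx, h7N] using h.flag v hv
    · intro u hu huR hui y hy
      -- Now `p x` has lost its edge too, and `x` was its only remaining child.
      by_cases hup : u = p x
      · intro hyu
        exact hy.2 (.inl (honly y hy.1 (hyu.trans hup)))
      · refine h.taken u hu (fun h' ↦ huR ⟨h', ?_⟩) hui y hy.1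
        rintro (rfl | h')
        · exact absurd hw.le (by omega)
        · exact hup h'
    · exact fun y hy ↦ hw.lt y hy.1 fun h ↦ hy.2 (.inl h)
    · exact he.reg
  · have h7 : M.arr 7 (p x) ≠ 0 := fun h' ↦ hpx ((h.flag _ hw.parent_lt).1 h')
    have hnf : ¬ Flagged G s p (p x) := fun hf ↦ h.taken _ hf hpx hw.parent_lt x hw.mem rfl
    obtain ⟨N, hN⟩ : ∃ N : Memory, N = M.setReg 11 (M.arr 7 (p x)) := ⟨_, rfl⟩
    have hNreg : ∀ y < 11, N.reg y = M.reg y := fun y hy ↦ by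
      rw [hN]
      exact Function.update_of_ne (by omega) _ _
    have hNarr : N.arr = M.arr := by rw [hN]; rfl
    have hNc : CoverMem G s pos p off ent L N := h.mem.congr (fun _ _ ↦ by rw [hNarr])
      (fun y hy ↦ hNreg y (by simp only [List.mem_cons, List.not_mem_nil, or_false] at hy; omega))
    have e : close.eval M = last.eval N := by
      have h11 : ¬ Test.Holds N (.eq 11 3) := by
        simp [Test.Holds, hN, Memory.setReg, h.mem.zero, h7]
      simp only [close, Program.eval, h10, ← hN, h11, if_false]
    obtain ⟨a, b, hab, he⟩ := last_spec hS.tree hS.graph hS.pos_lt hS.root hNc.mem hNc.children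
      hNc.zero hfx ((hNreg 9 (by omega)).trans h9) ((hNreg 10 (by omega)).trans h10)
    rw [e]
    refine ⟨R \ {x}, L ++ [(a, b)], ⟨hNc.emit he, ?_, ?_, ?_⟩, ?_, ?_⟩
    · exact h.progress.last hS.tree hS.depth hw.mem hnf honly (hw.depth_le hS) hab
    · intro v hv
      have hvx : v ≠ x := by
        rintro rfl
        exact absurd hw.le (by omega)
      have h7 : (last.eval N).arr 7 = M.arr 7 := by
        rw [he.arr, Function.update_of_ne (by omega), Function.update_of_ne (by omega), hNarr]
      simpa [h7, hvx] using h.flag v hv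
    · intro u hu huR hui y hy
      refine h.taken u hu (fun h' ↦ huR ⟨h', ?_⟩) hui y hy.1
      rintro rfl
      exact absurd hw.le (by omega)
    · exact fun y hy ↦ hw.lt y hy.1 hy.2
    · intro y hy hy6
      rw [he.reg y hy hy6, hNreg y (by omega)]

/-- Siblings are consecutive in the search order. So once a vertex `v` with another parent is
reached, the waiting vertex has no remaining sibling and can be closed. -/
theorem finalize_spec (hS : CoverSetup G s pos p D off ent)
    (h : CoverCore G s pos p D off ent i R L M) (hp : Pending pos p i R M) (hv : pos v + 1 = i)
    (h8 : M.reg 8 = M.arr 5 v) :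
    ∃ R' L', CoverCore G s pos p D off ent i R' L' (finalize.eval M) ∧
      ((finalize.eval M).reg 5 = 0 ∧ (∀ y ∈ R', pos y < i) ∨
        ∃ x : Fin n, (finalize.eval M).reg 5 = x + 1 ∧ Waiting pos p i R' x ∧ v ≠ s ∧ p v = p x) ∧
      (finalize.eval M).reg 2 = M.reg 2 ∧ (finalize.eval M).reg 7 = M.reg 7 := by
  rcases hp with ⟨h5, hlt⟩ | ⟨x, h5, hw⟩
  · have e : finalize.eval M = M := by
      simp [finalize, Program.eval, Test.Holds, h.mem.zero, h5]
    rw [e]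
    exact ⟨R, L, h, .inl ⟨h5, hlt⟩, rfl, rfl⟩
  · have hxs := (h.progress.flagged x hw.mem).1
    obtain ⟨N, hN⟩ : ∃ N : Memory, N = (M.setReg 9 x).setReg 10 (p x) := ⟨_, rfl⟩
    have hNreg : ∀ y < 9, N.reg y = M.reg y := fun y hy ↦ by
      rw [hN]
      exact (Function.update_of_ne (by omega) _ _).trans (Function.update_of_ne (by omega) _ _)
    have hNarr : N.arr = M.arr := by rw [hN]; rfl
    have hN9 : N.reg 9 = x := by simp [hN, Memory.setReg]
    have hN10 : N.reg 10 = p x := by simp [hN, Memory.setReg]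
    have hNc : CoverCore G s pos p D off ent i R L N := h.congr hNarr fun y hy ↦ hNreg y (by
      simp only [List.mem_cons, List.not_mem_nil, or_false] at hy; omega)
    have e : finalize.eval M =
        if (p x : ℕ) = M.arr 5 v then N else (close.eval N).setReg 5 0 := by
      have hM : Test.Holds M (.lt 3 5) := by simp [Test.Holds, h.mem.zero, h5]
      have hN' : ((M.setReg 9 (M.reg 5)).setReg 9 ((M.setReg 9 (M.reg 5)).reg 9 - 1)).setReg 10
          (((M.setReg 9 (M.reg 5)).setReg 9 ((M.setReg 9 (M.reg 5)).reg 9 - 1)).arr 5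
          (((M.setReg 9 (M.reg 5)).setReg 9 ((M.setReg 9 (M.reg 5)).reg 9 - 1)).reg 9)) = N := by
        rw [hN]
        simp [Memory.setReg, h5, h.mem.mem.parent x hxs]
      simp only [finalize, Program.eval, hM, if_true, hN']
      simp only [Test.Holds, hN', hN10, hNreg 8 (by omega), h8]
    by_cases hpv : (p x : ℕ) = M.arr 5 v
    · rw [e, if_pos hpv]
      have hvs : v ≠ s := by
        rintro rfl
        rw [h.mem.mem.parent_root] at hpv
        omega
      rw [h.mem.mem.parent v hvs] at hpv
      exact ⟨R, L, hNc, .inr ⟨x, by rw [hNreg 5 (by omega), h5], hw, hvs, (Fin.ext hpv).symm⟩,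
        hNreg 2 (by omega), hNreg 7 (by omega)⟩
    · rw [e, if_neg hpv]
      have honly : ∀ z ∈ R, p z = p x → z = x := by
        intro z hz hzx
        by_contra hne
        have hzi := hw.lt z hz hne
        have hzs := (h.progress.flagged z hz).1
        have hvs : v ≠ s := by
          rintro rfl
          have := hS.tree.root
          have := hS.tree.lt z hzs
          omega
        -- A sibling `z` still to come would have `v` between itself and `x`, so the parent of `v`
        -- would be squeezed to that of `x`.
        have h1 := hS.tree.mono z v hzs hvs (by omega)
        have h2 := hS.tree.mono v x hvs hxs (by have := hw.le; omega)
        rw [hzx] at h1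
        rw [h.mem.mem.parent v hvs] at hpv
        exact hpv (congrArg Fin.val (hS.tree.inj (le_antisymm h1 h2)))
      obtain ⟨R', L', h1, h2, h3⟩ := close_spec hS hNc hw honly hN9 hN10
      have hset : ∀ y ≠ 5, ((close.eval N).setReg 5 0).reg y = (close.eval N).reg y :=
        fun y hy ↦ Function.update_of_ne hy _ _
      refine ⟨R', L', h1.congr rfl fun y hy ↦ hset y ?_, .inl ⟨?_, h2⟩, ?_, ?_⟩
      · simp only [List.mem_cons, List.not_mem_nil, or_false] at hy
        omega
      · simp [Memory.setReg]
      · rw [hset 2 (by omega), h3 2 (by omega) (by omega), hNreg 2 (by omega)]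
      · rw [hset 7 (by omega), h3 7 (by omega) (by omega), hNreg 7 (by omega)]

/-- A vertex that still waits after `finalize` is a sibling of `v`, so they are paired if the edge
above `v` remains. With nobody waiting, such a `v` starts to wait itself. -/
theorem consume_spec (hS : CoverSetup G s pos p D off ent)
    (h : CoverCore G s pos p D off ent i R L M) (hv : pos v + 1 = i) (h7 : M.reg 7 = v)
    (hp : M.reg 5 = 0 ∧ (∀ y ∈ R, pos y < i) ∨
        ∃ x : Fin n, M.reg 5 = x + 1 ∧ Waiting pos p i R x ∧ v ≠ s ∧ p v = p x) :
    ∃ R' L', CoverCore G s pos p D off ent (pos v) R' L' (consume.eval M) ∧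
      Pending pos p (pos v) R' (consume.eval M) ∧ (consume.eval M).reg 2 = M.reg 2 := by
  have hlt : ∀ y, pos y < i → y ≠ v → pos y < pos v := fun y hy hne ↦ by
    have : pos y ≠ pos v := fun he ↦ hne (hS.tree.inj he)
    omega
  have hcore : ∀ {N : Memory}, N.arr = M.arr → (∀ y ∈ [0, 1, 3, 6], N.reg y = M.reg y) →
      CoverCore G s pos p D off ent (pos v) R L N := fun harr hreg ↦ by
    have h' := h.congr harr hreg
    exact ⟨h'.mem, h'.progress, fun w hw ↦ h'.flag w (by omega),
      fun u hu huR hui ↦ h'.taken u hu huR (by omega)⟩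
  obtain ⟨N, hN⟩ : ∃ N : Memory, N = M.setReg 11 (M.arr 7 v) := ⟨_, rfl⟩
  have hNreg : ∀ y ≠ 11, N.reg y = M.reg y := fun y hy ↦ by
    rw [hN]
    exact Function.update_of_ne hy _ _
  have hNarr : N.arr = M.arr := by rw [hN]; rfl
  by_cases hvR : v ∈ R
  · have hf : M.arr 7 v = 0 := (h.flag v (by omega)).2 hvR
    have hvf := h.progress.flagged v hvR
    have hvlt := hS.tree.lt v hvf.1
    rcases hp with ⟨h5, hR⟩ | ⟨x, h5, hw, hvs, hpx⟩
    · have e : consume.eval M = N.setReg 5 (v + 1) := by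
        rw [hN]
        simp only [consume, Program.eval, Test.Holds, Memory.setReg]
        simp [h7, hf, h.mem.zero, h5]
      have hset : ∀ y ≠ 5, (N.setReg 5 (v + 1)).reg y = N.reg y :=
        fun y hy ↦ Function.update_of_ne hy _ _
      rw [e]
      refine ⟨R, L, hcore hNarr fun y hy ↦ ?_, .inr ⟨v, by simp [Memory.setReg], hvR, le_rfl, hvlt,
        fun y hy ↦ hlt y (hR y hy)⟩, ?_⟩
      · simp only [List.mem_cons, List.not_mem_nil, or_false] at hy
        rw [hset y (by omega), hNreg y (by omega)]
      · rw [hset 2 (by omega), hNreg 2 (by omega)]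
    · have hvx : v ≠ x := by
        rintro rfl
        exact absurd hw.le (by omega)
      obtain ⟨K, hK⟩ : ∃ K : Memory, K =
        ⟨Function.update (Function.update (Function.update M.reg 11 0) 9 x) 6 (M.reg 6 + 1),
          Function.update (Function.update M.arr 2 (Function.update (M.arr 2) (M.reg 6) x)) 3
          (Function.update (M.arr 3) (M.reg 6) v)⟩ := ⟨_, rfl⟩
      have he : Emits M K x v := by
        rw [hK]
        refine ⟨rfl, by simp, fun y hy hy6 ↦ ?_⟩
        exact ((Function.update_of_ne hy6 _ _).trans (Function.update_of_ne (by omega) _ _)).trans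
          (Function.update_of_ne (by omega) _ _)
      have e : consume.eval M = K.setReg 5 0 := by
        rw [hK]
        simp only [consume, Program.eval, Test.Holds, Memory.setReg, Memory.setArr]
        simp [h7, hf, h.mem.zero, h5]
      have hset : ∀ y ≠ 5, (K.setReg 5 0).reg y = K.reg y :=
        fun y hy ↦ Function.update_of_ne hy _ _
      rw [e]
      refine ⟨R \ {x, v}, L ++ [(x, v)], ⟨?_, ?_, ?_, ?_⟩, .inl ⟨by simp [Memory.setReg], ?_⟩, ?_⟩
      · refine (h.mem.emit he).congr (fun _ _ ↦ rfl) fun y hy ↦ hset y ?_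
        simp only [List.mem_cons, List.not_mem_nil, or_false] at hy
        omega
      · exact h.progress.sibling hS.tree hS.depth hw.mem hvR hvx hpx (hw.depth_le hS)
      · intro w hwv
        have hwx : w ≠ x := by
          rintro rfl
          exact absurd hw.le (by omega)
        have hwv' : w ≠ v := by
          rintro rfl
          omega
        have h7 : (K.setReg 5 0).arr 7 = M.arr 7 := by simp [hK, Memory.setReg]
        simpa [h7, hwx, hwv'] using h.flag w (by omega)
      · intro u hu huR hui y hy
        refine h.taken u hu (fun h' ↦ huR ⟨h', ?_⟩) (by omega) y hy.1
        rintro (rfl | rfl)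
        · exact absurd hw.le (by omega)
        · omega
      · exact fun y hy ↦ hlt y (hw.lt y hy.1 fun h ↦ hy.2 (.inl h)) fun h ↦ hy.2 (.inr h)
      · rw [hset 2 (by omega), he.reg 2 (by omega) (by omega)]
  · have hf : M.arr 7 v ≠ 0 := fun h' ↦ hvR ((h.flag v (by omega)).1 h')
    have e : consume.eval M = N := by
      rw [hN]
      simp [consume, Program.eval, Test.Holds, Memory.setReg, h7, hf, h.mem.zero]
    rw [e]
    have hne : ∀ y ∈ R, y ≠ v := fun y hy he ↦ hvR (he ▸ hy)
    refine ⟨R, L, hcore hNarr fun y hy ↦ hNreg y ?_, ?_, hNreg 2 (by omega)⟩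
    · simp only [List.mem_cons, List.not_mem_nil, or_false] at hy
      omega
    · rcases hp with ⟨h5, hR⟩ | ⟨x, h5, hw, hvs, hpx⟩
      · exact .inl ⟨by rw [hNreg 5 (by omega), h5], fun y hy ↦ hlt y (hR y hy) (hne y hy)⟩
      -- `v` has no remaining edge and `x` goes on waiting; their common parent still precedes `v`.
      · refine .inr ⟨x, by rw [hNreg 5 (by omega), h5], hw.mem, ?_, hpx ▸ hS.tree.lt v hvs,
          fun y hy hyx ↦ hlt y (hw.lt y hy hyx) (hne y hy)⟩
        have := hw.le
        omega

/-- The invariant of the last loop. -/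
def CoverInv (G : SimpleGraph (Fin n)) (s : Fin n) (pos : Fin n → ℕ) (p : Fin n → Fin n)
    (D : Fin n → ℕ) (off ent : ℕ → ℕ) (i : ℕ) (M : Memory) : Prop :=
  ∃ R L, CoverCore G s pos p D off ent i R L M ∧ Pending pos p i R M ∧ M.reg 2 = i ∧ i ≤ n

theorem CoverInv.step (hS : CoverSetup G s pos p D off ent)
    (h : CoverInv G s pos p D off ent (i + 1) M) :
    CoverInv G s pos p D off ent i ((advance ⨟ finalize ⨟ consume).eval M) := by
  obtain ⟨R, L, hC, hp, h2, hi⟩ := h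
  obtain ⟨v, rfl⟩ := hS.surj i hi
  obtain ⟨N, hN⟩ : ∃ N, N = advance.eval M := ⟨_, rfl⟩
  have e : N = ⟨Function.update (Function.update (Function.update M.reg 2 (pos v)) 7 v) 8
      (M.arr 5 v), M.arr⟩ := by
    rw [hN]
    simp only [advance, Program.eval, Memory.setReg]
    simp [h2, hC.mem.mem.order]
  have hNc : CoverCore G s pos p D off ent (pos v + 1) R L N := by
    rw [e]
    refine hC.congr rfl fun y hy ↦ ?_
    simp only [List.mem_cons, List.not_mem_nil, or_false] at hy
    exact ((Function.update_of_ne (by omega) _ _).trans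
      (Function.update_of_ne (by omega) _ _)).trans (Function.update_of_ne (by omega) _ _)
  have hNp : Pending pos p (pos v + 1) R N := by
    rw [e]
    simpa [Pending] using hp
  obtain ⟨R₁, L₁, h3, h4, h5, h6⟩ := finalize_spec hS hNc hNp rfl (by simp [e])
  obtain ⟨R₂, L₂, h7, h8, h9⟩ := consume_spec hS h3 rfl (h6.trans (by simp [e])) h4
  have hev : (advance ⨟ finalize ⨟ consume).eval M = consume.eval (finalize.eval N) := by
    rw [hN]; rfl
  rw [hev]
  exact ⟨R₂, L₂, h7, h8, by rw [h9, h5, e]; simp, by omega⟩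

theorem cover_spec (hS : CoverSetup G s pos p D off ent) (h : ChildInv G s pos p off ent n M) :
    ∃ t M' L, Exec cover M t M' ∧
      t ≤ 4 + ((advance ⨟ finalize ⨟ consume).size + 1) * n + 2 ∧
      Progress G s p D ∅ L ∧ M'.reg 0 = L.length ∧
      ∀ (j : ℕ) (h : j < L.length), M'.arr 2 j = (L[j].1 : ℕ) ∧ M'.arr 3 j = (L[j].2 : ℕ) := by
  obtain ⟨t, ht, h1⟩ := Program.LoopFree.exec (P := .copy 2 0 ⨟ .const 3 0 ⨟ .const 5 0 ⨟ .const 6 0)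
    (by simp [Program.LoopFree]) M
  have h0 : CoverInv G s pos p D off ent n
      ((Program.copy 2 0 ⨟ .const 3 0 ⨟ .const 5 0 ⨟ .const 6 0).eval M) := by
    simp only [Program.eval, Memory.setReg]
    refine ⟨{v | Flagged G s p v}, [], ⟨⟨⟨h.mem.offsets, h.mem.entries, h.mem.order, h.mem.parent,
      h.mem.parent_root, ?_, ?_⟩, h.children, ?_, ?_, ?_⟩, ?_, ?_, ?_⟩, .inl ⟨?_, ?_⟩, ?_, le_rfl⟩
    · simpa using h.mem.reg_zero
    · simpa using h.mem.reg_one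
    · simp
    · simp
    · simp
    · exact hS.tree.progress_initial hS.depth
    · exact fun v _ ↦ h.flag v
    · exact fun u hu hu' ↦ absurd hu hu'
    · simp
    · exact fun y _ ↦ hS.pos_lt y
    · simpa using h.mem.reg_zero
  obtain ⟨t', l, M', h2, hI, h4, h5⟩ :=
    exec_while (P := advance ⨟ finalize ⨟ consume) (b := .lt 3 2)
      (by simp [advance, finalize, close, last, pick, consume, Program.LoopFree])
      (I := fun k M ↦ CoverInv G s pos p D off ent k M)
      (fun k M hk hb ↦ by
        obtain ⟨R, L, hC, -, h2, -⟩ := id hk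
        simp only [Test.Holds, hC.mem.zero, h2] at hb
        obtain ⟨i, rfl⟩ : ∃ i, k = i + 1 := ⟨k - 1, by omega⟩
        exact ⟨i, by omega, hk.step hS⟩)
      h0
  obtain ⟨R, L, hC, hp, h6, -⟩ := hI
  have hl : l = 0 := by
    simp only [Test.Holds, hC.mem.zero, h6] at h4
    omega
  subst hl
  -- At the end no vertex waits, since its parent would have to lie before position 0.
  have hR : R = ∅ := by
    rcases hp with ⟨-, hR⟩ | ⟨x, -, hw⟩
    · exact Set.eq_empty_of_forall_notMem fun y hy ↦ absurd (hR y hy) (by omega)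
    · exact absurd hw.parent_lt (by omega)
  subst hR
  refine ⟨t + (t' + 1), M'.setReg 0 (M'.reg 6), L, .seq h1 (.seq h2 .copy), ?_, hC.progress, ?_,
    hC.mem.output⟩
  · simp only [Program.size] at ht
    omega
  · simpa [Memory.setReg] using hC.mem.count

end CoverLoop

/-! ### The complete program and its running time -/

/-- A linear time program for the algorithm. -/
def algorithm : Program := search ⨟ findChildren ⨟ cover

/-- The factor in the bound on the running time of the program `algorithm`. -/
def timeFactor : ℕ :=
  searchInit.size + (searchBody.size + 1) * 2 + (childBody.size + 1) +
    ((advance ⨟ finalize ⨟ consume).size + 1) + 10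

theorem algorithm_spec {n : ℕ} {G : SimpleGraph (Fin n)} (hn : 3 ≤ n) (hG : G.Connected)
    (hc : IsChordal G) (A : AdjLists G) :
    ∃ (t : ℕ) (M : Memory) (S : Set (Sym2 (Fin n))), Exec algorithm A.initial t M ∧
      t ≤ timeFactor * (n + G.edgeSet.ncard) ∧ M.Outputs S ∧ IsAlgorithmOutput G S := by
  obtain ⟨s, q, π, t, M, hs, h1, ht, H, hm⟩ := search_spec hG hn A
  obtain ⟨pos, p, hT, hpos, hq, hp, hclean⟩ := H.exists_searchTree hG hc
  obtain ⟨D, hD, hDmono⟩ := hT.exists_depth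
  have hpos0 : ∀ v, v ≠ s → 1 ≤ pos v := fun v hv ↦ by
    have := hT.lt v hv
    omega
  have hmem : TreeMem s pos p (A.initial.arr 0) (A.initial.arr 1) M := by
    refine ⟨hm.offsets, hm.entries, fun v ↦ ?_, fun v hv ↦ ?_, hm.parent_root, hm.reg_zero,
      hm.reg_one⟩
    · rw [hm.queue _ (hpos v).1, (hpos v).2]
    · have := hp _ (hpos0 v hv) (hpos v).1
      have h5 := hm.parent _ (hpos0 v hv) (hpos v).1
      rwa [← this, (hpos v).2] at h5
  have hflag : ∀ v : Fin n, M.arr 7 v = 0 ↔ Flagged G s p v := fun v ↦ by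
    have h7 := (hm.flag _ (hpos v).1).trans (hclean _ (hpos v).1)
    rwa [(hpos v).2] at h7
  have hsurj : ∀ i < n, ∃ v, pos v = i := fun i hi ↦ ⟨q i, hq i hi⟩
  obtain ⟨t₁, M₁, h2, ht₁, hch⟩ := findChildren_spec hmem hflag hm.zero hT.inj hsurj
  have hS : CoverSetup G s pos p D (A.initial.arr 0) (A.initial.arr 1) :=
    ⟨hT, A.holdsGraph, fun v ↦ (hpos v).1, hsurj, hs, hD, hDmono⟩
  obtain ⟨t₂, M₂, L, h3, ht₂, hP, hlen, hout⟩ := cover_spec hS hch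
  refine ⟨t + (t₁ + t₂), M₂, _, .seq h1 (.seq h2 h3), ?_, ⟨L, hlen, hout, hP.nodup, fun e ↦ Iff.rfl⟩,
    hP.isAlgorithmOutput⟩
  -- The adjacency lists have total length `2 m`; the additive constants are absorbed with `n ≥ 3`.
  rw [A.holdsGraph.total] at ht
  unfold timeFactor
  generalize searchInit.size = a at *
  generalize searchBody.size + 1 = b at *
  generalize childBody.size + 1 = c at *
  generalize (advance ⨟ finalize ⨟ consume).size + 1 = d at *
  generalize G.edgeSet.ncard = m at *
  nlinarith [Nat.zero_le (a * m), Nat.zero_le (b * n), Nat.zero_le (c * m), Nat.zero_le (d * m),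
    Nat.mul_le_mul_left a hn]

end CliqueCover

theorem mainTheorem5 :
    -- every output of the algorithm is optimal, and is of the claimed form on each tree
    (∀ (n : ℕ) (G : SimpleGraph (Fin n)), 3 ≤ n → G.Connected → CliqueCover.IsChordal G →
      ∀ S : Set (Sym2 (Fin n)), CliqueCover.IsAlgorithmOutput G S →
        CliqueCover.IsOptimalCompletionSet 3 1 G S ∧
        (∀ c : CliqueCover.BridgeComponent G, 3 ≤ c.supp.ncard →
          CliqueCover.IsOptimalCompletionSet 3 1
            ((CliqueCover.bridgeGraph G).induce c.supp)
            (Sym2.map (Subtype.val : c.supp → Fin n) ⁻¹' S)) ∧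
        (∀ c : CliqueCover.BridgeComponent G, c.supp.ncard = 2 →
          ∃ u v w : Fin n, c.supp = {u, v} ∧ G.Adj u w ∧ G.dist v w = 2 ∧ s(v, w) ∈ S ∧
            ∀ x : Fin n, (CliqueCover.addEdges G S).Adj u x →
              (CliqueCover.addEdges G S).Adj v x → x = w)) ∧
    -- the algorithm runs in linear time
    (∃ (P : CliqueCover.Program) (C : ℕ),
      ∀ (n : ℕ) (G : SimpleGraph (Fin n)), 3 ≤ n → G.Connected → CliqueCover.IsChordal G →
        ∀ A : CliqueCover.AdjLists G,
          ∃ (t : ℕ) (M : CliqueCover.Memory) (S : Set (Sym2 (Fin n))),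
            CliqueCover.Exec P A.initial t M ∧
            t ≤ C * (n + G.edgeSet.ncard) ∧
            M.Outputs S ∧
            CliqueCover.IsAlgorithmOutput G S ∧
            CliqueCover.IsOptimalCompletionSet 3 1 G S) := by
  refine ⟨fun n G _ hG hc S hS ↦ ?_, CliqueCover.algorithm, CliqueCover.timeFactor,
    fun n G hn hG hc A ↦ ?_⟩
  · obtain ⟨add, h⟩ := hS.exists_outputData
    exact ⟨h.isOptimal hG hc, fun c hc ↦ h.isOptimal_tree hc, fun c hc ↦ h.pair_unique hc⟩
  · obtain ⟨t, M, S, h1, h2, h3, h4⟩ := CliqueCover.algorithm_spec hn hG hc A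
    obtain ⟨add, h⟩ := h4.exists_outputData
    exact ⟨t, M, S, h1, h2, h3, h4, h.isOptimal hG hc⟩
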